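/- Fix an integer $m\ge 1$, put $n=2m+2$, and fix $\rho>1$. Let $\mathbb A_\rho=\{\lambda\in\mathbb C:1/\rho<|\lambda|<\rho\}$ and let $\mathcal W^{\ge0}_{\mathbb R}$ be the real Banach space of series $f(\lambda)=\sum_{k\ge0}f_k\lambda^k$, $f_k\in\mathbb R$, with norm $\|f\|_\rho=\sum_k|f_k|\rho^k<\infty$; write $f^0=f_0$. For $\mathbf x=(r,a,b,c)\in\mathbb R\times(\mathcal W^{\ge0}_{\mathbb R})^3$ and $t\in\mathbb R$ let $$\eta_t^{\mathbf x}(z,\lambda)=\begin{pmatrix}0&0\\ mrz^{m-1}&0\end{pmatrix}dz+t\sum_{j=0}^{n-1}A_j(\lambda)\frac{dz}{z-p_j},\qquad p_j=e^{2\pi i j/n},$$ where $$A_0(\lambda)=\begin{pmatrix}a(\lambda)&\lambda^{-1}b(\lambda)\\ \lambda c(\lambda)&-a(\lambda)\end{pmatrix},\qquad A_{j+1}(\lambda)=D^{-1}A_j(-\lambda)D,\qquad D=\mathrm{diag}(e^{i\pi m/n},e^{-i\pi m/n}).$$ Let $M(t,\mathbf x)(\lambda)$ be the monodromy, along the counterclockwise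 simple loop $\gamma_0$ based at $0$ given by the petal $R=2\cos(n\theta/2)$, $|\theta|\le\pi/n$ (which encloses $p_0=1$ and no other $p_j$), of the solution of $d\Phi=\Phi\,\eta_t^{\mathbf x}$, $\Phi(z=0)=\mathrm{Id}$. Put $\widetilde M=\frac1t\log M$ for $t\neq0$ (power series of $\log$ at $\mathrm{Id}$) and $\widetilde M(0,\mathbf x)=\partial_tM(t,\mathbf x)|_{t=0}$, and let $f^*(\lambda)=\overline{f(1/\bar\lambda)}$. Consider the equations $$\widetilde M_{11}+\widetilde M_{11}^*=0,\quad \widetilde M_{21}+\widetilde M_{12}^*=0\ \text{ on }\mathbb A_\rho,\quad \widetilde M_{12}(\lambda=1)=\widetilde M_{12}(\lambda=-1)=0,\quad (a^0)^2+b^0c^0=1,\tag{E}$$ and let $\mathbf x_0$ be given by $r=1$, $a=\lambda$, $b=\frac{\lambda^2-1}2$, $c=-2$. 1. There are $\varepsilon>0$, a neighbourhood $U$ of $\mathbf x_0$ and a family $\mathbf x(t)=(r(t),a(t),b(t),c(t))$, smooth on $(-\varepsilon,\varepsilon)$ with $\mathbf x(0)=\mathbf x_0$, such that for every $t\in(-\varepsilon,\varepsilon)$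 the point $\mathbf x(t)$ is the unique solution of (E) at time $t$ in $U$. 2. This family, and indeed every family $\mathbf x(t)$ with $\mathbf x(0)=\mathbf x_0$ that is continuous at $t=0$ and solves (E) for all $t$ near $0$, is smooth at $t=0$ and satisfies, for all $t$ near $0$, with $\eta_t=\eta_t^{\mathbf x(t)}$, $$\eta_{-t}(z,-\lambda)=\eta_t(z,\lambda)\qquad(\lambda\in\mathbb A_\rho,\ z\in\mathbb C\setminus\{p_0,\dots,p_{n-1}\}),$$ and, for $|\lambda|<\rho$, $$a(-t)(-\lambda)=-a(t)(\lambda),\quad b(-t)(-\lambda)=b(t)(\lambda),\quad c(-t)(-\lambda)=c(t)(\lambda),\quad r(-t)=r(t).$$ In particular, for every even $k\ge0$, $\frac{d^k}{dt^k}a(t)\big|_{t=0}$ is an odd function of $\lambda$ and vanishes at $\lambda=0$. 3. The two forms of the parity are equivalent: for every $t\ne0$ and all parameters $\mathbf x=(r,a,b,c)$, $\hat{\mathbf x}=(\hat r,\hat a,\hat b,\hat c)$, one has $\eta^{\hat{\mathbf x}}_{-t}(z,-\lambda)=\eta^{\mathbf x}_t(z,\lambda)$ for all $\lambda\in\mathbb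 A_\rho$ and $z\in\mathbb C\setminus\{p_0,\dots,p_{n-1}\}$ if and only if, for $|\lambda|<\rho$, $\hat a(-\lambda)=-a(\lambda)$, $\hat b(-\lambda)=b(\lambda)$, $\hat c(-\lambda)=c(\lambda)$, and $\hat r=r$. -/

import Mathlib

open scoped ContDiff Topology

namespace DPW

noncomputable section

/-- Real power series `∑ f_k λ^k` with `∑ |f_k| ρ^k < ∞`, as a subspace of all coefficient
sequences. -/
def wSubmodule (ρ : ℝ) [Fact (1 < ρ)] : Submodule ℝ (ℕ → ℝ) where
  carrier := {f | Summable fun k => |f k| * ρ ^ k}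
  zero_mem' := by
    change Summable fun k => |(0 : ℕ → ℝ) k| * ρ ^ k
    simp
  add_mem' := by
    intro f g hf hg
    have hρ : 0 < ρ := lt_trans one_pos (Fact.out : 1 < ρ)
    refine Summable.of_nonneg_of_le (fun k => by positivity) (fun k => ?_) (hf.add hg)
    rw [← add_mul]
    exact mul_le_mul_of_nonneg_right (abs_add_le _ _) (by positivity)
  smul_mem' := by
    intro c f hf
    have h := Summable.mul_left |c| hf
    refine h.congr (fun k => ?_)
    simp [abs_mul, mul_assoc]

/-- The space of loops `f(λ) = ∑_{k ≥ 0} f_k λ^k` with real Fourier coefficients and finite norm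
`‖f‖_ρ = ∑ |f_k| ρ^k`. An element is represented by its coefficient sequence. -/
def W (ρ : ℝ) [Fact (1 < ρ)] : Type := wSubmodule ρ

variable {ρ : ℝ} [Fact (1 < ρ)]

instance : AddCommGroup (W ρ) := inferInstanceAs (AddCommGroup (wSubmodule ρ))

instance : Module ℝ (W ρ) := inferInstanceAs (Module ℝ (wSubmodule ρ))

/-- The `k`-th Fourier coefficient. -/
def W.coeff (f : W ρ) (k : ℕ) : ℝ := f.1 k

instance : Norm (W ρ) := ⟨fun f => ∑' k, |f.coeff k| * ρ ^ k⟩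

theorem W.summable (f : W ρ) : Summable fun k => |f.coeff k| * ρ ^ k := f.2

theorem W.norm_def (f : W ρ) : ‖f‖ = ∑' k, |f.coeff k| * ρ ^ k := rfl

theorem W.coeff_add (f g : W ρ) (k : ℕ) : (f + g).coeff k = f.coeff k + g.coeff k := rfl

theorem W.coeff_smul (c : ℝ) (f : W ρ) (k : ℕ) : (c • f).coeff k = c * f.coeff k := rfl

theorem W.coeff_zero (k : ℕ) : (0 : W ρ).coeff k = 0 := rfl

theorem W.ext {f g : W ρ} (h : ∀ k, f.coeff k = g.coeff k) : f = g :=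
  Subtype.ext (funext h)

theorem W.core : NormedSpace.Core ℝ (W ρ) where
  norm_nonneg f := by
    have hρ : 0 < ρ := lt_trans one_pos (Fact.out : 1 < ρ)
    exact tsum_nonneg fun k => by positivity
  norm_smul c f := by
    rw [W.norm_def, W.norm_def, Real.norm_eq_abs, ← tsum_mul_left]
    refine tsum_congr fun k => ?_
    rw [W.coeff_smul, abs_mul, mul_assoc]
  norm_triangle f g := by
    have hρ : 0 < ρ := lt_trans one_pos (Fact.out : 1 < ρ)
    rw [W.norm_def, W.norm_def, W.norm_def, ← f.summable.tsum_add g.summable]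
    refine Summable.tsum_le_tsum (fun k => ?_) (f + g).summable (f.summable.add g.summable)
    rw [W.coeff_add, ← add_mul]
    exact mul_le_mul_of_nonneg_right (abs_add_le _ _) (by positivity)
  norm_eq_zero_iff f := by
    have hρ : 0 < ρ := lt_trans one_pos (Fact.out : 1 < ρ)
    constructor
    · intro h
      have h0 : HasSum (fun k => |f.coeff k| * ρ ^ k) 0 := by
        have := f.summable.hasSum
        rwa [← W.norm_def, h] at this
      rw [hasSum_zero_iff_of_nonneg (fun k => by positivity)] at h0
      refine W.ext fun k => ?_
      have hk := congrFun h0 k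
      simp only [Pi.zero_apply, mul_eq_zero, abs_eq_zero] at hk
      rcases hk with hk | hk
      · exact hk
      · exact absurd hk (by positivity)
    · rintro rfl
      simp [W.norm_def, W.coeff_zero]

instance : NormedAddCommGroup (W ρ) := NormedAddCommGroup.ofCore W.core

instance : NormedSpace ℝ (W ρ) := NormedSpace.ofCore W.core

/-- The value `f(λ) = ∑ f_k λ^k`, meaningful for `|λ| ≤ ρ`. -/
def W.eval (f : W ρ) (l : ℂ) : ℂ := ∑' k, (f.coeff k : ℂ) * l ^ k

/-- The loop given by a real polynomial in `λ`. -/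
def W.ofPoly (p : Polynomial ℝ) : W ρ :=
  ⟨fun k => p.coeff k, summable_of_ne_finset_zero (s := p.support) (fun k hk => by
    simp [Polynomial.notMem_support_iff.mp hk])⟩

/-- The parameter vector `𝐱 = (r, a, b, c)`. -/
abbrev Param (ρ : ℝ) [Fact (1 < ρ)] : Type := ℝ × W ρ × W ρ × W ρ

def Param.r (x : Param ρ) : ℝ := x.1

def Param.a (x : Param ρ) : W ρ := x.2.1

def Param.b (x : Param ρ) : W ρ := x.2.2.1

def Param.c (x : Param ρ) : W ρ := x.2.2.2

/-- The central value `r = 1`, `a = λ`, `b = (λ² - 1)/2`, `c = -2`. -/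
def Param.central (ρ : ℝ) [Fact (1 < ρ)] : Param ρ :=
  (1, W.ofPoly Polynomial.X,
    W.ofPoly (Polynomial.C (1 / 2) * (Polynomial.X ^ 2 - 1)), W.ofPoly (Polynomial.C (-2)))

/-- The open annulus `1/ρ < |λ| < ρ`. -/
def annulus (ρ : ℝ) : Set ℂ := {l | 1 / ρ < ‖l‖ ∧ ‖l‖ < ρ}

/-- The punctures `p_j = exp(2πij/n)`, `n = 2m+2`. -/
def puncture (m j : ℕ) : ℂ := Complex.exp (2 * Real.pi * Complex.I * j / (2 * m + 2 : ℕ))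

/-- `D = diag(exp(iπm/n), exp(-iπm/n))`, `n = 2m+2`. -/
def symD (m : ℕ) : Matrix (Fin 2) (Fin 2) ℂ :=
  !![Complex.exp (Complex.I * Real.pi * m / (2 * m + 2 : ℕ)), 0;
     0, Complex.exp (-(Complex.I * Real.pi * m / (2 * m + 2 : ℕ)))]

/-- The residues: `A_0 = (a, λ⁻¹b; λc, -a)` and `A_{j+1}(λ) = D⁻¹ A_j(-λ) D`. -/
def residue (m : ℕ) (x : Param ρ) : ℕ → ℂ → Matrix (Fin 2) (Fin 2) ℂ
  | 0, l => !![x.a.eval l, l⁻¹ * x.b.eval l; l * x.c.eval l, -x.a.eval l]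
  | j + 1, l => (symD m)⁻¹ * residue m x j (-l) * symD m

/-- The coefficient of `dz` in the potential `η_t^𝐱(z, λ)`. -/
def potential (m : ℕ) (t : ℝ) (x : Param ρ) (z l : ℂ) : Matrix (Fin 2) (Fin 2) ℂ :=
  !![0, 0; (m : ℂ) * x.r * z ^ (m - 1), 0] +
    (t : ℂ) • ∑ j ∈ Finset.range (2 * m + 2), (z - puncture m j)⁻¹ • residue m x j l

/-- The loop `γ_0(s)`, `0 ≤ s ≤ 1`, based at `0`: the petal with polar equation
`R = 2 cos(nθ/2)`, `-π/n ≤ θ ≤ π/n`, `n = 2m+2`, traversed counterclockwise. It is a simple closed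
curve enclosing the puncture `p_0 = 1` and no other puncture. -/
def loop (m : ℕ) (s : ℝ) : ℂ :=
  2 * Real.sin (Real.pi * s) *
    Complex.exp (Complex.I * Real.pi * (2 * s - 1) / (2 * m + 2 : ℕ))

/-- `Y` is the continuation along `γ_0` of the solution of `dΦ = Φ η_t^𝐱`, `Φ(0) = Id`
(for one fixed `λ`), i.e. `Y(s) = Φ(γ_0(s))`; the ODE is written entrywise. -/
def IsSolutionAlongLoop (m : ℕ) (t : ℝ) (x : Param ρ) (l : ℂ)
    (Y : ℝ → Matrix (Fin 2) (Fin 2) ℂ) : Prop :=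
  Y 0 = 1 ∧ ∀ s ∈ Set.Icc (0 : ℝ) 1, ∀ i j,
    HasDerivWithinAt (fun u => Y u i j)
      ((Y s * (deriv (loop m) s • potential m t x (loop m s) l)) i j) (Set.Icc 0 1) s

open Classical in
/-- The monodromy `M(t)(λ)` along `γ_0` of the solution of `dΦ = Φ η_t^𝐱`, `Φ(0) = Id`: the
value at the end point of `γ_0` of the solution continued along `γ_0`. -/
def monodromy (m : ℕ) (t : ℝ) (x : Param ρ) (l : ℂ) : Matrix (Fin 2) (Fin 2) ℂ :=
  if h : ∃ Y, IsSolutionAlongLoop m t x l Y then h.choose 1 else 1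

/-- The logarithm near the identity, by its power series. -/
def matrixLog (X : Matrix (Fin 2) (Fin 2) ℂ) : Matrix (Fin 2) (Fin 2) ℂ :=
  ∑' k : ℕ, ((-1 : ℂ) ^ k / (k + 1)) • (X - 1) ^ (k + 1)

/-- `M̃(t) = t⁻¹ log M(t)`, extended to `t = 0` by `M̃(0) = M'(0)`. -/
def logMonodromy (m : ℕ) (t : ℝ) (x : Param ρ) (l : ℂ) : Matrix (Fin 2) (Fin 2) ℂ :=
  if t = 0 then Matrix.of fun i j => deriv (fun s : ℝ => monodromy m s x l i j) 0
  else (t : ℂ)⁻¹ • matrixLog (monodromy m t x l)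

/-- The involution `f*(λ) = conj (f (1 / conj λ))`. -/
def starInv (f : ℂ → ℂ) (l : ℂ) : ℂ := starRingEnd ℂ (f (1 / starRingEnd ℂ l))

def calF (m : ℕ) (t : ℝ) (x : Param ρ) (l : ℂ) : ℂ :=
  1 / (2 * Real.pi * Complex.I) *
    (logMonodromy m t x l 0 0 + starInv (fun u => logMonodromy m t x u 0 0) l)

def calG (m : ℕ) (t : ℝ) (x : Param ρ) (l : ℂ) : ℂ :=
  1 / (2 * Real.pi * Complex.I) *
    (logMonodromy m t x l 1 0 + starInv (fun u => logMonodromy m t x u 0 1) l)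

def calH₁ (m : ℕ) (t : ℝ) (x : Param ρ) : ℂ :=
  1 / (2 * Real.pi * Complex.I) * logMonodromy m t x 1 0 1

def calH₂ (m : ℕ) (t : ℝ) (x : Param ρ) : ℂ :=
  1 / (2 * Real.pi * Complex.I) * logMonodromy m t x (-1) 0 1

/-- `-det A_0` at `λ = 0`, that is `(a⁰)² + b⁰c⁰`. -/
def calK (x : Param ρ) : ℝ := x.a.coeff 0 ^ 2 + x.b.coeff 0 * x.c.coeff 0

/-- The equations of the monodromy problem: `F = 0`, `G = 0` (as loops), `H₁ = H₂ = 0`, `K = 1`. -/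
def SolvesMonodromyProblem (m : ℕ) (t : ℝ) (x : Param ρ) : Prop :=
  (∀ l ∈ annulus ρ, calF m t x l = 0) ∧ (∀ l ∈ annulus ρ, calG m t x l = 0) ∧
    calH₁ m t x = 0 ∧ calH₂ m t x = 0 ∧ calK x = 1

/-- A family `𝐱(t)` through the central value at `t = 0`, continuous there, that solves the
monodromy problem for all `t` close to `0`. -/
def IsSolutionFamily (m : ℕ) (x : ℝ → Param ρ) : Prop :=
  x 0 = Param.central ρ ∧ ContinuousAt x 0 ∧ ∀ᶠ t in 𝓝 (0 : ℝ), SolvesMonodromyProblem m t (x t)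

/-- `η_{-t}^𝐲(z, -λ) = η_t^𝐱(z, λ)` for all `λ` in the annulus and all `z` off the punctures. -/
def PotentialParity (m : ℕ) (t : ℝ) (x y : Param ρ) : Prop :=
  ∀ l ∈ annulus ρ, ∀ z : ℂ, (∀ j < 2 * m + 2, z ≠ puncture m j) →
    potential m (-t) y z (-l) = potential m t x z l

/-- With `𝐱 = (r, a, b, c)` and `𝐲 = (r̂, â, b̂, ĉ)`: `â(-λ) = -a(λ)`, `b̂(-λ) = b(λ)`,
`ĉ(-λ) = c(λ)`, `r̂ = r`. -/
def ParamParity (x y : Param ρ) : Prop :=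
  (∀ l : ℂ, ‖l‖ < ρ → y.a.eval (-l) = -x.a.eval l) ∧
  (∀ l : ℂ, ‖l‖ < ρ → y.b.eval (-l) = x.b.eval l) ∧
  (∀ l : ℂ, ‖l‖ < ρ → y.c.eval (-l) = x.c.eval l) ∧
  y.r = x.r

end

end DPW

open DPW

namespace DPW

noncomputable section

variable {ρ : ℝ} [Fact (1 < ρ)]

/-! Near `(0, 𝐱₀)` the system (E) is the zero set of one analytic map between real Banach spaces.
Existence, uniqueness and smoothness come from the implicit function theorem, and the parity is a
consequence of uniqueness.

Analyticity at `t = 0`. There the equation is solved by `P = (1, 0; r z^m, 1)`. Writing `Φ = N P`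
turns `dΦ = Φ η` into `N' = t N B` along the petal, where `B` (`gauged`) is polynomial in the
parameters and takes values in the Banach algebra `LoopMat` of matrices of Laurent series. A Neumann
series gives `N(1) = 1 + t Q` with `Q` analytic in `(t, B)`, and `log N(1) / t = Q * logQuot (t Q)`
involves no division by `t` (`contDiffAt_logMat`). Evaluation at `λ` recovers the pointwise
monodromy by uniqueness for linear equations (`logMonodromy_eq`).

Reality. Conjugation carries the potential at `λ` to the one at `conj λ` and reverses the petal, so
`conj M(conj λ)` is inverse to `M(λ)`. The logarithm changes sign under inversion, hence the entries
of `M̃ / 2πi` that occur in (E) have real Laurent coefficients (`logEntry_im`). The star is then, up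
to sign, `λ ↦ 1/λ`, and (E) becomes `loopEq = 0` in real Fourier coefficients (`solves_iff_loopEq`).

Linearisation. At `t = 0` only the pole at `1` contributes, so `M̃ = 2πi P A_0 P⁻¹` with `P` taken
at `z = 1`. The derivative at `𝐱₀` is triangular on high coefficients, and a small invertible system
remains (`linEq_isInvertible`).

Parity. Replacing `(r, a, b, c)` by `(r, -a(-λ), b(-λ), c(-λ))` negates the residues up to `λ ↦ -λ`,
so it trades `(t, λ)` for `(-t, -λ)` in the potential and sends solutions at `-t` to solutions at
`t`. It fixes `𝐱₀`, so uniqueness gives the symmetry of the family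
(`IsSolutionFamily.eventually_parity`). In the other direction, for `t ≠ 0` the residue of the
potential at `z = 1` determines `a`, `b`, `c` (`eq_parity_of_potentialParity`). -/

theorem rho_pos : 0 < ρ := lt_trans one_pos (Fact.out : 1 < ρ)

theorem rho_ge_one : 1 ≤ ρ := (Fact.out : 1 < ρ).le

/-! ### The Banach algebra of Laurent series and its evaluations. -/

/-- The two-sided Wiener algebra of Laurent series `∑ v_k λ^k` with `∑ |v_k| ρ^|k| < ∞`; the
underlying `ℓ¹` sequence is `v_k ρ^|k|`. -/
def Laurent (ρ : ℝ) [Fact (1 < ρ)] : Type := lp (fun _ : ℤ => ℂ) 1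

namespace Laurent

instance : NormedAddCommGroup (Laurent ρ) :=
  inferInstanceAs (NormedAddCommGroup (lp (fun _ : ℤ => ℂ) 1))

instance : NormedSpace ℂ (Laurent ρ) := inferInstanceAs (NormedSpace ℂ (lp (fun _ : ℤ => ℂ) 1))

instance : CompleteSpace (Laurent ρ) := inferInstanceAs (CompleteSpace (lp (fun _ : ℤ => ℂ) 1))

/-- The monomial `λ^k`. -/
def T (k : ℤ) : Laurent ρ := lp.single (E := fun _ : ℤ => ℂ) 1 k ((ρ : ℂ) ^ k.natAbs)

/-- The `k`-th Laurent coefficient. -/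
def coeff (k : ℤ) (v : Laurent ρ) : ℂ :=
  (v : lp (fun _ : ℤ => ℂ) 1).1 k / (ρ : ℂ) ^ k.natAbs

theorem rho_pow_ne (k : ℕ) : (ρ : ℂ) ^ k ≠ 0 :=
  pow_ne_zero _ (by exact_mod_cast (rho_pos (ρ := ρ)).ne')

theorem norm_rho_pow (k : ℕ) : ‖(ρ : ℂ) ^ k‖ = ρ ^ k := by
  rw [norm_pow, Complex.norm_real, Real.norm_of_nonneg rho_pos.le]

theorem coeff_add (k : ℤ) (v w : Laurent ρ) : coeff k (v + w) = coeff k v + coeff k w :=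
  add_div _ _ _

theorem coeff_smul (k : ℤ) (c : ℂ) (v : Laurent ρ) : coeff k (c • v) = c * coeff k v :=
  mul_div_assoc _ _ _

theorem coeff_T (j k : ℤ) : coeff k (T j : Laurent ρ) = if k = j then 1 else 0 := by
  change (lp.single (E := fun _ : ℤ => ℂ) 1 j ((ρ : ℂ) ^ j.natAbs)).1 k / _ = _
  rw [lp.coeFn_single]
  split_ifs with h
  · subst h
    rw [Pi.single_eq_same, div_self (rho_pow_ne _)]
  · rw [Pi.single_eq_of_ne h, zero_div]

theorem hasSum_norm (v : Laurent ρ) :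
    HasSum (fun k : ℤ => ‖coeff k v‖ * ρ ^ k.natAbs) ‖v‖ := by
  have h := lp.hasSum_norm (p := 1) (by simp) (v : lp (fun _ : ℤ => ℂ) 1)
  simp only [ENNReal.toReal_one, Real.rpow_one] at h
  convert! h using 2 with k
  have h2 : 0 < ρ ^ k.natAbs := pow_pos rho_pos _
  rw [coeff, norm_div, norm_rho_pow, div_mul_cancel₀ _ h2.ne']

/-- Norm-convergent expansion in monomials: it reduces identities between continuous linear maps to
the monomials `T k`. -/
theorem hasSum_T (v : Laurent ρ) : HasSum (fun k : ℤ => coeff k v • (T k : Laurent ρ)) v := by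
  have h := lp.hasSum_single (p := 1) (by simp) (v : lp (fun _ : ℤ => ℂ) 1)
  have e : (fun k : ℤ => coeff k v • (T k : Laurent ρ)) = fun k =>
      lp.single (E := fun _ : ℤ => ℂ) 1 k ((v : lp (fun _ : ℤ => ℂ) 1).1 k) := by
    funext k
    have := lp.single_smul (E := fun _ : ℤ => ℂ) 1 k (coeff k v) ((ρ : ℂ) ^ k.natAbs)
    rw [smul_eq_mul, coeff, div_mul_cancel₀ _ (rho_pow_ne _)] at this
    exact this.symm
  rw [e]
  exact h

theorem norm_T (k : ℤ) : ‖(T k : Laurent ρ)‖ = ρ ^ k.natAbs := by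
  have := lp.norm_single (E := fun _ : ℤ => ℂ) (p := 1) (by simp) k ((ρ : ℂ) ^ k.natAbs)
  rw [norm_rho_pow] at this
  exact this

@[ext]
theorem ext {v w : Laurent ρ} (h : ∀ k, coeff k v = coeff k w) : v = w :=
  by
  have hw := hasSum_T w
  simp only [← h] at hw
  exact (hasSum_T v).unique hw

section lift

variable {E : Type*} [NormedAddCommGroup E] [NormedSpace ℂ E]

theorem norm_lift_term_le {u : ℤ → E} {C : ℝ} (hu : ∀ k, ‖u k‖ ≤ C * ρ ^ k.natAbs)
    (v : Laurent ρ) (k : ℤ) : ‖coeff k v • u k‖ ≤ C * (‖coeff k v‖ * ρ ^ k.natAbs) := by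
  rw [norm_smul]
  calc _ ≤ ‖coeff k v‖ * (C * ρ ^ k.natAbs) := by gcongr; exact hu k
    _ = _ := by ring

variable [CompleteSpace E]

theorem summable_lift {u : ℤ → E} {C : ℝ} (hu : ∀ k, ‖u k‖ ≤ C * ρ ^ k.natAbs)
    (v : Laurent ρ) : Summable fun k => coeff k v • u k :=
  Summable.of_norm_bounded ((hasSum_norm v).summable.mul_left C) (norm_lift_term_le hu v)

/-- The continuous linear map with prescribed values on the monomials. -/
def lift (u : ℤ → E) (C : ℝ) (hu : ∀ k, ‖u k‖ ≤ C * ρ ^ k.natAbs) : Laurent ρ →L[ℂ] E :=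
  LinearMap.mkContinuous
    { toFun := fun v => ∑' k, coeff k v • u k
      map_add' := fun v w => by
        simp only [coeff_add, add_smul]
        exact (summable_lift hu v).tsum_add (summable_lift hu w)
      map_smul' := fun c v => by
        simp only [coeff_smul, mul_smul, RingHom.id_apply]
        exact (summable_lift hu v).tsum_const_smul c } C
    (fun v => tsum_of_norm_bounded ((hasSum_norm v).mul_left C) (norm_lift_term_le hu v))

theorem lift_apply (u : ℤ → E) (C : ℝ) (hu : ∀ k, ‖u k‖ ≤ C * ρ ^ k.natAbs) (v : Laurent ρ) :
    lift u C hu v = ∑' k, coeff k v • u k := rfl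

@[simp]
theorem lift_T (u : ℤ → E) (C : ℝ) (hu : ∀ k, ‖u k‖ ≤ C * ρ ^ k.natAbs) (k : ℤ) :
    lift u C hu (T k : Laurent ρ) = u k := by
  rw [lift_apply, tsum_eq_single k]
  · simp [coeff_T]
  · intro j hj
    simp [coeff_T, hj]

theorem norm_lift_le (u : ℤ → E) (C : ℝ) (hu : ∀ k, ‖u k‖ ≤ C * ρ ^ k.natAbs) (hC : 0 ≤ C) :
    ‖lift u C hu‖ ≤ C :=
  LinearMap.mkContinuous_norm_le _ hC _

/-- The workhorse of this part. Commutativity, associativity and multiplicativity of evaluation are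
stated as equalities of continuous multilinear maps and then checked on monomials only, where they
are identities between exponents. -/
theorem clm_ext {F : Type*} [AddCommMonoid F] [Module ℂ F] [TopologicalSpace F] [T2Space F]
    {f g : Laurent ρ →L[ℂ] F} (h : ∀ k, f (T k) = g (T k)) : f = g := by
  ext v
  have hf := (hasSum_T v).mapL f
  have hg := (hasSum_T v).mapL g
  simp only [map_smul, h] at hf hg
  exact hf.unique hg

end lift

/-- Multiplication by `λ^j`. -/
def shift (j : ℤ) : Laurent ρ →L[ℂ] Laurent ρ :=
  lift (fun k => T (j + k)) (ρ ^ j.natAbs) fun k => by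
    rw [norm_T, ← pow_add]
    exact pow_le_pow_right₀ rho_ge_one (Int.natAbs_add_le j k)

/-- Multiplication of Laurent series, as a continuous bilinear map. -/
def mulL : Laurent ρ →L[ℂ] Laurent ρ →L[ℂ] Laurent ρ :=
  lift shift 1 fun k => by
    rw [one_mul]
    exact norm_lift_le _ _ _ (pow_pos rho_pos _).le

theorem mulL_T (j k : ℤ) : mulL (T j) (T k : Laurent ρ) = T (j + k) := by
  simp [mulL, shift]

theorem mulL_comm (v w : Laurent ρ) : mulL v w = mulL w v := by
  have : (mulL : Laurent ρ →L[ℂ] _) = mulL.flip := by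
    refine clm_ext fun j => clm_ext fun k => ?_
    rw [ContinuousLinearMap.flip_apply, mulL_T, mulL_T, add_comm]
  exact congrArg (fun f => f v w) this

theorem mulL_assoc (u v w : Laurent ρ) : mulL (mulL u v) w = mulL u (mulL v w) := by
  -- Both sides are the curried trilinear maps `(u, v, w) ↦ (u v) w` and `(u, v, w) ↦ u (v w)`.
  have : (ContinuousLinearMap.compL ℂ (Laurent ρ) (Laurent ρ) (Laurent ρ →L[ℂ] Laurent ρ) mulL) ∘L
      (mulL : Laurent ρ →L[ℂ] _) =
      (((ContinuousLinearMap.compL ℂ (Laurent ρ) (Laurent ρ →L[ℂ] Laurent ρ)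
        (Laurent ρ →L[ℂ] Laurent ρ)).flip (mulL : Laurent ρ →L[ℂ] _)) ∘L
        ContinuousLinearMap.compL ℂ (Laurent ρ) (Laurent ρ) (Laurent ρ)) ∘L
        (mulL : Laurent ρ →L[ℂ] _) := by
    refine clm_ext fun i => clm_ext fun j => clm_ext fun k => ?_
    simp [mulL_T, add_assoc]
  exact congrArg (fun f => f u v w) this

theorem one_mulL (v : Laurent ρ) : mulL (T 0) v = v := by
  have : mulL (T 0) = ContinuousLinearMap.id ℂ (Laurent ρ) :=
    clm_ext fun k => by simp [mulL_T]
  rw [this, ContinuousLinearMap.id_apply]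

instance : CommRing (Laurent ρ) where
  mul v w := mulL v w
  one := T 0
  left_distrib u v w := map_add (mulL u) v w
  right_distrib u v w := by
    change mulL (u + v) w = mulL u w + mulL v w
    rw [map_add, add_apply]
  zero_mul v := by
    change mulL 0 v = 0
    rw [map_zero, zero_apply]
  mul_zero v := map_zero (mulL v)
  mul_assoc := mulL_assoc
  one_mul := one_mulL
  mul_one v := (mulL_comm _ _).trans (one_mulL v)
  mul_comm := mulL_comm
  -- The integer and natural multiples are those of the existing normed group, so the two additive
  -- structures agree.
  zsmul n v := n • v
  zsmul_zero' v := zero_zsmul v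
  zsmul_succ' n v := SubNegMonoid.zsmul_succ' n v
  zsmul_neg' n v := SubNegMonoid.zsmul_neg' n v
  nsmul n v := n • v
  nsmul_zero v := zero_nsmul v
  nsmul_succ n v := succ_nsmul v n
  neg_add_cancel v := neg_add_cancel v
  sub_eq_add_neg v w := sub_eq_add_neg v w

theorem one_def : (1 : Laurent ρ) = T 0 := rfl

theorem T_mul_T (j k : ℤ) : (T j : Laurent ρ) * T k = T (j + k) := mulL_T j k

instance : NormedCommRing (Laurent ρ) where
  dist_eq v w := NormedAddCommGroup.dist_eq v w
  norm_mul_le v w := by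
    refine (ContinuousLinearMap.le_opNorm _ _).trans ?_
    gcongr
    refine (ContinuousLinearMap.le_opNorm mulL v).trans ?_
    refine (mul_le_mul_of_nonneg_right (norm_lift_le _ _ _ zero_le_one) (norm_nonneg v)).trans ?_
    rw [one_mul]

instance : Algebra ℂ (Laurent ρ) :=
  Algebra.ofModule (fun c v w => by
      change mulL (c • v) w = c • mulL v w
      rw [map_smul, smul_apply])
    (fun c v w => map_smul (mulL v) c w)

instance : NormedAlgebra ℂ (Laurent ρ) where
  norm_smul_le c v := norm_smul_le c v

/-- The closed annulus on which all Laurent series of the algebra converge. -/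
theorem norm_zpow_le {l : ℂ} (h1 : 1 / ρ ≤ ‖l‖) (h2 : ‖l‖ ≤ ρ) (k : ℤ) :
    ‖l ^ k‖ ≤ 1 * ρ ^ k.natAbs := by
  have hρ := rho_pos (ρ := ρ)
  have hl : 0 < ‖l‖ := lt_of_lt_of_le (by positivity) h1
  rw [one_mul, norm_zpow]
  rcases Int.natAbs_eq k with h | h
  · conv_lhs => rw [h]
    rw [zpow_natCast]
    exact pow_le_pow_left₀ hl.le h2 _
  · conv_lhs => rw [h]
    rw [zpow_neg, zpow_natCast, ← inv_pow]
    refine pow_le_pow_left₀ (by positivity) ?_ _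
    rw [inv_le_comm₀ hl hρ, ← one_div]
    exact h1

open Classical in
/-- The value of a Laurent series at a point of the closed annulus. -/
def ev (l : ℂ) : Laurent ρ →L[ℂ] ℂ :=
  if h : 1 / ρ ≤ ‖l‖ ∧ ‖l‖ ≤ ρ then lift (fun k => l ^ k) 1 (norm_zpow_le h.1 h.2) else 0

theorem ne_zero_of_mem {l : ℂ} (hl : l ∈ annulus ρ) : l ≠ 0 := by
  rintro rfl
  have := hl.1
  rw [norm_zero] at this
  exact absurd this (not_lt.mpr (by have := rho_pos (ρ := ρ); positivity))

theorem ev_apply {l : ℂ} (hl : l ∈ annulus ρ) (v : Laurent ρ) :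
    ev l v = ∑' k, coeff k v * l ^ k := by
  rw [ev, dif_pos ⟨hl.1.le, hl.2.le⟩]
  rfl

theorem ev_T {l : ℂ} (hl : l ∈ annulus ρ) (k : ℤ) : ev l (T k : Laurent ρ) = l ^ k := by
  rw [ev, dif_pos ⟨hl.1.le, hl.2.le⟩, lift_T]

theorem ev_mul {l : ℂ} (hl : l ∈ annulus ρ) (v w : Laurent ρ) :
    ev l (v * w) = ev l v * ev l w := by
  have : ContinuousLinearMap.compL ℂ (Laurent ρ) (Laurent ρ) ℂ (ev l) ∘L
      (mulL : Laurent ρ →L[ℂ] _) =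
      (((ContinuousLinearMap.compL ℂ (Laurent ρ) ℂ ℂ).flip (ev l)) ∘L
        (ContinuousLinearMap.mul ℂ ℂ)) ∘L (ev l) := by
    refine clm_ext fun j => clm_ext fun k => ?_
    simp [mulL_T, ev_T hl, zpow_add₀ (ne_zero_of_mem hl)]
  exact congrArg (fun f => f v w) this

theorem ev_one {l : ℂ} (hl : l ∈ annulus ρ) : ev l (1 : Laurent ρ) = 1 := by
  rw [one_def, ev_T hl, zpow_zero]

end Laurent

end

end DPW

/-! ### Coefficients, real parts and the inversion `λ ↦ 1/λ`. -/

namespace DPW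

noncomputable section

variable {ρ : ℝ} [Fact (1 < ρ)]

namespace Laurent

theorem coeff_zero (k : ℤ) : coeff k (0 : Laurent ρ) = 0 := by
  simpa using coeff_smul k 0 (0 : Laurent ρ)

theorem coeff_sub (k : ℤ) (v w : Laurent ρ) : coeff k (v - w) = coeff k v - coeff k w := by
  have := coeff_add k (v - w) w
  rw [sub_add_cancel] at this
  rw [this, add_sub_cancel_right]

theorem coeff_real_smul (k : ℤ) (c : ℝ) (v : Laurent ρ) : coeff k (c • v) = c * coeff k v := by
  rw [← coeff_smul]
  rfl

/-- The coefficient functional. -/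
def coeffL (k : ℤ) : Laurent ρ →L[ℂ] ℂ :=
  LinearMap.mkContinuous
    { toFun := coeff k
      map_add' := coeff_add k
      map_smul' := fun c v => coeff_smul k c v } 1 (fun v => by
    rw [one_mul]
    have h := le_hasSum (hasSum_norm v) k fun j _ => by
      have := rho_pos (ρ := ρ)
      positivity
    refine le_trans ?_ h
    exact le_mul_of_one_le_right (norm_nonneg _) (one_le_pow₀ rho_ge_one))

theorem coeffL_apply (k : ℤ) (v : Laurent ρ) : coeffL k v = coeff k v := rfl

section liftRe

variable {E : Type*} [NormedAddCommGroup E] [NormedSpace ℝ E]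

theorem norm_liftRe_term_le {u : ℤ → E} {C : ℝ} (hu : ∀ k, ‖u k‖ ≤ C * ρ ^ k.natAbs)
    (v : Laurent ρ) (k : ℤ) : ‖(coeff k v).re • u k‖ ≤ C * (‖coeff k v‖ * ρ ^ k.natAbs) := by
  rw [norm_smul]
  calc _ ≤ ‖coeff k v‖ * (C * ρ ^ k.natAbs) := by
        gcongr
        · exact Complex.abs_re_le_norm _
        · exact hu k
    _ = _ := by ring

variable [CompleteSpace E]

theorem summable_liftRe {u : ℤ → E} {C : ℝ} (hu : ∀ k, ‖u k‖ ≤ C * ρ ^ k.natAbs)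
    (v : Laurent ρ) : Summable fun k => (coeff k v).re • u k :=
  Summable.of_norm_bounded ((hasSum_norm v).summable.mul_left C) (norm_liftRe_term_le hu v)

/-- The real-linear map `∑ v_k λ^k ↦ ∑ Re(v_k) u_k`. -/
def liftRe (u : ℤ → E) (C : ℝ) (hu : ∀ k, ‖u k‖ ≤ C * ρ ^ k.natAbs) : Laurent ρ →L[ℝ] E :=
  LinearMap.mkContinuous
    { toFun := fun v => ∑' k, (coeff k v).re • u k
      map_add' := fun v w => by
        simp only [coeff_add, Complex.add_re, add_smul]
        exact (summable_liftRe hu v).tsum_add (summable_liftRe hu w)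
      map_smul' := fun c v => by
        simp only [coeff_real_smul, Complex.re_ofReal_mul, mul_smul, RingHom.id_apply]
        exact (summable_liftRe hu v).tsum_const_smul c } C
    (fun v => tsum_of_norm_bounded ((hasSum_norm v).mul_left C) (norm_liftRe_term_le hu v))

theorem liftRe_apply (u : ℤ → E) (C : ℝ) (hu : ∀ k, ‖u k‖ ≤ C * ρ ^ k.natAbs) (v : Laurent ρ) :
    liftRe u C hu v = ∑' k, (coeff k v).re • u k := rfl

end liftRe

/-- The series with coefficients `Re(v_k)`. -/
def reL : Laurent ρ →L[ℝ] Laurent ρ := liftRe T 1 fun k => by rw [norm_T, one_mul]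

theorem coeff_reL (k : ℤ) (v : Laurent ρ) : coeff k (reL v) = (coeff k v).re := by
  have hs : Summable fun j : ℤ => (coeff j v).re • (T j : Laurent ρ) :=
    summable_liftRe (C := 1) (fun k => by rw [norm_T, one_mul]) v
  rw [reL, liftRe_apply, ← coeffL_apply, (coeffL k).map_tsum hs, tsum_eq_single k]
  · rw [coeffL_apply, coeff_real_smul, coeff_T, if_pos rfl, mul_one]
  · intro j hj
    rw [coeffL_apply, coeff_real_smul, coeff_T, if_neg hj.symm, mul_zero]

/-- The substitution `λ ↦ 1/λ`. -/
def reflect : Laurent ρ →L[ℂ] Laurent ρ :=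
  lift (fun k => T (-k)) 1 fun k => by rw [norm_T, one_mul, Int.natAbs_neg]

theorem coeff_reflect (k : ℤ) (v : Laurent ρ) : coeff k (reflect v) = coeff (-k) v := by
  have : (coeffL k ∘L reflect : Laurent ρ →L[ℂ] ℂ) = coeffL (-k) := by
    refine clm_ext fun j => ?_
    simp only [reflect, ContinuousLinearMap.comp_apply, lift_T, coeffL_apply, coeff_T]
    exact if_congr (by omega) rfl rfl
  exact congrArg (fun f => f v) this

theorem mem_annulus_of_norm_one {l : ℂ} (hl : ‖l‖ = 1) : l ∈ annulus ρ := by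
  have h := (Fact.out : 1 < ρ)
  refine ⟨?_, by rwa [hl]⟩
  rw [hl, div_lt_one rho_pos]
  exact h

theorem inv_mem_annulus {l : ℂ} (hl : l ∈ annulus ρ) : l⁻¹ ∈ annulus ρ := by
  have h := rho_pos (ρ := ρ)
  have h0 : 0 < ‖l‖ := norm_pos_iff.mpr (ne_zero_of_mem hl)
  refine ⟨?_, ?_⟩
  · rw [norm_inv, one_div]
    exact inv_strictAnti₀ h0 hl.2
  · rw [norm_inv]
    rw [inv_lt_comm₀ h0 h, ← one_div]
    exact hl.1

theorem neg_mem_annulus {ρ : ℝ} {l : ℂ} (hl : l ∈ annulus ρ) : -l ∈ annulus ρ := by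
  simpa [annulus] using hl

theorem conj_mem_annulus {ρ : ℝ} {l : ℂ} (hl : l ∈ annulus ρ) : starRingEnd ℂ l ∈ annulus ρ := by
  simpa [annulus] using hl

theorem ev_reflect {l : ℂ} (hl : l ∈ annulus ρ) (v : Laurent ρ) :
    ev l (reflect v) = ev l⁻¹ v := by
  have : (ev l ∘L reflect : Laurent ρ →L[ℂ] ℂ) = ev l⁻¹ := by
    refine clm_ext fun j => ?_
    simp [reflect, ev_T hl, ev_T (inv_mem_annulus hl)]
  exact congrArg (fun f => f v) this

/-- On the unit circle a Laurent series is an absolutely convergent Fourier series. If it vanishes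
there, pairing with the orthonormal system `fourierLp` isolates each coefficient. -/
theorem coeff_eq_zero_of_ev {v : Laurent ρ} (h : ∀ l ∈ annulus ρ, ev l v = 0) (k : ℤ) :
    coeff k v = 0 := by
  have hsum : Summable fun j : ℤ => ‖coeff j v • (fourier j : C(AddCircle (1 : ℝ), ℂ))‖ := by
    refine Summable.of_nonneg_of_le (fun _ => norm_nonneg _) (fun j => ?_) (hasSum_norm v).summable
    have : Fact (0 < (1 : ℝ)) := ⟨one_pos⟩
    rw [norm_smul, fourier_norm]
    gcongr
    exact one_le_pow₀ rho_ge_one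
  have : Fact (0 < (1 : ℝ)) := ⟨one_pos⟩
  have h0 : HasSum (fun j : ℤ => coeff j v • (fourier j : C(AddCircle (1 : ℝ), ℂ))) 0 := by
    have hz : ∑' j : ℤ, coeff j v • (fourier j : C(AddCircle (1 : ℝ), ℂ)) = 0 := by
      ext x
      refine (ContinuousMap.tsum_apply hsum.of_norm x).symm.trans ?_
      have hx : ((fourier 1 x : ℂ)) ∈ annulus ρ :=
        mem_annulus_of_norm_one (by rw [fourier_apply]; exact Circle.norm_coe _)
      have := h _ hx
      rw [ev_apply hx] at this
      rw [ContinuousMap.zero_apply, ← this]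
      refine tsum_congr fun j => ?_
      rw [ContinuousMap.smul_apply, smul_eq_mul, fourier_apply, fourier_apply, one_smul,
        AddCircle.toCircle_zsmul, Circle.coe_zpow]
    rw [← hz]
    exact hsum.of_norm.hasSum
  -- The sum converges uniformly, hence in `L²`, where inner products may be taken term by term.
  have h1 := h0.mapL (ContinuousMap.toLp (E := ℂ) 2 AddCircle.haarAddCircle ℂ)
  have h2 := h1.mapL (innerSL ℂ (fourierLp (T := (1 : ℝ)) 2 k))
  simp only [map_smul, map_zero, innerSL_apply_apply, smul_eq_mul] at h2
  have h3 := h2.unique (hasSum_single k fun j hj => by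
    have := orthonormal_fourier (T := (1 : ℝ)).2 hj.symm
    exact mul_eq_zero_of_right _ this)
  have h4 : inner ℂ (fourierLp (T := (1 : ℝ)) 2 k)
      (ContinuousMap.toLp (E := ℂ) 2 AddCircle.haarAddCircle ℂ (fourier k)) = 1 := by
    have := orthonormal_fourier (T := (1 : ℝ)).1 k
    rw [← fourierLp, inner_self_eq_norm_sq_to_K, this]
    simp
  rw [h4, mul_one] at h3
  exact h3.symm

/-- The coefficients of `λ ↦ conj v(conj λ)` are `conj v_k = 2 Re v_k - v_k`. This form avoids a
separate conjugate-linear operator. -/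
theorem ev_conj {l : ℂ} (hl : l ∈ annulus ρ) (v : Laurent ρ) :
    starRingEnd ℂ (ev (starRingEnd ℂ l) v) = ev l (2 * reL v - v) := by
  rw [ev_apply hl, ev_apply (conj_mem_annulus hl), Complex.conj_tsum]
  refine tsum_congr fun k => ?_
  rw [two_mul, coeff_sub, coeff_add, coeff_reL, map_mul, map_zpow₀, Complex.conj_conj]
  congr 1
  apply Complex.ext <;> simp

/-- A Laurent series that is real in the sense `conj v(conj λ) = v(λ)` has real coefficients. -/
theorem coeff_im_eq_zero {v : Laurent ρ}
    (h : ∀ l ∈ annulus ρ, starRingEnd ℂ (ev (starRingEnd ℂ l) v) = ev l v) (k : ℤ) :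
    (coeff k v).im = 0 := by
  have := coeff_eq_zero_of_ev (v := 2 * reL v - v - v) (fun l hl => by
    rw [map_sub, ← ev_conj hl, h l hl, sub_self]) k
  rw [two_mul, coeff_sub, coeff_sub, coeff_add, coeff_reL] at this
  have h2 := congrArg Complex.im this
  simp at h2
  linarith

end Laurent

end

end DPW

/-! ### The real power series space `W`, its projections and its completeness. -/

namespace DPW

noncomputable section

variable {ρ : ℝ} [Fact (1 < ρ)]

namespace W

/-- The coefficient functional. -/
def coeffL (k : ℕ) : W ρ →L[ℝ] ℝ :=
  LinearMap.mkContinuous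
    { toFun := fun f => f.coeff k
      map_add' := fun f g => W.coeff_add f g k
      map_smul' := fun c f => W.coeff_smul c f k } 1 (fun f => by
    rw [one_mul]
    have h := le_hasSum f.summable.hasSum k fun j _ => by
      have := rho_pos (ρ := ρ)
      positivity
    refine le_trans ?_ h
    exact le_mul_of_one_le_right (norm_nonneg _) (one_le_pow₀ rho_ge_one))

theorem coeffL_apply (k : ℕ) (f : W ρ) : coeffL k f = f.coeff k := rfl

theorem norm_term_le (f : W ρ) (k : ℕ) :
    ‖f.coeff k • (Laurent.T k : Laurent ρ)‖ ≤ |f.coeff k| * ρ ^ k := by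
  rw [norm_smul, Laurent.norm_T, Int.natAbs_natCast, Real.norm_eq_abs]

theorem summable_T (f : W ρ) : Summable fun k : ℕ => f.coeff k • (Laurent.T k : Laurent ρ) :=
  Summable.of_norm_bounded f.summable (norm_term_le f)

/-- The inclusion of the power series into the Laurent series. -/
def toLaurent : W ρ →L[ℝ] Laurent ρ :=
  LinearMap.mkContinuous
    { toFun := fun f => ∑' k : ℕ, f.coeff k • (Laurent.T k : Laurent ρ)
      map_add' := fun f g => by
        simp only [W.coeff_add, add_smul]
        exact (summable_T f).tsum_add (summable_T g)
      map_smul' := fun c f => by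
        simp only [W.coeff_smul, mul_smul, RingHom.id_apply]
        exact (summable_T f).tsum_const_smul c } 1
    (fun f => by
      rw [one_mul]
      exact tsum_of_norm_bounded f.summable.hasSum (norm_term_le f))

theorem hasSum_toLaurent (f : W ρ) :
    HasSum (fun k : ℕ => f.coeff k • (Laurent.T k : Laurent ρ)) (toLaurent f) :=
  (summable_T f).hasSum

theorem coeff_toLaurent (f : W ρ) (j : ℤ) :
    Laurent.coeff j (toLaurent f) = if 0 ≤ j then (f.coeff j.toNat : ℂ) else 0 := by
  have h := (hasSum_toLaurent f).mapL ((Laurent.coeffL j).restrictScalars ℝ)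
  simp only [ContinuousLinearMap.coe_restrictScalars', Laurent.coeffL_apply,
    Laurent.coeff_real_smul, Laurent.coeff_T] at h
  split_ifs with hj
  · refine h.unique ?_
    convert hasSum_single j.toNat fun k hk => ?_ using 1
    · rw [if_pos (Int.toNat_of_nonneg hj).symm, mul_one]
    · rw [if_neg (by omega), mul_zero]
  · refine h.unique ?_
    convert (hasSum_zero : HasSum (fun _ : ℕ => (0 : ℂ)) 0) using 2 with k
    rw [if_neg (by omega), mul_zero]

theorem coeff_natCast_toLaurent (f : W ρ) (k : ℕ) :
    Laurent.coeff (k : ℤ) (toLaurent f) = f.coeff k := by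
  rw [coeff_toLaurent, if_pos (by omega), Int.toNat_natCast]

theorem ev_toLaurent {l : ℂ} (hl : l ∈ annulus ρ) (f : W ρ) :
    Laurent.ev l (toLaurent f) = f.eval l := by
  have h := (hasSum_toLaurent f).mapL ((Laurent.ev l).restrictScalars ℝ)
  simp only [map_smul, ContinuousLinearMap.coe_restrictScalars', Complex.real_smul,
    Laurent.ev_T hl, zpow_natCast] at h
  exact h.tsum_eq.symm

theorem toLaurent_ext {f g : W ρ} (h : ∀ l ∈ annulus ρ, f.eval l = g.eval l) : f = g := by
  refine W.ext fun k => ?_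
  have := Laurent.coeff_eq_zero_of_ev (v := toLaurent f - toLaurent g) (fun l hl => by
    rw [map_sub, ev_toLaurent hl, ev_toLaurent hl, h l hl, sub_self]) k
  rw [Laurent.coeff_sub, coeff_natCast_toLaurent, coeff_natCast_toLaurent, sub_eq_zero] at this
  exact_mod_cast this

section sample

variable {c : ℕ → ℝ} {τ : ℕ → ℤ} {C : ℝ}

/-- Weight comparison showing that the resampled sequence has finite `W` norm. One operator `sample`
then yields truncations, reflection and shifts, with boundedness proved once. -/
theorem sample_term_le (h : ∀ k, |c k| * ρ ^ k ≤ C * ρ ^ (τ k).natAbs) (v : Laurent ρ) (k : ℕ) :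
    |c k * (Laurent.coeff (τ k) v).re| * ρ ^ k ≤
      C * (‖Laurent.coeff (τ k) v‖ * ρ ^ (τ k).natAbs) := by
  rw [abs_mul]
  calc _ = |c k| * ρ ^ k * |(Laurent.coeff (τ k) v).re| := by ring
    _ ≤ C * ρ ^ (τ k).natAbs * ‖Laurent.coeff (τ k) v‖ :=
      mul_le_mul (h k) (Complex.abs_re_le_norm _) (abs_nonneg _)
        (le_trans (by have := rho_pos (ρ := ρ); positivity) (h k))
    _ = _ := by ring

/-- The real-linear map `∑ v_k λ^k ↦ ∑ c_k Re(v_{τ k}) λ^k`. -/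
def sample (c : ℕ → ℝ) (τ : ℕ → ℤ) (C : ℝ) (hC : 0 ≤ C) (hτ : Function.Injective τ)
    (h : ∀ k, |c k| * ρ ^ k ≤ C * ρ ^ (τ k).natAbs) : Laurent ρ →L[ℝ] W ρ :=
  have hs (v : Laurent ρ) : Summable fun k =>
      C * (‖Laurent.coeff (τ k) v‖ * ρ ^ (τ k).natAbs) :=
    ((Laurent.hasSum_norm v).summable.comp_injective hτ).mul_left C
  have hs' (v : Laurent ρ) : Summable fun k => |c k * (Laurent.coeff (τ k) v).re| * ρ ^ k :=
    Summable.of_nonneg_of_le (fun k => by have := rho_pos (ρ := ρ); positivity)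
      (sample_term_le h v) (hs v)
  LinearMap.mkContinuous
    { toFun := fun v => (⟨fun k => c k * (Laurent.coeff (τ k) v).re, hs' v⟩ : wSubmodule ρ)
      map_add' := fun v w => W.ext fun k => by
        change c k * (Laurent.coeff (τ k) (v + w)).re =
          c k * (Laurent.coeff (τ k) v).re + c k * (Laurent.coeff (τ k) w).re
        rw [Laurent.coeff_add, Complex.add_re, mul_add]
      map_smul' := fun r v => W.ext fun k => by
        change c k * (Laurent.coeff (τ k) (r • v)).re = r * (c k * (Laurent.coeff (τ k) v).re)
        rw [Laurent.coeff_real_smul, Complex.re_ofReal_mul]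
        ring } C (fun v => by
    have h1 := (hs' v).tsum_le_tsum (sample_term_le h v) (hs v)
    refine h1.trans ?_
    rw [tsum_mul_left]
    refine mul_le_mul_of_nonneg_left ?_ hC
    rw [← (Laurent.hasSum_norm v).tsum_eq]
    exact tsum_comp_le_tsum_of_inj (Laurent.hasSum_norm v).summable
      (fun k => by have := rho_pos (ρ := ρ); positivity) hτ)

end sample

/-- The coefficients `Re(v_{k+d})`, `k ≥ 0`. -/
def posPart (d : ℕ) : Laurent ρ →L[ℝ] W ρ :=
  sample (fun _ => 1) (fun k => k + d) 1 zero_le_one (fun i j h => by simpa using h) fun k => by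
    rw [abs_one]
    exact mul_le_mul_of_nonneg_left (pow_le_pow_right₀ rho_ge_one (by omega)) zero_le_one

theorem coeff_posPart (d : ℕ) (v : Laurent ρ) (k : ℕ) :
    (posPart d v).coeff k = (Laurent.coeff (k + d) v).re := one_mul _

/-- The coefficients `Re(v_{-k-d})`, `k ≥ 0`. -/
def negPart (d : ℕ) : Laurent ρ →L[ℝ] W ρ :=
  sample (fun _ => 1) (fun k => -(k + d : ℤ)) 1 zero_le_one (fun i j h => by simpa using h)
    fun k => by
      rw [abs_one]
      exact mul_le_mul_of_nonneg_left (pow_le_pow_right₀ rho_ge_one (by omega)) zero_le_one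

theorem coeff_negPart (d : ℕ) (v : Laurent ρ) (k : ℕ) :
    (negPart d v).coeff k = (Laurent.coeff (-(k + d : ℤ)) v).re := one_mul _

/-- The substitution `λ ↦ -λ`. -/
def reflect : W ρ →L[ℝ] W ρ :=
  sample (fun k => (-1) ^ k) (fun k => k) 1 zero_le_one (fun i j h => by simpa using h)
    (fun k => by simp) ∘L toLaurent

theorem coeff_reflect (f : W ρ) (k : ℕ) : (reflect f).coeff k = (-1) ^ k * f.coeff k := by
  change (-1) ^ k * (Laurent.coeff (k : ℤ) (toLaurent f)).re = _
  rw [coeff_natCast_toLaurent, Complex.ofReal_re]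

theorem eval_reflect (f : W ρ) (l : ℂ) : (reflect f).eval l = f.eval (-l) := by
  refine tsum_congr fun k => ?_
  rw [coeff_reflect, neg_pow l]
  push_cast
  ring

theorem reflect_reflect (f : W ρ) : reflect (reflect f) = f := by
  refine W.ext fun k => ?_
  rw [coeff_reflect, coeff_reflect, ← mul_assoc, ← mul_pow]
  simp

/-- Removal of the first `d` coefficients. -/
def tail (d : ℕ) : W ρ →L[ℝ] W ρ := posPart d ∘L toLaurent

theorem coeff_tail (d : ℕ) (f : W ρ) (k : ℕ) : (tail d f).coeff k = f.coeff (k + d) := by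
  rw [tail, ContinuousLinearMap.comp_apply, coeff_posPart, ← Nat.cast_add,
    coeff_natCast_toLaurent, Complex.ofReal_re]

/-- Multiplication by `λ^d`. -/
def shiftUp (d : ℕ) : W ρ →L[ℝ] W ρ :=
  sample (fun _ => 1) (fun k => k - d) (ρ ^ d) (pow_pos rho_pos d).le
    (fun i j h => by simpa using h) (fun k => by
      rw [abs_one, one_mul, ← pow_add]
      exact pow_le_pow_right₀ rho_ge_one (by omega)) ∘L toLaurent

theorem coeff_shiftUp (d : ℕ) (f : W ρ) (k : ℕ) :
    (shiftUp d f).coeff k = if d ≤ k then f.coeff (k - d) else 0 := by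
  change 1 * (Laurent.coeff ((k : ℤ) - d) (toLaurent f)).re = _
  rw [coeff_toLaurent, one_mul]
  split_ifs with h1 h2 h2
  · rw [show ((k : ℤ) - d).toNat = k - d by omega, Complex.ofReal_re]
  · omega
  · omega
  · rfl

/-- The polynomial `p₀ + p₁ λ + p₂ λ²`. -/
def quad (p₀ p₁ p₂ : ℝ) : W ρ :=
  ofPoly (Polynomial.C p₀ + Polynomial.C p₁ * Polynomial.X + Polynomial.C p₂ * Polynomial.X ^ 2)

theorem coeff_ofPoly (p : Polynomial ℝ) (k : ℕ) : (ofPoly p : W ρ).coeff k = p.coeff k := rfl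

theorem coeff_quad_zero (p₀ p₁ p₂ : ℝ) : (quad p₀ p₁ p₂ : W ρ).coeff 0 = p₀ := by
  simp [quad, coeff_ofPoly]

theorem coeff_quad_one (p₀ p₁ p₂ : ℝ) : (quad p₀ p₁ p₂ : W ρ).coeff 1 = p₁ := by
  simp [quad, coeff_ofPoly, Polynomial.coeff_C]

theorem coeff_quad_two (p₀ p₁ p₂ : ℝ) : (quad p₀ p₁ p₂ : W ρ).coeff 2 = p₂ := by
  simp [quad, coeff_ofPoly]

theorem coeff_quad_add_three (p₀ p₁ p₂ : ℝ) (k : ℕ) :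
    (quad p₀ p₁ p₂ : W ρ).coeff (k + 3) = 0 := by
  simp [quad, coeff_ofPoly]

theorem eval_quad (p₀ p₁ p₂ : ℝ) (l : ℂ) :
    (quad p₀ p₁ p₂ : W ρ).eval l = p₀ + p₁ * l + p₂ * l ^ 2 := by
  rw [eval, tsum_eq_sum (s := Finset.range 3)]
  · simp [Finset.sum_range_succ, coeff_quad_zero, coeff_quad_one, coeff_quad_two]
  · intro k hk
    obtain ⟨j, rfl⟩ := Nat.exists_eq_add_of_le (not_lt.mp (mt Finset.mem_range.mpr hk))
    rw [add_comm, coeff_quad_add_three, Complex.ofReal_zero, zero_mul]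

theorem posPart_toLaurent (f : W ρ) : posPart 0 (toLaurent f) = f := by
  refine W.ext fun k => ?_
  rw [coeff_posPart, Nat.cast_zero, add_zero, coeff_natCast_toLaurent, Complex.ofReal_re]

/-- `W ρ` is a continuous retract of the complete space `Laurent ρ`, since `posPart 0 ∘ toLaurent =
id`: the limit is taken in `Laurent ρ` and projected back. -/
instance : CompleteSpace (W ρ) := by
  refine Metric.complete_of_cauchySeq_tendsto fun u hu => ?_
  obtain ⟨v, hv⟩ := cauchySeq_tendsto_of_complete
    ((toLaurent (ρ := ρ)).uniformContinuous.comp_cauchySeq hu)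
  refine ⟨posPart 0 v, ?_⟩
  have := ((posPart (ρ := ρ) 0).continuous.tendsto v).comp hv
  refine this.congr fun n => posPart_toLaurent _

end W

end

end DPW

/-! ### The logarithm series in a Banach algebra. -/

namespace DPW

noncomputable section

section Log

variable {A : Type*} [NormedRing A] [NormedAlgebra ℂ A] [CompleteSpace A]

/-- The coefficients of `log (1 + X) / X`. -/
def logCoeff (k : ℕ) : ℂ := (-1) ^ k / (k + 1)

/-- The entire part `log (1 + X) / X = ∑ (-1)^k X^k / (k + 1)` of the logarithm. -/
def logQuot (X : A) : A := ∑' k : ℕ, logCoeff k • X ^ k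

theorem norm_logCoeff_le (k : ℕ) : ‖logCoeff k‖ ≤ 1 := by
  rw [logCoeff, norm_div, norm_pow, norm_neg, norm_one, one_pow, one_div]
  have : ‖(k + 1 : ℂ)‖ = k + 1 := by
    have := Complex.norm_natCast (k + 1)
    push_cast at this
    exact this
  rw [this]
  exact inv_le_one_of_one_le₀ (by linarith [Nat.cast_nonneg (α := ℝ) k])

theorem hasSum_logQuot {X : A} (hX : ‖X‖ < 1) :
    HasSum (fun k : ℕ => logCoeff k • X ^ k) (logQuot X) := by
  refine Summable.hasSum ?_
  refine Summable.of_norm_bounded (summable_norm_geometric_of_norm_lt_one hX) fun k => ?_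
  rw [norm_smul]
  exact mul_le_of_le_one_left (norm_nonneg _) (norm_logCoeff_le k)

/-- The ratio test shows that the series has radius at least `1`, so its sum is analytic at `0`. -/
theorem contDiffAt_logQuot : ContDiffAt ℂ ω (logQuot : A → A) 0 := by
  have hr : Filter.Tendsto (fun n => ‖logCoeff n.succ‖ / ‖logCoeff n‖) Filter.atTop
      (𝓝 ((1 : NNReal) : ℝ)) := by
    have e : (fun n : ℕ => ‖logCoeff n.succ‖ / ‖logCoeff n‖) =
        fun n : ℕ => ((n : ℝ) + 1) / ((n + 1 : ℕ) + 1) := by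
      funext n
      have h (k : ℕ) : ‖(k + 1 : ℂ)‖ = k + 1 := by
        have := Complex.norm_natCast (k + 1)
        push_cast at this
        exact this
      rw [logCoeff, logCoeff, norm_div, norm_div, norm_pow, norm_pow, norm_neg, norm_one, one_pow,
        one_pow, h, h, one_div, one_div, inv_div_inv]
    rw [e]
    have := (tendsto_natCast_div_add_atTop (1 : ℝ)).comp (Filter.tendsto_add_atTop_nat 1)
    rw [NNReal.coe_one]
    refine this.congr fun n => ?_
    simp
  have hrad := FormalMultilinearSeries.inv_le_ofScalars_radius_of_tendsto A logCoeff
    one_ne_zero hr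
  have h := (FormalMultilinearSeries.ofScalars A logCoeff).hasFPowerSeriesOnBall
    (lt_of_lt_of_le (by simp) hrad)
  have h2 : (FormalMultilinearSeries.ofScalars A logCoeff).sum = logQuot :=
    FormalMultilinearSeries.ofScalarsSum_eq_tsum (E := A) logCoeff
  rw [h2] at h
  exact h.analyticAt.contDiffAt

theorem norm_neg_smul_lt_one {A : Type*} [NormedRing A] [NormedAlgebra ℂ A] {P : A}
    (hP : ‖P‖ < 1) {u : ℝ} (hu : u ∈ Set.Icc (0 : ℝ) 1) :
    ‖-(u • P)‖ < 1 := by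
  rw [norm_neg, norm_smul, Real.norm_of_nonneg hu.1]
  exact lt_of_le_of_lt (mul_le_of_le_one_left (norm_nonneg _) hu.2) hP

/-- This is `log (1 + P) = ∫₀¹ P (1 + u P)⁻¹ du`, by termwise integration of the geometric series.
The integral form makes the behaviour under inversion a change of variable. -/
theorem mul_logQuot_eq_integral {P : A} (hP : ‖P‖ < 1) :
    P * logQuot P = ∫ u in (0 : ℝ)..1, P * Ring.inverse (1 + u • P) := by
  have key := intervalIntegral.hasSum_integral_of_dominated_convergence (a := 0) (b := 1)
    (μ := MeasureTheory.volume) (F := fun (k : ℕ) (u : ℝ) => ((-u) ^ k) • P ^ (k + 1))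
    (f := fun u : ℝ => P * Ring.inverse (1 + u • P))
    (fun k _ => ‖P‖ ^ (k + 1)) (fun k => by
      refine Continuous.aestronglyMeasurable ?_
      fun_prop) (fun k => Filter.Eventually.of_forall fun u hu => by
      rw [Set.uIoc_of_le zero_le_one] at hu
      rw [norm_smul, norm_pow, norm_neg, Real.norm_of_nonneg hu.1.le]
      refine (mul_le_of_le_one_left (norm_nonneg _) (pow_le_one₀ hu.1.le hu.2)).trans ?_
      exact norm_pow_le' P (Nat.succ_pos k))
    (Filter.Eventually.of_forall fun u _ => by
      simp only [pow_succ]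
      exact (summable_geometric_of_lt_one (norm_nonneg _) hP).mul_right _)
    (by simp) (Filter.Eventually.of_forall fun u hu => by
      rw [Set.uIoc_of_le zero_le_one] at hu
      have h1 := hasSum_geom_series_inverse (-(u • P))
        (norm_neg_smul_lt_one hP ⟨hu.1.le, hu.2⟩)
      rw [sub_neg_eq_add] at h1
      have h2 := h1.mul_left P
      have e : (fun k : ℕ => (-u) ^ k • P ^ (k + 1)) = fun k => P * (-(u • P)) ^ k := by
        funext k
        rw [← neg_smul, smul_pow, mul_smul_comm, pow_succ']
      rw [e]
      exact h2)
  refine HasSum.unique ?_ key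
  have e : (fun k : ℕ => ∫ u in (0 : ℝ)..1, (-u) ^ k • P ^ (k + 1)) =
      fun k => P * (logCoeff k • P ^ k) := ?_
  · rw [e]
    exact (hasSum_logQuot hP).mul_left P
  funext k
  rw [intervalIntegral.integral_smul_const, mul_smul_comm, ← pow_succ']
  have hint : ∫ u in (0 : ℝ)..1, (-u) ^ k = (-1) ^ k / (k + 1) := by
    have e' : (fun u : ℝ => (-u) ^ k) = fun u => (-1) ^ k * u ^ k := funext fun u => neg_pow u k
    rw [e', intervalIntegral.integral_const_mul, integral_pow]
    simp [div_eq_mul_inv]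
  rw [hint, ← Complex.coe_smul, logCoeff]
  push_cast
  rfl

/-- The power series of the logarithm satisfies `log (R⁻¹) = -log R` near the identity. -/
theorem mul_logQuot_inv {P R : A} (hP : ‖P‖ < 1) (hR : ‖R - 1‖ < 1) (h1 : R * (1 + P) = 1)
    (h2 : (1 + P) * R = 1) : (R - 1) * logQuot (R - 1) = -(P * logQuot P) := by
  rw [mul_logQuot_eq_integral hP, mul_logQuot_eq_integral hR,
    ← intervalIntegral.integral_neg]
  -- The substitution `u ↦ 1 - u` matches the two integrands pointwise.
  have hsub := intervalIntegral.integral_comp_sub_left (a := 0) (b := 1)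
    (fun u : ℝ => -(P * Ring.inverse (1 + u • P))) 1
  rw [sub_zero, sub_self] at hsub
  rw [← hsub]
  refine intervalIntegral.integral_congr fun u hu => ?_
  rw [Set.uIcc_of_le zero_le_one] at hu
  have hu' : (1 - u) ∈ Set.Icc (0 : ℝ) 1 := ⟨by linarith [hu.2], by linarith [hu.1]⟩
  let V : Aˣ := Units.oneSub _ (norm_neg_smul_lt_one hP hu')
  have hV : (V : A) = 1 + (1 - u) • P := by
    rw [Units.val_oneSub, sub_neg_eq_add]
  let R' : Aˣ := ⟨R, 1 + P, h1, h2⟩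
  have hPR : P * R = 1 - R := by
    rw [← h2, add_mul, one_mul, add_sub_cancel_left]
  -- With `R = (1 + P)⁻¹`, one has `(1 + (1 - u) P) R = 1 + u (R - 1)`. Inverting this and using `(R
  -- - 1)(1 + P) = -P` gives the integrand identity.
  have hVR : ((V * R' : Aˣ) : A) = 1 + u • (R - 1) := by
    rw [Units.val_mul, hV]
    change (1 + (1 - u) • P) * R = _
    rw [add_mul, one_mul, smul_mul_assoc, hPR]
    module
  rw [← hVR, Ring.inverse_unit, ← hV, Ring.inverse_unit, mul_inv_rev, Units.val_mul]
  change (R - 1) * ((1 + P) * _) = _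
  rw [← mul_assoc, sub_mul, h1, one_mul, sub_add_cancel_left, neg_mul]

end Log

end

end DPW

/-! ### Linear equations `N' = t N B` in a Banach algebra, solved through a Volterra operator. -/

namespace DPW

noncomputable section

section Volterra

variable {E : Type*} [NormedAddCommGroup E] [NormedSpace ℂ E] [CompleteSpace E]

/-- The primitive of a continuous function on the unit interval, vanishing at `0`. -/
def prim (f : C(Set.Icc (0 : ℝ) 1, E)) (s : ℝ) : E :=
  ∫ u in (0 : ℝ)..s, Set.IccExtend zero_le_one f u

theorem continuous_IccExtend {E : Type*} [NormedAddCommGroup E] (f : C(Set.Icc (0 : ℝ) 1, E)) :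
    Continuous (Set.IccExtend (zero_le_one (α := ℝ)) f) :=
  f.continuous.Icc_extend'

theorem hasDerivAt_prim (f : C(Set.Icc (0 : ℝ) 1, E)) (s : ℝ) :
    HasDerivAt (prim f) (Set.IccExtend zero_le_one f s) s :=
  ((continuous_IccExtend f).integral_hasStrictDerivAt 0 s).hasDerivAt

theorem continuous_prim (f : C(Set.Icc (0 : ℝ) 1, E)) : Continuous (prim f) :=
  continuous_iff_continuousAt.mpr fun s => (hasDerivAt_prim f s).continuousAt

/-- The primitive as a continuous linear map. -/
def primL : C(Set.Icc (0 : ℝ) 1, E) →L[ℂ] C(Set.Icc (0 : ℝ) 1, E) :=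
  LinearMap.mkContinuous
    { toFun := fun f => ⟨fun s => prim f s, (continuous_prim f).comp continuous_subtype_val⟩
      map_add' := fun f g => by
        ext s
        exact intervalIntegral.integral_add ((continuous_IccExtend f).intervalIntegrable _ _)
          ((continuous_IccExtend g).intervalIntegrable _ _)
      map_smul' := fun c f => by
        ext s
        exact intervalIntegral.integral_smul c _ } 1
    (fun f => by
      rw [one_mul]
      refine (ContinuousMap.norm_le _ (norm_nonneg f)).mpr fun s => ?_
      refine (intervalIntegral.norm_integral_le_of_norm_le_const
        fun u _ => ContinuousMap.norm_coe_le_norm f _).trans ?_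
      rw [sub_zero, abs_of_nonneg s.2.1]
      exact mul_le_of_le_one_right (norm_nonneg f) s.2.2)

theorem primL_apply (f : C(Set.Icc (0 : ℝ) 1, E)) (s : Set.Icc (0 : ℝ) 1) :
    primL f s = prim f s := rfl

end Volterra

section Resolvent

variable {X : Type*} [NormedRing X] [NormedAlgebra ℂ X] [CompleteSpace X]

/-- The operators `N ↦ J (N B)`. -/
def volterra (J : X →L[ℂ] X) : X →L[ℂ] (X →L[ℂ] X) :=
  ContinuousLinearMap.compL ℂ X X X J ∘L (ContinuousLinearMap.mul ℂ X).flip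

theorem volterra_apply (J : X →L[ℂ] X) (B N : X) : volterra J B N = J (N * B) := rfl

/-- The solution of `N = 1 + t J (N B)`, for small `t B`. -/
def resolventSol (J : X →L[ℂ] X) (t : ℂ) (B : X) : X := Ring.inverse (1 - t • volterra J B) 1

theorem resolventSol_eq {J : X →L[ℂ] X} {t : ℂ} {B : X} (h : ‖t • volterra J B‖ < 1) :
    resolventSol J t B = 1 + t • J (resolventSol J t B * B) := by
  have h1 : (1 - t • volterra J B) * Ring.inverse (1 - t • volterra J B) = 1 :=
    Ring.mul_inverse_cancel _ (isUnit_one_sub_of_norm_lt_one h)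
  have h2 := congrArg (fun f => f (1 : X)) h1
  have h3 : resolventSol J t B - t • volterra J B (resolventSol J t B) = 1 := h2
  rw [volterra_apply] at h3
  rw [← h3, sub_add_cancel]

theorem resolventSol_zero (J : X →L[ℂ] X) (B : X) : resolventSol J 0 B = 1 := by
  have : (1 : X →L[ℂ] X) - (0 : ℂ) • volterra J B = 1 := by module
  rw [resolventSol, this, Ring.inverse_one]
  rfl

/-- At `t = 0` the operator `1 - t V_B` is the identity whatever `B` is, and inversion is analytic
at a unit. Hence no smallness of `B` is required. -/
theorem contDiffAt_resolventSol (J : X →L[ℂ] X) (B : X) :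
    ContDiffAt ℂ ω (fun p : ℂ × X => resolventSol J p.1 p.2) (0, B) := by
  have h1 : ContDiffAt ℂ ω (fun p : ℂ × X => (1 : X →L[ℂ] X) - p.1 • volterra J p.2) (0, B) :=
    contDiffAt_const.sub (contDiffAt_fst.smul
      ((volterra J).contDiff.contDiffAt.comp (0, B) contDiffAt_snd))
  have h2 : ContDiffAt ℂ ω (fun p : ℂ × X =>
      Ring.inverse ((1 : X →L[ℂ] X) - p.1 • volterra J p.2)) (0, B) := by
    refine ContDiffAt.comp (g := (Ring.inverse : (X →L[ℂ] X) → _)) (0, B) ?_ h1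
    have : (1 : X →L[ℂ] X) - (0 : ℂ) • volterra J B = 1 := by module
    simp only [this]
    exact contDiffAt_ringInverse ℂ (1 : (X →L[ℂ] X)ˣ)
  exact h2.clm_apply contDiffAt_const

theorem eventually_norm_volterra_lt (J : X →L[ℂ] X) (B : X) :
    ∀ᶠ p : ℂ × X in 𝓝 (0, B), ‖p.1 • volterra J p.2‖ < 1 := by
  have h1 : ContinuousAt (fun p : ℂ × X => ‖p.1 • volterra J p.2‖) (0, B) :=
    (continuousAt_fst.smul
      ((volterra J).continuous.continuousAt.comp (x := (0, B)) continuousAt_snd)).norm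
  refine h1.eventually_lt_const ?_
  have : (0 : ℂ) • volterra J B = 0 := by module
  change ‖(0 : ℂ) • volterra J B‖ < 1
  rw [this, norm_zero]
  exact one_pos

end Resolvent

section LinearODE

variable {A : Type*} [NormedRing A] [NormedAlgebra ℂ A] [CompleteSpace A]

/-- The solution of `N' = t N B`, `N(0) = 1`, for small `t B`. -/
def fundSol (t : ℂ) (B : C(Set.Icc (0 : ℝ) 1, A)) : C(Set.Icc (0 : ℝ) 1, A) :=
  resolventSol primL t B

/-- The difference quotient `(N(1) - 1) / t` of the end value of the solution. -/
def endQuot (t : ℂ) (B : C(Set.Icc (0 : ℝ) 1, A)) : A :=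
  primL (fundSol t B * B) ⟨1, zero_le_one, le_rfl⟩

theorem fundSol_eq {t : ℂ} {B : C(Set.Icc (0 : ℝ) 1, A)} (h : ‖t • volterra primL B‖ < 1) :
    fundSol t B = 1 + t • primL (fundSol t B * B) := resolventSol_eq h

theorem endQuot_zero (B : C(Set.Icc (0 : ℝ) 1, A)) : endQuot 0 B = prim B 1 := by
  rw [endQuot, fundSol, resolventSol_zero, one_mul, primL_apply]

theorem contDiffAt_endQuot (B : C(Set.Icc (0 : ℝ) 1, A)) :
    ContDiffAt ℂ ω (fun p : ℂ × C(Set.Icc (0 : ℝ) 1, A) => endQuot p.1 p.2) (0, B) := by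
  have h3 := contDiffAt_resolventSol primL B
  have h4 := h3.mul contDiffAt_snd
  exact (ContinuousMap.evalCLM ℂ (M := A) ⟨1, zero_le_one, le_rfl⟩).contDiff.contDiffAt.comp _
    (primL.contDiff.contDiffAt.comp _ h4)

theorem one_add_smul_endQuot {t : ℂ} {B : C(Set.Icc (0 : ℝ) 1, A)} (h : ‖t • volterra primL B‖ < 1) :
    fundSol t B ⟨1, zero_le_one, le_rfl⟩ = 1 + t • endQuot t B := by
  conv_lhs => rw [fundSol_eq h]
  rfl

theorem fundSol_start {t : ℂ} {B : C(Set.Icc (0 : ℝ) 1, A)} (h : ‖t • volterra primL B‖ < 1) :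
    fundSol t B ⟨0, le_rfl, zero_le_one⟩ = 1 := by
  rw [fundSol_eq h]
  change (1 : A) + t • prim (fundSol t B * B) 0 = 1
  rw [prim, intervalIntegral.integral_same, smul_zero, add_zero]

theorem hasDerivAt_fundSol {t : ℂ} {B : C(Set.Icc (0 : ℝ) 1, A)} (h : ‖t • volterra primL B‖ < 1)
    {s : ℝ} (hs : s ∈ Set.Icc (0 : ℝ) 1) :
    HasDerivWithinAt (Set.IccExtend zero_le_one (fundSol t B))
      (t • (fundSol t B ⟨s, hs⟩ * B ⟨s, hs⟩)) (Set.Icc 0 1) s := by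
  have h1 := (((hasDerivAt_prim (E := A) (fundSol t B * B) s).const_smul t).const_add 1).hasDerivWithinAt
    (s := Set.Icc (0 : ℝ) 1)
  rw [Set.IccExtend_of_mem _ _ hs] at h1
  have h2 : ∀ u ∈ Set.Icc (0 : ℝ) 1, Set.IccExtend zero_le_one (fundSol t B) u =
      1 + t • prim (fundSol t B * B) u := fun u hu => by
    rw [Set.IccExtend_of_mem _ _ hu]
    conv_lhs => rw [fundSol_eq h]
    rfl
  exact h1.congr h2 (h2 s hs)

/-- The difference quotient `(log N(1)) / t`. -/
def logEnd (t : ℂ) (B : C(Set.Icc (0 : ℝ) 1, A)) : A :=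
  endQuot t B * logQuot (t • endQuot t B)

theorem logEnd_zero (B : C(Set.Icc (0 : ℝ) 1, A)) : logEnd 0 B = prim B 1 := by
  have h : logQuot (0 : A) = 1 := by
    rw [logQuot, tsum_eq_single 0 fun k hk => by rw [zero_pow hk, smul_zero]]
    simp [logCoeff]
  rw [logEnd, zero_smul, h, mul_one, endQuot_zero]

/-- Since `log (1 + X) = X * logQuot X`, the factor `t` in `X = t * endQuot` cancels algebraically,
so `(log N(1)) / t` extends analytically across `t = 0`. -/
theorem contDiffAt_logEnd (B : C(Set.Icc (0 : ℝ) 1, A)) :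
    ContDiffAt ℂ ω (fun p : ℂ × C(Set.Icc (0 : ℝ) 1, A) => logEnd p.1 p.2) (0, B) := by
  have h1 := contDiffAt_endQuot B
  have h2 : ContDiffAt ℂ ω (fun p : ℂ × C(Set.Icc (0 : ℝ) 1, A) => p.1 • endQuot p.1 p.2) (0, B) :=
    contDiffAt_fst.smul h1
  refine h1.mul (ContDiffAt.comp (g := logQuot) (0, B) ?_ h2)
  simp only [zero_smul]
  exact contDiffAt_logQuot

/-- The first bound makes the Neumann series converge, the second the logarithm series. -/
theorem eventually_small (B : C(Set.Icc (0 : ℝ) 1, A)) :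
    ∀ᶠ p : ℂ × C(Set.Icc (0 : ℝ) 1, A) in 𝓝 (0, B),
      ‖p.1 • volterra primL p.2‖ < 1 ∧ ‖p.1 • endQuot p.1 p.2‖ < 1 / 2 := by
  have h2 : ContinuousAt (fun p : ℂ × C(Set.Icc (0 : ℝ) 1, A) => ‖p.1 • endQuot p.1 p.2‖)
      (0, B) :=
    (continuousAt_fst.smul (contDiffAt_endQuot B).continuousAt).norm
  have h3 := h2.eventually_lt_const (u := 1 / 2) (by
    change ‖(0 : ℂ) • endQuot 0 B‖ < 1 / 2
    rw [zero_smul, norm_zero]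
    exact one_half_pos)
  have h1 := eventually_norm_volterra_lt (X := C(Set.Icc (0 : ℝ) 1, A)) primL B
  exact h1.and h3

end LinearODE

end

end DPW

/-! ### The petal loop and its contour integrals. -/

namespace DPW

noncomputable section

section Loop

variable (m : ℕ)

theorem card_pos : (0 : ℝ) < (2 * m + 2 : ℕ) := by positivity

theorem loop_eq (s : ℝ) : loop m s =
    ((2 * Real.sin (Real.pi * s) : ℝ) : ℂ) *
      Complex.exp ((Real.pi * (2 * s - 1) / (2 * m + 2 : ℕ) : ℝ) * Complex.I) := by
  rw [loop]
  push_cast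
  congr 2
  ring

theorem contDiff_loop : ContDiff ℝ ∞ (loop m) := by
  have : loop m = fun s : ℝ => ((2 * Real.sin (Real.pi * s) : ℝ) : ℂ) *
      Complex.exp ((Real.pi * (2 * s - 1) / (2 * m + 2 : ℕ) : ℝ) * Complex.I) :=
    funext (loop_eq m)
  rw [this]
  have h1 : ContDiff ℝ ∞ fun s : ℝ => ((2 * Real.sin (Real.pi * s) : ℝ) : ℂ) :=
    Complex.ofRealCLM.contDiff.comp
      (contDiff_const.mul (Real.contDiff_sin.comp (contDiff_const.mul contDiff_id)))
  have h2 : ContDiff ℝ ∞ fun s : ℝ => ((Real.pi * (2 * s - 1) / (2 * m + 2 : ℕ) : ℝ) : ℂ) :=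
    Complex.ofRealCLM.contDiff.comp
      ((contDiff_const.mul ((contDiff_const.mul contDiff_id).sub contDiff_const)).div_const _)
  exact h1.mul (h2.mul contDiff_const).cexp

theorem hasDerivAt_loop (s : ℝ) : HasDerivAt (loop m) (deriv (loop m) s) s :=
  ((contDiff_loop m).differentiable (by simp) s).hasDerivAt

theorem continuous_loop : Continuous (loop m) := (contDiff_loop m).continuous

theorem continuous_deriv_loop : Continuous (deriv (loop m)) :=
  (contDiff_loop m).continuous_deriv (by simp)

theorem loop_zero : loop m 0 = 0 := by simp [loop]

theorem loop_one : loop m 1 = 0 := by simp [loop]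

theorem loop_half : loop m (1 / 2) = 2 := by
  rw [loop_eq, show Real.pi * (1 / 2) = Real.pi / 2 by ring, Real.sin_pi_div_two]
  norm_num

/-- The petal is symmetric about the real axis, and conjugation reverses its orientation. This is
the geometric source of the reality statements. -/
theorem loop_one_sub (s : ℝ) : loop m (1 - s) = starRingEnd ℂ (loop m s) := by
  rw [loop_eq, loop_eq, map_mul, Complex.conj_ofReal, ← Complex.exp_conj, map_mul,
    Complex.conj_ofReal, Complex.conj_I, mul_sub, mul_one, Real.sin_pi_sub]
  congr 2
  push_cast
  ring

theorem deriv_loop_one_sub (s : ℝ) :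
    starRingEnd ℂ (deriv (loop m) (1 - s)) = -deriv (loop m) s := by
  have h1 : HasDerivAt (fun u => starRingEnd ℂ (loop m (1 - u)))
      (starRingEnd ℂ (-deriv (loop m) (1 - s))) s := by
    have h := (hasDerivAt_loop m (1 - s)).scomp s ((hasDerivAt_id s).const_sub 1)
    rw [neg_one_smul] at h
    exact (Complex.conjCLE : ℂ →L[ℝ] ℂ).hasFDerivAt.comp_hasDerivAt s h
  have h2 : (fun u => starRingEnd ℂ (loop m (1 - u))) = loop m := by
    funext u
    rw [loop_one_sub, Complex.conj_conj]
  rw [h2] at h1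
  rw [h1.deriv, map_neg, neg_neg]

theorem puncture_eq (j : ℕ) : puncture m j =
    Complex.exp ((2 * Real.pi * j / (2 * m + 2 : ℕ) : ℝ) * Complex.I) := by
  rw [puncture]
  push_cast
  congr 1
  ring

theorem puncture_zero : puncture m 0 = 1 := by simp [puncture]

theorem puncture_ne_zero (j : ℕ) : puncture m j ≠ 0 := Complex.exp_ne_zero _

/-- For `0 < j < n` the argument of `γ/p_j` lies strictly between `-2π` and `0`, so `γ/p_j` never
meets the ray `[1, ∞)`. One branch of the logarithm therefore serves the whole loop. -/
theorem one_sub_loop_div_mem_slitPlane {s : ℝ} (hs : s ∈ Set.Icc (0 : ℝ) 1) {j : ℕ} (h0 : 0 < j)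
    (hj : j < 2 * m + 2) : 1 - loop m s / puncture m j ∈ Complex.slitPlane := by
  have hN := card_pos m
  set N : ℝ := ((2 * m + 2 : ℕ) : ℝ) with hNdef
  set θ : ℝ := Real.pi * (2 * s - 1) / N - 2 * Real.pi * j / N with hθ
  set R : ℝ := 2 * Real.sin (Real.pi * s) with hR
  have hR0 : 0 ≤ R := by
    have := Real.sin_nonneg_of_nonneg_of_le_pi (mul_nonneg Real.pi_pos.le hs.1)
      (mul_le_of_le_one_right Real.pi_pos.le hs.2)
    positivity
  have hw : loop m s / puncture m j = (R : ℂ) * Complex.exp (θ * Complex.I) := by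
    rw [loop_eq, puncture_eq, mul_div_assoc, ← Complex.exp_sub, ← sub_mul, ← Complex.ofReal_sub]
  have hπ := Real.pi_pos
  have hj1 : (1 : ℝ) ≤ j := by exact_mod_cast h0
  have hj2 : (j : ℝ) + 1 ≤ N := by
    rw [hNdef]
    exact_mod_cast hj
  have hlt : θ < 0 := by
    rw [hθ, ← sub_div, div_neg_iff]
    right
    refine ⟨?_, hN⟩
    nlinarith [hs.1, hs.2]
  have hgt : -(2 * Real.pi) < θ := by
    rw [hθ, ← sub_div, lt_div_iff₀ hN]
    nlinarith [hs.1, hs.2]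
  rw [hw, Complex.mem_slitPlane_iff]
  by_contra hcon
  push Not at hcon
  obtain ⟨h1, h2⟩ := hcon
  simp only [Complex.sub_re, Complex.one_re, Complex.re_ofReal_mul, Complex.exp_ofReal_mul_I_re,
    Complex.sub_im, Complex.one_im, Complex.im_ofReal_mul, Complex.exp_ofReal_mul_I_im] at h1 h2
  have hRc : 1 ≤ R * Real.cos θ := by linarith
  have hRpos : R ≠ 0 := by
    rintro h
    rw [h] at hRc
    linarith
  have hsin : Real.sin θ = 0 := by
    rcases mul_eq_zero.mp (show R * Real.sin θ = 0 by linarith) with h | h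
    · exact absurd h hRpos
    · exact h
  have hcos : Real.cos θ = 1 := by
    have hc : 0 < Real.cos θ := by
      by_contra hc
      nlinarith [not_lt.mp hc]
    have := Real.sin_sq_add_cos_sq θ
    rw [hsin] at this
    nlinarith
  rw [Real.cos_eq_one_iff_of_lt_of_lt hgt (by linarith)] at hcos
  linarith

/-- The first half of the petal lies below the real axis except at its ends `0` and `2`, so a
rotation by `I` of `γ - 1` has positive real part inside and is `∓I` at the ends. -/
theorem I_mul_loop_sub_one_mem_slitPlane {s : ℝ} (hs : s ∈ Set.Icc (0 : ℝ) (1 / 2)) :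
    Complex.I * (loop m s - 1) ∈ Complex.slitPlane := by
  rcases eq_or_lt_of_le hs.1 with h | h
  · rw [← h, loop_zero, Complex.mem_slitPlane_iff]
    right
    simp
  rcases eq_or_lt_of_le hs.2 with h2 | h2
  · rw [h2, loop_half, Complex.mem_slitPlane_iff]
    right
    norm_num
  · rw [Complex.mem_slitPlane_iff]
    left
    have hπ := Real.pi_pos
    have hN := card_pos m
    have hN1 : (1 : ℝ) ≤ (2 * m + 2 : ℕ) := by exact_mod_cast (by omega : 1 ≤ 2 * m + 2)
    have h3 : 0 < Real.sin (Real.pi * s) :=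
      Real.sin_pos_of_pos_of_lt_pi (by positivity) (by nlinarith)
    have h4 : Real.sin (Real.pi * (2 * s - 1) / (2 * m + 2 : ℕ)) < 0 := by
      refine Real.sin_neg_of_neg_of_neg_pi_lt ?_ ?_
      · rw [div_neg_iff]
        right
        exact ⟨by nlinarith, hN⟩
      · rw [lt_div_iff₀ hN]
        nlinarith
    have h5 : (Complex.I * (loop m s - 1)).re = -(loop m s).im := by simp
    rw [h5, loop_eq, Complex.im_ofReal_mul, Complex.exp_ofReal_mul_I_im]
    nlinarith [mul_neg_of_pos_of_neg h3 h4]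

theorem neg_I_mul_loop_sub_one_mem_slitPlane {s : ℝ} (hs : s ∈ Set.Icc (1 / 2 : ℝ) 1) :
    -Complex.I * (loop m s - 1) ∈ Complex.slitPlane := by
  have h := I_mul_loop_sub_one_mem_slitPlane m (s := 1 - s)
    ⟨by linarith [hs.2], by linarith [hs.1]⟩
  rw [loop_one_sub] at h
  have e : -Complex.I * (loop m s - 1) =
      starRingEnd ℂ (Complex.I * (starRingEnd ℂ (loop m s) - 1)) := by
    rw [map_mul, map_sub, Complex.conj_conj, Complex.conj_I, map_one]
  rw [e]
  rw [Complex.mem_slitPlane_iff] at h ⊢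
  rwa [Complex.conj_re, Complex.conj_im, neg_ne_zero]

theorem loop_ne_puncture {s : ℝ} (hs : s ∈ Set.Icc (0 : ℝ) 1) {j : ℕ} (hj : j < 2 * m + 2) :
    loop m s - puncture m j ≠ 0 := by
  rcases Nat.eq_zero_or_pos j with rfl | h0
  · rw [puncture_zero]
    intro h
    rcases le_total s (1 / 2) with h2 | h2
    · have := I_mul_loop_sub_one_mem_slitPlane m ⟨hs.1, h2⟩
      rw [h, mul_zero] at this
      exact Complex.zero_notMem_slitPlane this
    · have := neg_I_mul_loop_sub_one_mem_slitPlane m ⟨h2, hs.2⟩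
      rw [h, mul_zero] at this
      exact Complex.zero_notMem_slitPlane this
  · intro h
    have := one_sub_loop_div_mem_slitPlane m hs h0 hj
    rw [sub_eq_zero.mp h, div_self (puncture_ne_zero m j), sub_self] at this
    exact Complex.zero_notMem_slitPlane this

theorem continuousOn_kernel {j : ℕ} (hj : j < 2 * m + 2) :
    ContinuousOn (fun s => (loop m s - puncture m j)⁻¹ * deriv (loop m) s) (Set.Icc 0 1) :=
  (((continuous_loop m).continuousOn.sub continuousOn_const).inv₀ fun _ hs =>
    loop_ne_puncture m hs hj).mul (continuous_deriv_loop m).continuousOn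

/-- The factor `c` rotates the path into the slit plane and drops out of the logarithmic derivative.
-/
theorem integral_log_deriv {a b : ℝ} (hab : a ≤ b) (h01 : Set.Icc a b ⊆ Set.Icc 0 1) {j : ℕ}
    (hj : j < 2 * m + 2) {c : ℂ} (hc : c ≠ 0)
    (h : ∀ s ∈ Set.Icc a b, c * (loop m s - puncture m j) ∈ Complex.slitPlane) :
    ∫ s in a..b, (loop m s - puncture m j)⁻¹ * deriv (loop m) s =
      Complex.log (c * (loop m b - puncture m j)) - Complex.log (c * (loop m a - puncture m j)) := by
  have hcont := (continuousOn_kernel m hj).mono h01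
  rw [← Set.uIcc_of_le hab] at hcont
  refine intervalIntegral.integral_eq_sub_of_hasDerivAt
    (f := fun s => Complex.log (c * (loop m s - puncture m j))) (fun s hs => ?_)
    hcont.intervalIntegrable
  rw [Set.uIcc_of_le hab] at hs
  have h1 := (((hasDerivAt_loop m s).sub_const (puncture m j)).const_mul c).clog_real (h s hs)
  rwa [mul_div_mul_left _ _ hc, div_eq_inv_mul] at h1

/-- These are the winding numbers about the punctures. For `j = 0` the loop is cut at `s = 1/2` and
each half contributes `log I - log (-I) = πi`; for the other punctures a single branch is closed up.
-/
theorem integral_kernel {j : ℕ} (hj : j < 2 * m + 2) :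
    ∫ s in (0 : ℝ)..1, (loop m s - puncture m j)⁻¹ * deriv (loop m) s =
      if j = 0 then 2 * Real.pi * Complex.I else 0 := by
  split_ifs with h0
  · subst h0
    have hi : ∀ a b : ℝ, a ∈ Set.Icc (0 : ℝ) 1 → b ∈ Set.Icc (0 : ℝ) 1 →
        IntervalIntegrable (fun s => (loop m s - puncture m 0)⁻¹ * deriv (loop m) s)
          MeasureTheory.volume a b := fun a b ha hb =>
      ((continuousOn_kernel m hj).mono (Set.uIcc_subset_Icc ha hb)).intervalIntegrable
    have m0 : (0 : ℝ) ∈ Set.Icc (0 : ℝ) 1 := by norm_num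
    have m1 : (1 : ℝ) ∈ Set.Icc (0 : ℝ) 1 := by norm_num
    have mh : (1 / 2 : ℝ) ∈ Set.Icc (0 : ℝ) 1 := by norm_num
    rw [← intervalIntegral.integral_add_adjacent_intervals (hi 0 (1 / 2) m0 mh)
      (hi (1 / 2) 1 mh m1),
      integral_log_deriv m (by norm_num) (Set.Icc_subset_Icc le_rfl mh.2) hj Complex.I_ne_zero
        (fun s hs => by
          rw [puncture_zero]
          exact I_mul_loop_sub_one_mem_slitPlane m hs),
      integral_log_deriv m (by norm_num) (Set.Icc_subset_Icc mh.1 le_rfl) hj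
        (neg_ne_zero.mpr Complex.I_ne_zero) (fun s hs => by
          rw [puncture_zero]
          exact neg_I_mul_loop_sub_one_mem_slitPlane m hs),
      puncture_zero, loop_zero, loop_one, loop_half]
    have e1 : Complex.I * (2 - 1) = Complex.I := by ring
    have e2 : Complex.I * (0 - 1) = -Complex.I := by ring
    have e3 : -Complex.I * (0 - 1) = Complex.I := by ring
    have e4 : -Complex.I * (2 - 1) = -Complex.I := by ring
    rw [e1, e2, e3, e4, Complex.log_I, Complex.log_neg_I]
    ring
  · have hp := puncture_ne_zero m j
    rw [integral_log_deriv m zero_le_one le_rfl hj (c := -(puncture m j)⁻¹)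
      (neg_ne_zero.mpr (inv_ne_zero hp)) (fun s hs => by
        have := one_sub_loop_div_mem_slitPlane m hs (Nat.pos_of_ne_zero h0) hj
        convert this using 1
        field_simp
        ring), loop_one, loop_zero, sub_self]

/-- Induction on `k` from `z^(k+1)/(z - p) = z^k + p z^k/(z - p)`: the first term has a primitive,
so it integrates to `0` over the closed loop. -/
theorem integral_loop_pow_mul_kernel {j : ℕ} (hj : j < 2 * m + 2) (k : ℕ) :
    ∫ s in (0 : ℝ)..1, loop m s ^ k * ((loop m s - puncture m j)⁻¹ * deriv (loop m) s) =
      if j = 0 then 2 * Real.pi * Complex.I else 0 := by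
  -- The factor `p_j` gained at each induction step is invisible: only `j = 0` contributes, and `p_0
  -- = 1`.
  have hone : (if j = 0 then 2 * Real.pi * Complex.I else (0 : ℂ)) =
      puncture m j * if j = 0 then 2 * Real.pi * Complex.I else 0 := by
    split_ifs with h
    · rw [h, puncture_zero, one_mul]
    · rw [mul_zero]
  induction k with
  | zero => simpa using integral_kernel m hj
  | succ k ih =>
    have hc : Continuous fun s => loop m s ^ k * deriv (loop m) s :=
      ((continuous_loop m).pow k).mul (continuous_deriv_loop m)
    have hpow : ∫ s in (0 : ℝ)..1, loop m s ^ k * deriv (loop m) s = 0 := by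
      rw [intervalIntegral.integral_eq_sub_of_hasDerivAt
        (f := fun s => loop m s ^ (k + 1) / (k + 1)) (fun s _ => ?_)
        (hc.intervalIntegrable _ _)]
      · rw [loop_one, loop_zero, sub_self]
      · have h := ((hasDerivAt_loop m s).pow (k + 1)).div_const ((k : ℂ) + 1)
        have : (k : ℂ) + 1 ≠ 0 := Nat.cast_add_one_ne_zero k
        rw [Nat.add_sub_cancel, Nat.cast_add_one, mul_assoc, mul_div_cancel_left₀ _ this] at h
        exact h
    have hsplit : Set.EqOn
        (fun s => loop m s ^ (k + 1) * ((loop m s - puncture m j)⁻¹ * deriv (loop m) s))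
        (fun s => loop m s ^ k * deriv (loop m) s +
          puncture m j * (loop m s ^ k * ((loop m s - puncture m j)⁻¹ * deriv (loop m) s)))
        (Set.uIcc 0 1) := fun s hs => by
      rw [Set.uIcc_of_le zero_le_one] at hs
      have := loop_ne_puncture m hs hj
      simp only
      field_simp
      ring
    rw [intervalIntegral.integral_congr hsplit, intervalIntegral.integral_add, hpow,
      intervalIntegral.integral_const_mul, ih, zero_add, ← hone]
    · exact hc.intervalIntegrable _ _
    · refine ContinuousOn.intervalIntegrable ?_
      rw [Set.uIcc_of_le zero_le_one]
      exact continuousOn_const.mul (((continuous_loop m).pow k).continuousOn.mul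
        (continuousOn_kernel m hj))

end Loop

end

end DPW

/-! ### Closed form of the residues and conjugation symmetry of the potential. -/

namespace DPW

noncomputable section

variable {ρ : ℝ} [Fact (1 < ρ)]

theorem W.conj_eval (f : W ρ) (l : ℂ) :
    starRingEnd ℂ (f.eval l) = f.eval (starRingEnd ℂ l) := by
  rw [W.eval, W.eval, Complex.conj_tsum]
  refine tsum_congr fun k => ?_
  rw [map_mul, map_pow, Complex.conj_ofReal]

section Residue

variable (m : ℕ)

/-- The square `exp(2πim/n)` of the first diagonal entry of `D`. -/
def twist : ℂ := Complex.exp ((2 * Real.pi * m / (2 * m + 2 : ℕ) : ℝ) * Complex.I)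

theorem card_ne_zero : ((2 * m + 2 : ℕ) : ℂ) ≠ 0 := Nat.cast_ne_zero.mpr (by omega)

theorem twist_pow_card : twist m ^ (2 * m + 2) = 1 := by
  rw [twist, ← Complex.exp_nat_mul, Complex.exp_eq_one_iff]
  refine ⟨m, ?_⟩
  have := card_ne_zero m
  push_cast at this ⊢
  field_simp

theorem conj_twist : starRingEnd ℂ (twist m) = (twist m)⁻¹ := by
  rw [twist, ← Complex.exp_conj, map_mul, Complex.conj_ofReal, Complex.conj_I, mul_neg,
    Complex.exp_neg]

theorem puncture_card : puncture m (2 * m + 2) = puncture m 0 := by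
  rw [puncture_zero, puncture, mul_div_assoc, div_self (card_ne_zero m), mul_one,
    Complex.exp_two_pi_mul_I]

theorem conj_puncture {j : ℕ} (hj : j ≤ 2 * m + 2) :
    starRingEnd ℂ (puncture m j) = puncture m (2 * m + 2 - j) := by
  rw [puncture_eq, puncture, ← Complex.exp_conj, map_mul, Complex.conj_ofReal, Complex.conj_I,
    Complex.exp_eq_exp_iff_exists_int]
  refine ⟨-1, ?_⟩
  have := card_ne_zero m
  rw [Nat.cast_sub hj]
  push_cast at this ⊢
  field_simp
  ring

theorem symD_inv_mul_mul (p q r s : ℂ) : (symD m)⁻¹ * !![p, q; r, s] * symD m =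
    !![p, (twist m)⁻¹ * q; twist m * r, s] := by
  set e : ℂ := Complex.I * Real.pi * m / (2 * m + 2 : ℕ) with he
  have h1 : Complex.exp e * Complex.exp (-e) = 1 := by
    rw [← Complex.exp_add, add_neg_cancel, Complex.exp_zero]
  have hinv : (symD m)⁻¹ = !![Complex.exp (-e), 0; 0, Complex.exp e] := by
    refine Matrix.inv_eq_right_inv ?_
    rw [symD, ← he, Matrix.mul_fin_two, Matrix.one_fin_two]
    simp only [mul_zero, zero_mul, add_zero, zero_add]
    rw [h1, mul_comm (Complex.exp (-e)), h1]
  have htw : twist m = Complex.exp e * Complex.exp e := by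
    rw [twist, ← Complex.exp_add]
    congr 1
    rw [he]
    push_cast
    ring
  have htw' : (twist m)⁻¹ = Complex.exp (-e) * Complex.exp (-e) := by
    rw [htw, mul_inv, Complex.exp_neg]
  rw [hinv, htw', htw, symD, ← he, Matrix.mul_fin_two, Matrix.mul_fin_two]
  simp only [mul_zero, zero_mul, add_zero, zero_add]
  ext i j
  fin_cases i <;> fin_cases j <;> simp
  · linear_combination p * h1
  · ring
  · ring
  · linear_combination s * h1

theorem residue_eq (x : Param ρ) (j : ℕ) (l : ℂ) : residue m x j l =
    !![x.a.eval ((-1) ^ j * l), (twist m ^ j)⁻¹ * (((-1) ^ j * l)⁻¹ * x.b.eval ((-1) ^ j * l));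
      twist m ^ j * (((-1) ^ j * l) * x.c.eval ((-1) ^ j * l)), -x.a.eval ((-1) ^ j * l)] := by
  induction j generalizing l with
  | zero => simp [residue]
  | succ j ih =>
    have e : (-1 : ℂ) ^ j * -l = (-1) ^ (j + 1) * l := by ring
    rw [residue, ih, symD_inv_mul_mul, e]
    ext i k
    fin_cases i <;> fin_cases k <;> simp
    · rw [pow_succ, mul_inv]
      ring
    · ring

/-- The recursion for `A_j` closes up after `n` steps because `twist m` is an `n`-th root of unity
and `n` is even. -/
theorem residue_card (x : Param ρ) (l : ℂ) : residue m x (2 * m + 2) l = residue m x 0 l := by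
  rw [residue_eq, residue_eq, twist_pow_card, pow_zero, pow_zero,
    Even.neg_one_pow ⟨m + 1, by ring⟩]

theorem conj_residue (x : Param ρ) {j : ℕ} (hj : j ≤ 2 * m + 2) (l : ℂ) (i k : Fin 2) :
    starRingEnd ℂ (residue m x j l i k) =
      residue m x (2 * m + 2 - j) (starRingEnd ℂ l) i k := by
  have h1 : twist m ^ (2 * m + 2 - j) = (twist m ^ j)⁻¹ := by
    refine eq_inv_of_mul_eq_one_left ?_
    rw [← pow_add, Nat.sub_add_cancel hj, twist_pow_card]
  have h2 : (-1 : ℂ) ^ (2 * m + 2 - j) = (-1) ^ j := by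
    have : (-1 : ℂ) ^ (2 * m + 2 - j) * (-1) ^ j = 1 := by
      rw [← pow_add, Nat.sub_add_cancel hj, Even.neg_one_pow ⟨m + 1, by ring⟩]
    have h3 : (-1 : ℂ) ^ j * (-1) ^ j = 1 := by rw [← mul_pow]; simp
    calc _ = (-1 : ℂ) ^ (2 * m + 2 - j) * ((-1) ^ j * (-1) ^ j) := by rw [h3, mul_one]
      _ = _ := by rw [← mul_assoc, this, one_mul]
  rw [residue_eq, residue_eq, h1, h2]
  fin_cases i <;> fin_cases k <;>
    simp [W.conj_eval, conj_twist]

/-- Conjugation exchanges `p_j` with `p_{n-j}` and `A_j(λ)` with `A_{n-j}(conj λ)`, as the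
coefficients are real, so the sum over the punctures is only permuted. -/
theorem potential_conj (t : ℝ) (x : Param ρ) (z l : ℂ) (i k : Fin 2) :
    starRingEnd ℂ (potential m t x z l i k) =
      potential m t x (starRingEnd ℂ z) (starRingEnd ℂ l) i k := by
  set f : ℕ → ℂ := fun j => (starRingEnd ℂ z - puncture m j)⁻¹ *
    residue m x j (starRingEnd ℂ l) i k with hf
  have hper : f (2 * m + 2) = f 0 := by
    rw [hf]
    simp only
    rw [puncture_card, residue_card]
  have hsum : ∑ j ∈ Finset.range (2 * m + 2),
      starRingEnd ℂ ((z - puncture m j)⁻¹ * residue m x j l i k) =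
      ∑ j ∈ Finset.range (2 * m + 2), f j := by
    -- Reflecting the range sends `j` to `n - 1 - j` rather than to `n - j`, so periodicity is used
    -- to shift the summation index by one.
    have h1 : ∑ j ∈ Finset.range (2 * m + 2), f j = ∑ j ∈ Finset.range (2 * m + 2), f (j + 1) := by
      have := Finset.sum_range_succ f (2 * m + 2)
      rw [Finset.sum_range_succ', hper] at this
      exact (add_right_cancel this).symm
    rw [h1, ← Finset.sum_range_reflect]
    refine Finset.sum_congr rfl fun j hj => ?_
    have hj' := Finset.mem_range.mp hj
    have hle : 2 * m + 2 - 1 - j ≤ 2 * m + 2 := by omega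
    rw [map_mul, map_inv₀, map_sub, conj_puncture m hle, conj_residue m x hle,
      show 2 * m + 2 - (2 * m + 2 - 1 - j) = j + 1 by omega]
  simp only [potential, Matrix.add_apply, Matrix.smul_apply, Matrix.sum_apply, smul_eq_mul,
    map_add, map_mul, Complex.conj_ofReal, map_sum] at hsum ⊢
  rw [hsum]
  congr 1
  fin_cases i <;> fin_cases k <;> simp [Complex.conj_ofReal]

end Residue

end

end DPW

/-! ### Uniqueness of the continued solution and monodromy of the reversed loop. -/

namespace DPW

noncomputable section

section Uniqueness

/-- Uniqueness for linear matrix differential equations on the unit interval. -/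
theorem linear_ode_unique {C Y Z : ℝ → Matrix (Fin 2) (Fin 2) ℂ}
    (hC : ∀ i j, ContinuousOn (fun s => C s i j) (Set.Icc 0 1))
    (hY : ∀ s ∈ Set.Icc (0 : ℝ) 1, ∀ i j,
      HasDerivWithinAt (fun u => Y u i j) ((Y s * C s) i j) (Set.Icc 0 1) s)
    (hZ : ∀ s ∈ Set.Icc (0 : ℝ) 1, ∀ i j,
      HasDerivWithinAt (fun u => Z u i j) ((Z s * C s) i j) (Set.Icc 0 1) s)
    (h0 : Y 0 = Z 0) {s : ℝ} (hs : s ∈ Set.Icc (0 : ℝ) 1) : Y s = Z s := by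
  have hb : ∃ K : ℝ, 0 ≤ K ∧ ∀ s ∈ Set.Icc (0 : ℝ) 1, ∀ i j, ‖C s i j‖ ≤ K := by
    have : ∀ i j, ∃ K : ℝ, ∀ s ∈ Set.Icc (0 : ℝ) 1, ‖C s i j‖ ≤ K := fun i j =>
      isCompact_Icc.exists_bound_of_continuousOn (hC i j)
    choose K hK using this
    refine ⟨∑ i, ∑ j, |K i j|, by positivity, fun s hs i j => (hK i j s hs).trans ?_⟩
    refine (le_abs_self _).trans ?_
    refine (Finset.single_le_sum (f := fun j => |K i j|) (fun _ _ => abs_nonneg _)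
      (Finset.mem_univ j)).trans ?_
    exact Finset.single_le_sum (f := fun i => ∑ j, |K i j|)
      (fun _ _ => Finset.sum_nonneg fun _ _ => abs_nonneg _) (Finset.mem_univ i)
  obtain ⟨K, hK0, hK⟩ := hb
  let v : ℝ → (Fin 2 → Fin 2 → ℂ) → (Fin 2 → Fin 2 → ℂ) :=
    fun s y i j => ∑ k, y i k * C s k j
  -- Each entry of a product of `2 × 2` matrices has two terms, whence the Lipschitz constant `2 K`
  -- for the sup distance.
  have hv : ∀ s ∈ Set.Ico (0 : ℝ) 1, LipschitzOnWith (Real.toNNReal (2 * K)) (v s) Set.univ := by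
    intro s hs
    refine LipschitzOnWith.of_dist_le_mul fun y _ z _ => ?_
    have hnn : 0 ≤ 2 * K * dist y z := by positivity
    rw [Real.coe_toNNReal _ (by positivity)]
    refine (dist_pi_le_iff hnn).mpr fun i => (dist_pi_le_iff hnn).mpr fun j => ?_
    have hyz : ∀ k, ‖(y i k - z i k) * C s k j‖ ≤ dist y z * K := fun k => by
      rw [norm_mul, ← dist_eq_norm]
      exact mul_le_mul ((dist_le_pi_dist (y i) (z i) k).trans (dist_le_pi_dist y z i))
        (hK s ⟨hs.1, hs.2.le⟩ k j) (norm_nonneg _) dist_nonneg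
    have e : v s y i j - v s z i j = ∑ k, (y i k - z i k) * C s k j := by
      simp only [v, sub_mul, Finset.sum_sub_distrib]
    rw [dist_eq_norm, e, Fin.sum_univ_two]
    refine (norm_add_le _ _).trans ?_
    linarith [hyz 0, hyz 1]
  have hsol : ∀ {Y : ℝ → Matrix (Fin 2) (Fin 2) ℂ}, (∀ s ∈ Set.Icc (0 : ℝ) 1, ∀ i j,
      HasDerivWithinAt (fun u => Y u i j) ((Y s * C s) i j) (Set.Icc 0 1) s) →
      ∀ s ∈ Set.Icc (0 : ℝ) 1, HasDerivWithinAt (fun u => (fun i j => Y u i j : Fin 2 → Fin 2 → ℂ))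
        (v s (fun i j => Y s i j)) (Set.Icc 0 1) s := fun h s hs =>
    hasDerivWithinAt_pi.mpr fun i => hasDerivWithinAt_pi.mpr fun j => h s hs i j
  have hIci : ∀ {Y : ℝ → Fin 2 → Fin 2 → ℂ} {Y' : Fin 2 → Fin 2 → ℂ} {s : ℝ},
      s ∈ Set.Ico (0 : ℝ) 1 → HasDerivWithinAt Y Y' (Set.Icc 0 1) s →
      HasDerivWithinAt Y Y' (Set.Ici s) s := fun hs h =>
    h.mono_of_mem_nhdsWithin (Icc_mem_nhdsGE_of_mem hs)
  have key := ODE_solution_unique_of_mem_Icc_right (s := fun _ => Set.univ) hv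
    (f := fun u i j => Y u i j) (g := fun u i j => Z u i j)
    (fun u hu => (hsol hY u hu).continuousWithinAt)
    (fun u hu => hIci hu (hsol hY u ⟨hu.1, hu.2.le⟩)) (fun _ _ => Set.mem_univ _)
    (fun u hu => (hsol hZ u hu).continuousWithinAt)
    (fun u hu => hIci hu (hsol hZ u ⟨hu.1, hu.2.le⟩)) (fun _ _ => Set.mem_univ _)
    (by rw [h0])
  exact key hs

end Uniqueness

variable {ρ : ℝ} [Fact (1 < ρ)]

section Monodromy

variable (m : ℕ)

/-- The coefficient matrix of the differential equation along the loop. -/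
def loopCoeff (t : ℝ) (x : Param ρ) (l : ℂ) (s : ℝ) : Matrix (Fin 2) (Fin 2) ℂ :=
  deriv (loop m) s • potential m t x (loop m s) l

theorem continuousOn_loopCoeff (t : ℝ) (x : Param ρ) (l : ℂ) (i k : Fin 2) :
    ContinuousOn (fun s => loopCoeff m t x l s i k) (Set.Icc 0 1) := by
  have h1 : ContinuousOn (fun s => ∑ j ∈ Finset.range (2 * m + 2),
      (loop m s - puncture m j)⁻¹ * residue m x j l i k) (Set.Icc 0 1) :=
    continuousOn_finsetSum _ fun j hj =>
      (((continuous_loop m).continuousOn.sub continuousOn_const).inv₀ fun _ hs =>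
        loop_ne_puncture m hs (Finset.mem_range.mp hj)).mul continuousOn_const
  have h2 : ContinuousOn (fun s => (!![0, 0; (m : ℂ) * x.r * loop m s ^ (m - 1), 0] :
      Matrix (Fin 2) (Fin 2) ℂ) i k) (Set.Icc 0 1) := by
    have := ((continuous_loop m).pow (m - 1)).const_mul ((m : ℂ) * x.r) |>.continuousOn
      (s := Set.Icc 0 1)
    fin_cases i <;> fin_cases k <;> simp <;> first | exact continuousOn_const | exact this
  have h3 := (continuous_deriv_loop m).continuousOn.mul
    (h2.add (continuousOn_const (c := (t : ℂ)) |>.mul h1))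
  refine h3.congr fun s _ => ?_
  simp only [loopCoeff, potential, Matrix.smul_apply, Matrix.add_apply, Matrix.sum_apply,
    smul_eq_mul]
  rfl

/-- Uniqueness makes the arbitrary choice in `monodromy` harmless: any solution computes it. -/
theorem monodromy_eq {t : ℝ} {x : Param ρ} {l : ℂ} {Y : ℝ → Matrix (Fin 2) (Fin 2) ℂ}
    (hY : IsSolutionAlongLoop m t x l Y) : monodromy m t x l = Y 1 := by
  have h : ∃ Y, IsSolutionAlongLoop m t x l Y := ⟨Y, hY⟩
  rw [monodromy, dif_pos h]
  have h2 := h.choose_spec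
  exact linear_ode_unique (continuousOn_loopCoeff m t x l) h2.2 hY.2 (h2.1.trans hY.1.symm)
    ⟨zero_le_one, le_rfl⟩

theorem conj_loopCoeff (t : ℝ) (x : Param ρ) (l : ℂ) (s : ℝ) (i k : Fin 2) :
    starRingEnd ℂ (loopCoeff m t x (starRingEnd ℂ l) (1 - s) i k) = -loopCoeff m t x l s i k := by
  simp only [loopCoeff, Matrix.smul_apply, smul_eq_mul, map_mul, potential_conj,
    deriv_loop_one_sub, loop_one_sub, Complex.conj_conj]
  ring

/-- The symmetry of the potential under complex conjugation reverses the loop. -/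
theorem conj_monodromy_mul {t : ℝ} {x : Param ρ} {l : ℂ}
    (h1 : ∃ Y, IsSolutionAlongLoop m t x (starRingEnd ℂ l) Y)
    (h2 : ∃ Y, IsSolutionAlongLoop m t x l Y) :
    (monodromy m t x (starRingEnd ℂ l)).map (starRingEnd ℂ) * monodromy m t x l = 1 := by
  obtain ⟨Y, hY⟩ := h1
  obtain ⟨V, hV⟩ := h2
  rw [monodromy_eq m hY, monodromy_eq m hV]
  -- Conjugating and reversing the solution at `conj λ` gives a solution at `λ`, because the two
  -- signs from `s ↦ 1 - s` cancel.
  have hZ : ∀ s ∈ Set.Icc (0 : ℝ) 1, ∀ i j,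
      HasDerivWithinAt (fun u => ((Y (1 - u)).map (starRingEnd ℂ)) i j)
        (((Y (1 - s)).map (starRingEnd ℂ) * loopCoeff m t x l s) i j) (Set.Icc 0 1) s := by
    intro s hs i j
    have hs' : 1 - s ∈ Set.Icc (0 : ℝ) 1 := ⟨by linarith [hs.2], by linarith [hs.1]⟩
    have hd := (hY.2 (1 - s) hs' i j).scomp s
      (((hasDerivAt_id s).const_sub 1).hasDerivWithinAt (s := Set.Icc (0 : ℝ) 1))
      (fun u hu => ⟨by simpa using hu.2, by simpa using hu.1⟩)
    have hd2 := (Complex.conjCLE : ℂ →L[ℝ] ℂ).hasFDerivAt.comp_hasDerivWithinAt s hd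
    refine hd2.congr_deriv ?_
    change starRingEnd ℂ ((-1 : ℝ) • (Y (1 - s) *
      loopCoeff m t x (starRingEnd ℂ l) (1 - s)) i j) = _
    rw [neg_one_smul, map_neg, Matrix.mul_apply, Matrix.mul_apply, map_sum, ← Finset.sum_neg_distrib]
    refine Finset.sum_congr rfl fun k _ => ?_
    rw [map_mul, conj_loopCoeff, Matrix.map_apply]
    ring
  -- The solution `V` multiplied on the left by the constant `conj Y(1)` has the same initial value.
  -- Comparison at `s = 1`, where the reversed solution equals `conj Y(0) = 1`, gives the claim.
  have hW : ∀ s ∈ Set.Icc (0 : ℝ) 1, ∀ i j,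
      HasDerivWithinAt (fun u => ((Y 1).map (starRingEnd ℂ) * V u) i j)
        (((Y 1).map (starRingEnd ℂ) * V s * loopCoeff m t x l s) i j) (Set.Icc 0 1) s := by
    intro s hs i j
    simp only [Matrix.mul_assoc]
    simp only [Matrix.mul_apply (M := (Y 1).map (starRingEnd ℂ))]
    exact HasDerivWithinAt.fun_sum fun k _ => (hV.2 s hs k j).const_mul _
  have := linear_ode_unique (continuousOn_loopCoeff m t x l) hZ hW
    (by rw [sub_zero, hV.1, mul_one]) (s := 1) ⟨zero_le_one, le_rfl⟩
  rw [← this, sub_self, hY.1]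
  ext i j
  rw [Matrix.map_apply, Matrix.one_apply]
  split_ifs <;> simp

end Monodromy

/-! ### The symmetry `(t, λ) ↦ (-t, -λ)`. -/

section Parity

variable (m : ℕ)

/-- The parameter `(r, -a(-λ), b(-λ), c(-λ))`. -/
def Param.parity (x : Param ρ) : Param ρ :=
  (x.r, -W.reflect x.a, W.reflect x.b, W.reflect x.c)

theorem Param.parity_r (x : Param ρ) : x.parity.r = x.r := rfl

theorem Param.parity_a (x : Param ρ) : x.parity.a = -W.reflect x.a := rfl

theorem Param.parity_b (x : Param ρ) : x.parity.b = W.reflect x.b := rfl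

theorem Param.parity_c (x : Param ρ) : x.parity.c = W.reflect x.c := rfl

theorem W.eval_neg (f : W ρ) (l : ℂ) : (-f).eval l = -f.eval l := by
  rw [W.eval, W.eval, ← tsum_neg]
  refine tsum_congr fun k => ?_
  have : (-f).coeff k = -f.coeff k := rfl
  rw [this, Complex.ofReal_neg, neg_mul]

theorem Param.parity_parity (x : Param ρ) : x.parity.parity = x := by
  simp only [Param.parity, Param.r, Param.a, Param.b, Param.c, map_neg, W.reflect_reflect, neg_neg]

theorem continuous_parity : Continuous (Param.parity : Param ρ → Param ρ) := by
  have h : Continuous (W.reflect : W ρ → W ρ) := W.reflect.continuous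
  refine continuous_fst.prodMk (Continuous.prodMk ?_ (Continuous.prodMk ?_ ?_))
  · exact (h.comp (continuous_fst.comp continuous_snd)).neg
  · exact h.comp (continuous_fst.comp (continuous_snd.comp continuous_snd))
  · exact h.comp (continuous_snd.comp (continuous_snd.comp continuous_snd))

/-- The diagonal gets its sign from `-a(-λ)`, while the off-diagonal entries get theirs from the odd
factors `λ⁻¹` and `λ`. -/
theorem residue_parity (x : Param ρ) (j : ℕ) (l : ℂ) :
    residue m x.parity j l = -residue m x j (-l) := by
  rw [residue_eq, residue_eq, Param.parity_a, Param.parity_b, Param.parity_c, W.eval_neg,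
    W.eval_reflect, W.eval_reflect, W.eval_reflect]
  ext i k
  fin_cases i <;> fin_cases k <;> simp [inv_neg]

/-- The sign of the residues is absorbed into `t`, and the remaining term depends on neither `t` nor
`λ`. -/
theorem potential_parity (t : ℝ) (x : Param ρ) (z l : ℂ) :
    potential m t x.parity z l = potential m (-t) x z (-l) := by
  simp only [potential, residue_parity, Param.parity_r, smul_neg, Finset.sum_neg_distrib,
    Complex.ofReal_neg, neg_smul]

theorem monodromy_parity (t : ℝ) (x : Param ρ) (l : ℂ) :
    monodromy m t x.parity l = monodromy m (-t) x (-l) := by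
  have : IsSolutionAlongLoop m t x.parity l = IsSolutionAlongLoop m (-t) x (-l) := by
    funext Y
    simp only [IsSolutionAlongLoop, potential_parity]
  unfold monodromy
  rw [this]

/-- The monodromies agree, so the sign comes from `1/t` or, at `t = 0`, from differentiating in
`-t`. -/
theorem logMonodromy_parity (t : ℝ) (x : Param ρ) (l : ℂ) :
    logMonodromy m t x.parity l = -logMonodromy m (-t) x (-l) := by
  by_cases ht : t = 0
  · subst ht
    rw [logMonodromy, if_pos rfl, logMonodromy, if_pos neg_zero]
    ext i j
    simp only [monodromy_parity, Matrix.of_apply, Matrix.neg_apply]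
    have := deriv_comp_neg (fun s : ℝ => monodromy m s x (-l) i j) 0
    rw [neg_zero] at this
    exact this
  · rw [logMonodromy, if_neg ht, logMonodromy, if_neg (neg_ne_zero.mpr ht), monodromy_parity,
      Complex.ofReal_neg, inv_neg, neg_smul, neg_neg]

/-- The loop equations are homogeneous in `M̃` and the annulus is symmetric. The conditions at `λ =
1` and `λ = -1` change places, and `calK` sees `a⁰` only through its square. -/
theorem SolvesMonodromyProblem.parity {t : ℝ} {x : Param ρ}
    (h : SolvesMonodromyProblem m (-t) x) : SolvesMonodromyProblem m t x.parity := by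
  obtain ⟨hF, hG, h1, h2, hK⟩ := h
  have hstar : ∀ (l : ℂ), (1 : ℂ) / starRingEnd ℂ (-l) = -(1 / starRingEnd ℂ l) := fun l => by
    rw [map_neg, div_neg]
  refine ⟨fun l hl => ?_, fun l hl => ?_, ?_, ?_, ?_⟩
  · have := hF (-l) (Laurent.neg_mem_annulus hl)
    rw [calF, starInv, hstar] at this
    rw [calF, starInv, logMonodromy_parity, logMonodromy_parity, Matrix.neg_apply,
      Matrix.neg_apply, map_neg]
    linear_combination -this
  · have := hG (-l) (Laurent.neg_mem_annulus hl)
    rw [calG, starInv, hstar] at this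
    rw [calG, starInv, logMonodromy_parity, logMonodromy_parity, Matrix.neg_apply,
      Matrix.neg_apply, map_neg]
    linear_combination -this
  · rw [calH₂] at h2
    rw [calH₁, logMonodromy_parity, Matrix.neg_apply]
    linear_combination -h2
  · rw [calH₁] at h1
    rw [calH₂, logMonodromy_parity, Matrix.neg_apply, neg_neg]
    linear_combination -h1
  · rw [← hK, calK, calK, Param.parity_a, Param.parity_b, Param.parity_c]
    have : (-W.reflect x.a).coeff 0 = -(W.reflect x.a).coeff 0 := rfl
    rw [this]
    simp only [W.coeff_reflect, pow_zero, one_mul]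
    ring

theorem paramParity_iff {x y : Param ρ} : ParamParity x y ↔ y = x.parity := by
  constructor
  · rintro ⟨ha, hb, hc, hr⟩
    have hA : W.reflect y.a = -x.a := W.toLaurent_ext fun l hl => by
      rw [W.eval_reflect, ha l hl.2, W.eval_neg]
    have hB : W.reflect y.b = x.b := W.toLaurent_ext fun l hl => by
      rw [W.eval_reflect, hb l hl.2]
    have hC : W.reflect y.c = x.c := W.toLaurent_ext fun l hl => by
      rw [W.eval_reflect, hc l hl.2]
    have e1 : y.a = -W.reflect x.a := by
      rw [← map_neg, ← hA, W.reflect_reflect]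
    have e2 : y.b = W.reflect x.b := by rw [← hB, W.reflect_reflect]
    have e3 : y.c = W.reflect x.c := by rw [← hC, W.reflect_reflect]
    exact Prod.ext hr (Prod.ext e1 (Prod.ext e2 e3))
  · rintro rfl
    refine ⟨fun l _ => ?_, fun l _ => ?_, fun l _ => ?_, rfl⟩
    · rw [Param.parity_a, W.eval_neg, W.eval_reflect, neg_neg]
    · rw [Param.parity_b, W.eval_reflect, neg_neg]
    · rw [Param.parity_c, W.eval_reflect, neg_neg]

theorem potentialParity_of_eq (t : ℝ) (x : Param ρ) : PotentialParity m t x x.parity := by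
  intro l _ z _
  rw [potential_parity, neg_neg, neg_neg]

/-- The residue of the potential at `p_0 = 1`. -/
theorem tendsto_residue (t : ℝ) (x : Param ρ) (l : ℂ) (i k : Fin 2) :
    Filter.Tendsto (fun z => (z - 1) * potential m t x z l i k) (𝓝[≠] 1)
      (𝓝 (t * residue m x 0 l i k)) := by
  have hne : ∀ j < 2 * m + 1, (1 : ℂ) - puncture m (j + 1) ≠ 0 := fun j hj h => by
    have := one_sub_loop_div_mem_slitPlane m (s := 1 / 2) (by norm_num) (Nat.succ_pos j)
      (by omega : j + 1 < 2 * m + 2)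
    rw [loop_half, ← sub_eq_zero.mp h, Complex.mem_slitPlane_iff] at this
    norm_num at this
  have h1 : ContinuousAt (fun z : ℂ => (z - 1) * ((!![0, 0; (m : ℂ) * x.r * z ^ (m - 1), 0] :
      Matrix (Fin 2) (Fin 2) ℂ) i k + t * ∑ j ∈ Finset.range (2 * m + 1),
        (z - puncture m (j + 1))⁻¹ * residue m x (j + 1) l i k) +
      t * residue m x 0 l i k) 1 := by
    have h2 : ContinuousAt (fun z : ℂ => (!![0, 0; (m : ℂ) * x.r * z ^ (m - 1), 0] :
      Matrix (Fin 2) (Fin 2) ℂ) i k) 1 := by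
      have : ContinuousAt (fun z : ℂ => (m : ℂ) * x.r * z ^ (m - 1)) 1 := by fun_prop
      fin_cases i <;> fin_cases k <;> simp <;> first | exact continuousAt_const | exact this
    have h3 : ContinuousAt (fun z : ℂ => ∑ j ∈ Finset.range (2 * m + 1),
        (z - puncture m (j + 1))⁻¹ * residue m x (j + 1) l i k) 1 :=
      tendsto_finsetSum _ fun j hj =>
        (((continuousAt_id.sub continuousAt_const).inv₀
          (hne j (Finset.mem_range.mp hj))).mul continuousAt_const)
    exact ((continuousAt_id.sub continuousAt_const).mul
      (h2.add (continuousAt_const.mul h3))).add continuousAt_const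
  have h2 := h1.tendsto.mono_left (nhdsWithin_le_nhds (s := {1}ᶜ))
  simp only [sub_self, zero_mul, zero_add] at h2
  refine h2.congr' ?_
  filter_upwards [self_mem_nhdsWithin] with z hz
  have hz' : z - 1 ≠ 0 := sub_ne_zero.mpr hz
  rw [potential, Finset.sum_range_succ' _ (2 * m + 1), puncture_zero]
  simp only [Matrix.add_apply, Matrix.smul_apply, Matrix.sum_apply, smul_eq_mul]
  field_simp
  ring

/-- Comparing residues at `z = 1` and dividing by `t ≠ 0` recovers `a`, `b`, `c`. Once the pole
terms agree, the regular term gives `r`. -/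
theorem eq_parity_of_potentialParity {t : ℝ} (ht : t ≠ 0) {x y : Param ρ}
    (hm : 1 ≤ m) (h : PotentialParity m t x y) : y = x.parity := by
  have hres : ∀ l ∈ annulus ρ, residue m y 0 (-l) = -residue m x 0 l := fun l hl => by
    ext i k
    have h1 := tendsto_residue m (-t) y (-l) i k
    have h2 := tendsto_residue m t x l i k
    have h3 : Filter.Tendsto (fun z => (z - 1) * potential m t x z l i k) (𝓝[≠] 1)
        (𝓝 ((-t : ℝ) * residue m y 0 (-l) i k)) := by
      refine h1.congr' ?_
      -- The identity is only assumed off the punctures. The other punctures form a finite set, so a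
      -- punctured neighbourhood of `1` avoids them.
      have hfin : ({z : ℂ | ∃ j < 2 * m + 2, z = puncture m j} \ {1}).Finite := by
        refine (((Finset.range (2 * m + 2)).finite_toSet.image (puncture m)).subset ?_).subset
          Set.sdiff_subset
        rintro z ⟨j, hj, rfl⟩
        exact ⟨j, by simpa using hj, rfl⟩
      have hev := nhdsWithin_le_nhds (s := {(1 : ℂ)}ᶜ)
        (hfin.isClosed.isOpen_compl.mem_nhds (x := (1 : ℂ)) (by simp))
      filter_upwards [hev, self_mem_nhdsWithin] with z hz hz1
      rw [h l hl z fun j hj hzj => hz ⟨⟨j, hj, hzj⟩, hz1⟩]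
    have h4 := tendsto_nhds_unique h2 h3
    have ht' : (t : ℂ) ≠ 0 := Complex.ofReal_ne_zero.mpr ht
    rw [Complex.ofReal_neg, neg_mul, ← mul_neg] at h4
    rw [Matrix.neg_apply, mul_left_cancel₀ ht' h4, neg_neg]
  have hent : ∀ l ∈ annulus ρ, ∀ i k, residue m y 0 (-l) i k = -residue m x 0 l i k :=
    fun l hl i k => by rw [hres l hl, Matrix.neg_apply]
  have hA : W.reflect y.a = -x.a := W.toLaurent_ext fun l hl => by
    rw [W.eval_reflect, W.eval_neg]
    exact hent l hl 0 0
  have hB : W.reflect y.b = x.b := W.toLaurent_ext fun l hl => by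
    have := hent l hl 0 1
    change (-l)⁻¹ * y.b.eval (-l) = -(l⁻¹ * x.b.eval l) at this
    rw [inv_neg, neg_mul, neg_inj] at this
    rw [W.eval_reflect]
    exact mul_left_cancel₀ (inv_ne_zero (Laurent.ne_zero_of_mem hl)) this
  have hC : W.reflect y.c = x.c := W.toLaurent_ext fun l hl => by
    have := hent l hl 1 0
    change (-l) * y.c.eval (-l) = -(l * x.c.eval l) at this
    rw [neg_mul, neg_inj] at this
    rw [W.eval_reflect]
    exact mul_left_cancel₀ (Laurent.ne_zero_of_mem hl) this
  have e1 : y.a = -W.reflect x.a := by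
    rw [← map_neg, ← hA, W.reflect_reflect]
  have e2 : y.b = W.reflect x.b := by rw [← hB, W.reflect_reflect]
  have e3 : y.c = W.reflect x.c := by rw [← hC, W.reflect_reflect]
  -- One sample point suffices: `z = 2` is not a puncture, as these have modulus `1`, and the
  -- coefficient `m 2^(m-1)` is nonzero because `m ≥ 1`.
  have hr : y.r = x.r := by
    have hl : (1 : ℂ) ∈ annulus ρ := Laurent.mem_annulus_of_norm_one (by simp)
    have h2 : ∀ j < 2 * m + 2, (2 : ℂ) ≠ puncture m j := fun j _ hj => by
      have := congrArg norm hj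
      rw [puncture_eq, Complex.norm_exp_ofReal_mul_I] at this
      norm_num at this
    have h3 := congrFun (congrFun (h 1 hl 2 h2) 1) 0
    have h4 := congrFun (congrFun (potentialParity_of_eq m t x 1 hl 2 h2) 1) 0
    rw [← h4] at h3
    have hresid : ∀ j, residue m y j (-1) = residue m x.parity j (-1) := fun j => by
      rw [residue_eq, residue_eq, e1, e2, e3]
      rfl
    simp only [potential, hresid, Matrix.add_apply, add_left_inj] at h3
    have h5 : (m : ℂ) * y.r * 2 ^ (m - 1) = (m : ℂ) * x.r * 2 ^ (m - 1) := h3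
    have hm0 : (m : ℂ) ≠ 0 := Nat.cast_ne_zero.mpr (by omega)
    have h6 := mul_left_cancel₀ hm0 (mul_right_cancel₀ (pow_ne_zero (m - 1) two_ne_zero) h5)
    exact_mod_cast h6
  exact Prod.ext hr (Prod.ext e1 (Prod.ext e2 e3))

end Parity

end

end DPW

/-! ### Matrices of Laurent series and the residues as linear functions of the parameters. -/

namespace DPW

noncomputable section

variable {ρ : ℝ} [Fact (1 < ρ)]

/-- The Banach algebra of `2 × 2` matrices of Laurent series. -/
def LoopMat (ρ : ℝ) [Fact (1 < ρ)] : Type := Matrix (Fin 2) (Fin 2) (Laurent ρ)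

namespace LoopMat

instance : NormedRing (LoopMat ρ) :=
  (Matrix.linftyOpNormedRing : NormedRing (Matrix (Fin 2) (Fin 2) (Laurent ρ)))

instance : NormedAlgebra ℂ (LoopMat ρ) :=
  @Matrix.linftyOpNormedAlgebra ℂ (Fin 2) (Laurent ρ) _ _ _ _ _

instance : CompleteSpace (LoopMat ρ) :=
  inferInstanceAs (CompleteSpace (Matrix (Fin 2) (Fin 2) (Laurent ρ)))

/-- The entries, as continuous linear maps. -/
def entryL (i j : Fin 2) : LoopMat ρ →L[ℂ] Laurent ρ where
  toFun X := (X : Matrix (Fin 2) (Fin 2) (Laurent ρ)) i j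
  map_add' _ _ := rfl
  map_smul' _ _ := rfl
  cont := (continuous_apply j).comp (continuous_apply i :
    Continuous fun X : Matrix (Fin 2) (Fin 2) (Laurent ρ) => X i)

/-- Evaluation of a matrix of Laurent series at a point of the annulus. -/
def evMat (l : ℂ) : LoopMat ρ →L[ℂ] Matrix (Fin 2) (Fin 2) ℂ where
  toFun X := Matrix.of fun i j => Laurent.ev l (entryL i j X)
  map_add' X Y := by
    ext i j
    simp
  map_smul' c X := by
    ext i j
    simp
  cont := continuous_matrix fun i j => ((Laurent.ev l).comp (entryL i j)).continuous

theorem evMat_apply (l : ℂ) (X : LoopMat ρ) (i j : Fin 2) :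
    evMat l X i j = Laurent.ev l (entryL i j X) := rfl

theorem entryL_mul (X Y : LoopMat ρ) (i j : Fin 2) :
    entryL i j (X * Y) = ∑ k, entryL i k X * entryL k j Y :=
  @Matrix.mul_apply (Fin 2) (Fin 2) (Fin 2) (Laurent ρ) _ _ _ X Y i j

theorem entryL_one (i j : Fin 2) : entryL i j (1 : LoopMat ρ) = if i = j then 1 else 0 :=
  @Matrix.one_apply (Fin 2) (Laurent ρ) _ _ _ i j

theorem evMat_mul {l : ℂ} (hl : l ∈ annulus ρ) (X Y : LoopMat ρ) :
    evMat l (X * Y) = evMat l X * evMat l Y := by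
  ext i j
  rw [evMat_apply, entryL_mul, Matrix.mul_apply, map_sum]
  refine Finset.sum_congr rfl fun k _ => ?_
  rw [Laurent.ev_mul hl]
  rfl

theorem evMat_one {l : ℂ} (hl : l ∈ annulus ρ) : evMat l (1 : LoopMat ρ) = 1 := by
  ext i j
  rw [evMat_apply, entryL_one, Matrix.one_apply]
  split_ifs
  · exact Laurent.ev_one hl
  · exact map_zero _

theorem evMat_pow {l : ℂ} (hl : l ∈ annulus ρ) (X : LoopMat ρ) (k : ℕ) :
    evMat l (X ^ k) = evMat l X ^ k := by
  induction k with
  | zero => rw [pow_zero, pow_zero, evMat_one hl]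
  | succ k ih => rw [pow_succ, pow_succ, evMat_mul hl, ih]

/-- The elementary matrix `(0, 0; 1, 0)`. -/
def nil : LoopMat ρ := (!![0, 0; 1, 0] : Matrix (Fin 2) (Fin 2) (Laurent ρ))

theorem evMat_nil {l : ℂ} (hl : l ∈ annulus ρ) : evMat l (nil : LoopMat ρ) = !![0, 0; 1, 0] := by
  ext i j
  rw [evMat_apply]
  fin_cases i <;> fin_cases j
  · exact map_zero _
  · exact map_zero _
  · exact Laurent.ev_one hl
  · exact map_zero _

end LoopMat

open LoopMat

theorem W.eval_reflect_pow (f : W ρ) (j : ℕ) (l : ℂ) :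
    ((W.reflect ^ j) f).eval l = f.eval ((-1) ^ j * l) := by
  induction j generalizing l with
  | zero => rw [pow_zero, pow_zero, one_mul]; rfl
  | succ j ih =>
    rw [pow_succ']
    change (W.reflect ((W.reflect ^ j) f)).eval l = _
    rw [W.eval_reflect, ih]
    congr 1
    ring

/-- The residue `A_j` as a matrix of Laurent series, linear in the parameters. -/
def residueL (m j : ℕ) : Param ρ →L[ℝ] LoopMat ρ where
  toFun x := (!![W.toLaurent ((W.reflect ^ j) x.a),
    ((twist m ^ j)⁻¹ * (-1) ^ j) • (Laurent.T (-1) * W.toLaurent ((W.reflect ^ j) x.b));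
    (twist m ^ j * (-1) ^ j) • (Laurent.T 1 * W.toLaurent ((W.reflect ^ j) x.c)),
    -W.toLaurent ((W.reflect ^ j) x.a)] : Matrix (Fin 2) (Fin 2) (Laurent ρ))
  map_add' x y := by
    have h1 : (x + y).a = x.a + y.a := rfl
    have h2 : (x + y).b = x.b + y.b := rfl
    have h3 : (x + y).c = x.c + y.c := rfl
    rw [h1, h2, h3]
    refine Matrix.ext fun i k => ?_
    simp only [map_add, mul_add, smul_add, neg_add]
    fin_cases i <;> fin_cases k <;> rfl
  map_smul' c x := by
    have h1 : (c • x).a = c • x.a := rfl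
    have h2 : (c • x).b = c • x.b := rfl
    have h3 : (c • x).c = c • x.c := rfl
    rw [h1, h2, h3]
    refine Matrix.ext fun i k => ?_
    simp only [map_smul, mul_smul_comm, smul_comm _ c, ← smul_neg]
    fin_cases i <;> fin_cases k <;> rfl
  cont := by
    have hι : Continuous (W.toLaurent : W ρ → Laurent ρ) := W.toLaurent.continuous
    have hr : Continuous ((W.reflect ^ j : W ρ →L[ℝ] W ρ)) := (W.reflect ^ j).continuous
    have ha : Continuous fun x : Param ρ => x.a := continuous_fst.comp continuous_snd
    have hb : Continuous fun x : Param ρ => x.b :=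
      continuous_fst.comp (continuous_snd.comp continuous_snd)
    have hc : Continuous fun x : Param ρ => x.c :=
      continuous_snd.comp (continuous_snd.comp continuous_snd)
    refine continuous_matrix fun i k => ?_
    fin_cases i <;> fin_cases k
    · exact hι.comp (hr.comp ha)
    · exact (continuous_const.mul (hι.comp (hr.comp hb))).const_smul _
    · exact (continuous_const.mul (hι.comp (hr.comp hc))).const_smul _
    · exact (hι.comp (hr.comp ha)).neg

theorem evMat_residueL (m j : ℕ) (x : Param ρ) {l : ℂ} (hl : l ∈ annulus ρ) :
    evMat l (residueL m j x) = residue m x j l := by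
  have hs : ((-1 : ℂ) ^ j)⁻¹ = (-1) ^ j := by
    refine inv_eq_of_mul_eq_one_left ?_
    rw [← mul_pow]
    simp
  rw [residue_eq]
  ext i k
  rw [evMat_apply]
  fin_cases i <;> fin_cases k
  · change Laurent.ev l (W.toLaurent ((W.reflect ^ j) x.a)) = x.a.eval ((-1) ^ j * l)
    rw [W.ev_toLaurent hl, W.eval_reflect_pow]
  · change Laurent.ev l (((twist m ^ j)⁻¹ * (-1) ^ j) •
      (Laurent.T (-1) * W.toLaurent ((W.reflect ^ j) x.b))) =
      (twist m ^ j)⁻¹ * (((-1) ^ j * l)⁻¹ * x.b.eval ((-1) ^ j * l))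
    rw [map_smul, Laurent.ev_mul hl, Laurent.ev_T hl, W.ev_toLaurent hl, W.eval_reflect_pow,
      mul_inv, hs, zpow_neg_one, smul_eq_mul]
    ring
  · change Laurent.ev l ((twist m ^ j * (-1) ^ j) •
      (Laurent.T 1 * W.toLaurent ((W.reflect ^ j) x.c))) =
      twist m ^ j * (((-1) ^ j * l) * x.c.eval ((-1) ^ j * l))
    rw [map_smul, Laurent.ev_mul hl, Laurent.ev_T hl, W.ev_toLaurent hl, W.eval_reflect_pow,
      zpow_one, smul_eq_mul]
    ring
  · change Laurent.ev l (-W.toLaurent ((W.reflect ^ j) x.a)) = -x.a.eval ((-1) ^ j * l)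
    rw [map_neg, W.ev_toLaurent hl, W.eval_reflect_pow]

/-! ### Scalar kernels along the petal times constant algebra elements. -/

section Path

variable {A : Type*} [NormedRing A] [NormedAlgebra ℂ A]

/-- The path `s ↦ h(s) X`. -/
def pathL (h : C(Set.Icc (0 : ℝ) 1, ℂ)) : A →L[ℂ] C(Set.Icc (0 : ℝ) 1, A) :=
  LinearMap.mkContinuous
    { toFun := fun X => ⟨fun s => h s • X, h.continuous.smul continuous_const⟩
      map_add' := fun X Y => by
        ext s
        exact smul_add _ _ _
      map_smul' := fun c X => by
        ext s
        exact smul_comm _ _ _ } ‖h‖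
    (fun X => by
      refine (ContinuousMap.norm_le _ (by positivity)).mpr fun s => ?_
      refine (norm_smul_le _ _).trans ?_
      gcongr
      exact ContinuousMap.norm_coe_le_norm h s)

theorem pathL_apply (h : C(Set.Icc (0 : ℝ) 1, ℂ)) (X : A) (s : Set.Icc (0 : ℝ) 1) :
    pathL h X s = h s • X := rfl

theorem prim_pathL [CompleteSpace A] (h : C(Set.Icc (0 : ℝ) 1, ℂ)) (X : A) :
    prim (pathL h X) 1 = prim h 1 • X := by
  rw [prim, prim, ← intervalIntegral.integral_smul_const]
  rfl

variable (m : ℕ)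

/-- The kernels `γ'(s) / (γ(s) - p_j)`. -/
def kernel (j : Fin (2 * m + 2)) : C(Set.Icc (0 : ℝ) 1, ℂ) :=
  ⟨fun s => (loop m s - puncture m j)⁻¹ * deriv (loop m) s,
    (continuousOn_kernel m j.2).domRestrict⟩

/-- The path `γ(s)^m`. -/
def loopPow : C(Set.Icc (0 : ℝ) 1, ℂ) :=
  ⟨fun s => loop m s ^ m, ((continuous_loop m).pow m).comp continuous_subtype_val⟩

theorem prim_kernel (j : Fin (2 * m + 2)) (k : ℕ) : prim (loopPow m ^ k * kernel m j) 1 =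
    if j = 0 then 2 * Real.pi * Complex.I else 0 := by
  have h := integral_loop_pow_mul_kernel m j.2 (m * k)
  rw [prim, show (if j = 0 then 2 * Real.pi * Complex.I else (0 : ℂ)) =
    if (j : ℕ) = 0 then 2 * Real.pi * Complex.I else 0 from
      if_congr (by rw [Fin.ext_iff]; rfl) rfl rfl, ← h]
  refine intervalIntegral.integral_congr fun s hs => ?_
  rw [Set.uIcc_of_le zero_le_one] at hs
  rw [Set.IccExtend_of_mem _ _ hs]
  change (loop m s ^ m) ^ k * _ = _
  rw [← pow_mul]
  rfl

end Path

/-! ### The gauged potential `P (∑ A_j dz/(z - p_j)) P⁻¹`, without its factor `t`. -/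

section Gauged

variable (m : ℕ)

/-- The potential along the loop, gauged by the solution `(1, 0; r z^m, 1)` at `t = 0`. -/
def gauged (x : Param ρ) : C(Set.Icc (0 : ℝ) 1, LoopMat ρ) :=
  ∑ j : Fin (2 * m + 2),
    (pathL (loopPow m ^ 0 * kernel m j) (residueL m j x) +
      pathL (loopPow m ^ 1 * kernel m j)
        ((x.r : ℂ) • (nil * residueL m j x - residueL m j x * nil)) -
      pathL (loopPow m ^ 2 * kernel m j) ((x.r : ℂ) ^ 2 • (nil * residueL m j x * nil)))

theorem contDiff_gauged : ContDiff ℝ ω (gauged m : Param ρ → _) := by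
  have hr : ContDiff ℝ ω fun x : Param ρ => (x.r : ℂ) :=
    Complex.ofRealCLM.contDiff.comp contDiff_fst
  have hp (h : C(Set.Icc (0 : ℝ) 1, ℂ)) :
      ContDiff ℝ ω (pathL h : LoopMat ρ → C(Set.Icc (0 : ℝ) 1, LoopMat ρ)) :=
    (pathL h : LoopMat ρ →L[ℂ] C(Set.Icc (0 : ℝ) 1, LoopMat ρ)).contDiff.restrict_scalars ℝ
  refine ContDiff.sum fun j _ => ?_
  have hA : ContDiff ℝ ω (residueL m j : Param ρ → LoopMat ρ) := (residueL m j).contDiff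
  refine (((hp _).comp hA).add ((hp _).comp (hr.smul ?_))).sub ((hp _).comp ((hr.pow 2).smul ?_))
  · exact (contDiff_const.mul hA).sub (hA.mul contDiff_const)
  · exact (contDiff_const.mul hA).mul contDiff_const

/-- Residue theorem: only the pole `p_0 = 1` is enclosed, and there `z^m = 1`. The bracket is `A_0`
conjugated by `(1, 0; r, 1)`, expanded using that `nil` has square zero. -/
theorem prim_gauged (x : Param ρ) : prim (gauged m x) 1 = (2 * Real.pi * Complex.I) •
    (residueL m 0 x + (x.r : ℂ) • (nil * residueL m 0 x - residueL m 0 x * nil) -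
      (x.r : ℂ) ^ 2 • (nil * residueL m 0 x * nil)) := by
  let P : C(Set.Icc (0 : ℝ) 1, LoopMat ρ) →L[ℂ] LoopMat ρ :=
    ContinuousMap.evalCLM ℂ ⟨1, zero_le_one, le_rfl⟩ ∘L primL
  have hP (f : C(Set.Icc (0 : ℝ) 1, LoopMat ρ)) : prim f 1 = P f := rfl
  have hPp (h : C(Set.Icc (0 : ℝ) 1, ℂ)) (X : LoopMat ρ) : P (pathL h X) = prim h 1 • X :=
    prim_pathL h X
  rw [hP, gauged, map_sum]
  simp only [map_add, map_sub, hPp, prim_kernel]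
  rw [Finset.sum_eq_single 0]
  · have h0 : ((0 : Fin (2 * m + 2)) : ℕ) = 0 := rfl
    rw [if_pos rfl, h0]
    module
  · intro j _ hj
    rw [if_neg hj, zero_smul, zero_smul, zero_smul, add_zero, sub_zero]
  · intro h
    exact absurd (Finset.mem_univ _) h

end Gauged

end

end DPW

/-! ### From the gauged equation back to the monodromy and its logarithm. -/

namespace DPW

noncomputable section

variable {ρ : ℝ} [Fact (1 < ρ)]

open LoopMat

section GaugedSolution

variable (m : ℕ)

/-- With `P = (1, 0; w, 1)` the left factor is `P A P⁻¹`, so this is `(P A P⁻¹) P = P A` with no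
inverse in sight. -/
theorem gauge_identity (A : Matrix (Fin 2) (Fin 2) ℂ) (w : ℂ) :
    (A + w • (!![0, 0; 1, 0] * A - A * !![0, 0; 1, 0]) -
      w ^ 2 • (!![0, 0; 1, 0] * A * !![0, 0; 1, 0])) * !![1, 0; w, 1] =
      !![1, 0; w, 1] * A := by
  rw [Matrix.eta_fin_two A]
  ext i j
  fin_cases i <;> fin_cases j <;> simp [Matrix.mul_apply, Fin.sum_univ_two] <;> ring

/-- The product rule for `N P`: the left side is `N' P + N P'`, the right side is `N P` times the
ungauged coefficient. The hypothesis `P * E = E` says that the gauge does not affect the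
`t`-independent term. -/
theorem gauge_transform {A : Matrix (Fin 2) (Fin 2) ℂ} (N : Matrix (Fin 2) (Fin 2) ℂ)
    {P E S : Matrix (Fin 2) (Fin 2) ℂ} {t w : ℂ} (hg : A * P = P * (w • S)) (hP : P * E = E) :
    (t • (N * A)) * P + N * (w • E) = N * P * (w • (E + t • S)) := by
  rw [smul_mul_assoc, Matrix.mul_assoc, hg, smul_add, Matrix.mul_add, Matrix.mul_assoc N P,
    Matrix.mul_assoc N P, Matrix.mul_smul P w E, hP, smul_comm w t S, Matrix.mul_smul P t,
    Matrix.mul_smul N t, add_comm]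

theorem evMat_gauged (x : Param ρ) {l : ℂ} (hl : l ∈ annulus ρ) (s : Set.Icc (0 : ℝ) 1) :
    evMat l (gauged m x s) * !![1, 0; x.r * loop m s ^ m, 1] = !![1, 0; x.r * loop m s ^ m, 1] *
      (deriv (loop m) s • ∑ j ∈ Finset.range (2 * m + 2),
        (loop m s - puncture m j)⁻¹ • residue m x j l) := by
  have hg : evMat l (gauged m x s) = ∑ j : Fin (2 * m + 2),
      ((loop m s - puncture m j)⁻¹ * deriv (loop m) s) • (residue m x j l +
        (x.r * loop m s ^ m) • (!![0, 0; 1, 0] * residue m x j l -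
          residue m x j l * !![0, 0; 1, 0]) -
        (x.r * loop m s ^ m) ^ 2 • (!![0, 0; 1, 0] * residue m x j l * !![0, 0; 1, 0])) := by
    rw [gauged, ContinuousMap.sum_apply, map_sum]
    refine Finset.sum_congr rfl fun j _ => ?_
    rw [ContinuousMap.sub_apply, ContinuousMap.add_apply, pathL_apply, pathL_apply, pathL_apply]
    simp only [map_add, map_sub, map_smul, evMat_mul hl, evMat_nil hl, evMat_residueL m _ x hl]
    have h0 : (loopPow m ^ 0 * kernel m j) s =
        (loop m s - puncture m j)⁻¹ * deriv (loop m) s := by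
      rw [pow_zero, one_mul]
      rfl
    have h1 : (loopPow m ^ 1 * kernel m j) s =
        loop m s ^ m * ((loop m s - puncture m j)⁻¹ * deriv (loop m) s) := by
      rw [pow_one]
      rfl
    have h2 : (loopPow m ^ 2 * kernel m j) s =
        (loop m s ^ m) ^ 2 * ((loop m s - puncture m j)⁻¹ * deriv (loop m) s) := rfl
    rw [h0, h1, h2]
    module
  rw [hg, Finset.sum_mul, Finset.sum_range, Finset.smul_sum, Finset.mul_sum]
  refine Finset.sum_congr rfl fun j _ => ?_
  rw [smul_mul_assoc, gauge_identity, smul_smul, Matrix.mul_smul, mul_comm]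

theorem hasDerivWithinAt_matrix_mul {Y Z : ℝ → Matrix (Fin 2) (Fin 2) ℂ}
    {Y' Z' : Matrix (Fin 2) (Fin 2) ℂ} {S : Set ℝ} {s : ℝ}
    (hY : ∀ i j, HasDerivWithinAt (fun u => Y u i j) (Y' i j) S s)
    (hZ : ∀ i j, HasDerivWithinAt (fun u => Z u i j) (Z' i j) S s) (i j : Fin 2) :
    HasDerivWithinAt (fun u => (Y u * Z u) i j) ((Y' * Z s + Y s * Z') i j) S s := by
  simp only [Matrix.mul_apply, Matrix.add_apply, ← Finset.sum_add_distrib]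
  exact HasDerivWithinAt.fun_sum fun k _ => (hY i k).mul (hZ k j)

/-- The range of times and parameters in which the series for the monodromy and its logarithm
converge. -/
def Small (t : ℝ) (x : Param ρ) : Prop :=
  ‖(t : ℂ) • volterra primL (gauged m x)‖ < 1 ∧ ‖(t : ℂ) • endQuot t (gauged m x)‖ < 1 / 2

/-- Undoing the gauge: `N P` solves the original equation. As `m ≥ 1`, the gauge `P` is the identity
at the base point `z = 0`. -/
theorem isSolutionAlongLoop (hm : 1 ≤ m) {t : ℝ} {x : Param ρ} (h : Small m t x) {l : ℂ}
    (hl : l ∈ annulus ρ) : IsSolutionAlongLoop m t x l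
      (fun s => evMat l (Set.IccExtend zero_le_one (fundSol t (gauged m x)) s) *
        !![1, 0; x.r * loop m s ^ m, 1]) := by
  constructor
  · have h0 : (0 : ℝ) ∈ Set.Icc (0 : ℝ) 1 := ⟨le_rfl, zero_le_one⟩
    simp only
    rw [Set.IccExtend_of_mem _ _ h0, fundSol_start h.1, evMat_one hl, loop_zero,
      zero_pow (by omega), mul_zero, one_mul, Matrix.one_fin_two]
  · intro s hs i j
    have hE : ∀ i j, HasDerivWithinAt
        (fun u => evMat l (Set.IccExtend zero_le_one (fundSol t (gauged m x)) u) i j)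
        (((t : ℂ) • (evMat l (fundSol t (gauged m x) ⟨s, hs⟩) *
          evMat l (gauged m x ⟨s, hs⟩))) i j) (Set.Icc 0 1) s := fun i j => by
      have h1 := hasDerivAt_fundSol h.1 hs
      have h2 := (((Laurent.ev l).comp (entryL i j)).restrictScalars ℝ).hasFDerivAt
        |>.comp_hasDerivWithinAt s h1
      refine h2.congr_deriv ?_
      rw [← evMat_mul hl, ← map_smul]
      rfl
    have hF : ∀ i j, HasDerivWithinAt
        (fun u => (!![1, 0; (x.r : ℂ) * loop m u ^ m, 1] : Matrix (Fin 2) (Fin 2) ℂ) i j)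
        ((deriv (loop m) s • !![0, 0; (m : ℂ) * x.r * loop m s ^ (m - 1), 0] :
          Matrix (Fin 2) (Fin 2) ℂ) i j) (Set.Icc 0 1) s := fun i j => by
      have h1 := (((hasDerivAt_loop m s).pow m).const_mul (x.r : ℂ)).hasDerivWithinAt
        (s := Set.Icc (0 : ℝ) 1)
      fin_cases i <;> fin_cases j <;> simp
      · exact hasDerivWithinAt_const _ _ _
      · exact hasDerivWithinAt_const _ _ _
      · refine h1.congr_deriv ?_
        ring
      · exact hasDerivWithinAt_const _ _ _
    refine (hasDerivWithinAt_matrix_mul hE hF i j).congr_deriv ?_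
    have hg := evMat_gauged m x hl ⟨s, hs⟩
    simp only at hg
    -- The derivative of the gauge is a multiple of the nilpotent matrix, so multiplication by the
    -- unipotent gauge leaves it unchanged.
    have h0 : (!![1, 0; (x.r : ℂ) * loop m s ^ m, 1] : Matrix (Fin 2) (Fin 2) ℂ) *
        !![0, 0; (m : ℂ) * x.r * loop m s ^ (m - 1), 0] =
        !![0, 0; (m : ℂ) * x.r * loop m s ^ (m - 1), 0] := by
      rw [Matrix.mul_fin_two]
      simp
    have key := gauge_transform (t := (t : ℂ)) (evMat l (fundSol t (gauged m x) ⟨s, hs⟩)) hg h0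
    have hI : Set.IccExtend zero_le_one (fundSol t (gauged m x)) s =
        fundSol t (gauged m x) ⟨s, hs⟩ := Set.IccExtend_of_mem _ _ hs
    beta_reduce
    rw [hI, potential, ← key]

/-- The loop returns to `0`, where the gauge is again trivial, so no correction factor appears. -/
theorem monodromy_eq_evMat (hm : 1 ≤ m) {t : ℝ} {x : Param ρ} (h : Small m t x) {l : ℂ}
    (hl : l ∈ annulus ρ) :
    monodromy m t x l = evMat l (1 + (t : ℂ) • endQuot t (gauged m x)) := by
  have h1 : (1 : ℝ) ∈ Set.Icc (0 : ℝ) 1 := ⟨zero_le_one, le_rfl⟩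
  rw [monodromy_eq m (isSolutionAlongLoop m hm h hl), Set.IccExtend_of_mem _ _ h1,
    one_add_smul_endQuot h.1, loop_one, zero_pow (by omega), mul_zero, ← Matrix.one_fin_two, mul_one]

theorem hasSum_matrixLog {X : LoopMat ρ} (hX : ‖X‖ < 1) {l : ℂ} (hl : l ∈ annulus ρ) :
    HasSum (fun k : ℕ => ((-1 : ℂ) ^ k / (k + 1)) • (evMat l (1 + X) - 1) ^ (k + 1))
      (evMat l (X * logQuot X)) := by
  have h := ((hasSum_logQuot hX).mul_left X).mapL (evMat l)
  have e : (fun k : ℕ => ((-1 : ℂ) ^ k / (k + 1)) • (evMat l (1 + X) - 1) ^ (k + 1)) =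
      fun k => evMat l (X * (logCoeff k • X ^ k)) := by
    funext k
    rw [map_add, evMat_one hl, add_sub_cancel_left, mul_smul_comm, ← pow_succ', map_smul,
      evMat_pow hl]
    rfl
  rw [e]
  exact h

/-- The logarithmic monodromy as a matrix of Laurent series. -/
def logMat (t : ℝ) (x : Param ρ) : LoopMat ρ := logEnd t (gauged m x)

theorem eventually_small_time (x : Param ρ) : ∀ᶠ t in 𝓝 (0 : ℝ), Small m t x := by
  have h := eventually_small (gauged m x)
  have hc : Filter.Tendsto (fun t : ℝ => ((t : ℂ), gauged m x)) (𝓝 0) (𝓝 (0, gauged m x)) := by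
    have : Continuous fun t : ℝ => ((t : ℂ), gauged m x) :=
      Complex.continuous_ofReal.prodMk continuous_const
    have h2 := this.tendsto 0
    rwa [Complex.ofReal_zero] at h2
  exact hc.eventually h

theorem tendsto_gauged (x : Param ρ) : Filter.Tendsto
    (fun p : ℝ × Param ρ => ((p.1 : ℂ), gauged m p.2)) (𝓝 (0, x)) (𝓝 (0, gauged m x)) := by
  have : Continuous fun p : ℝ × Param ρ => ((p.1 : ℂ), gauged m p.2) :=
    (Complex.continuous_ofReal.comp continuous_fst).prodMk
      ((contDiff_gauged m).continuous.comp continuous_snd)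
  have h2 := this.tendsto (0, x)
  rwa [Complex.ofReal_zero] at h2

theorem eventually_small_prod (x : Param ρ) :
    ∀ᶠ p : ℝ × Param ρ in 𝓝 (0, x), Small m p.1 p.2 :=
  (tendsto_gauged m x).eventually (eventually_small (gauged m x))

theorem contDiffAt_logMat (x : Param ρ) :
    ContDiffAt ℝ ω (fun p : ℝ × Param ρ => logMat m p.1 p.2) (0, x) := by
  have h1 : ContDiff ℝ ω (fun p : ℝ × Param ρ => ((p.1 : ℂ), gauged m p.2)) :=
    (Complex.ofRealCLM.contDiff.comp contDiff_fst).prodMk ((contDiff_gauged m).comp contDiff_snd)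
  have h2 := (contDiffAt_logEnd (gauged m x)).restrict_scalars ℝ
  have h3 : ((((0, x) : ℝ × Param ρ).1 : ℂ), gauged m ((0, x) : ℝ × Param ρ).2) =
      (0, gauged m x) := by simp
  rw [← h3] at h2
  exact h2.comp (0, x) h1.contDiffAt

/-- Links the pointwise definition, including its separate value at `t = 0`, to a single analytic
object. At `t = 0` it uses that the derivative of `1 + t G(t)` is `G(0)`. -/
theorem logMonodromy_eq (hm : 1 ≤ m) {t : ℝ} {x : Param ρ} (h : Small m t x) {l : ℂ}
    (hl : l ∈ annulus ρ) : logMonodromy m t x l = evMat l (logMat m t x) := by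
  by_cases ht : t = 0
  · subst ht
    rw [logMonodromy, if_pos rfl]
    ext i j
    rw [Matrix.of_apply]
    let G : ℝ → LoopMat ρ := fun s => endQuot (s : ℂ) (gauged m x)
    have hG : DifferentiableAt ℝ G 0 := by
      have h2 := (contDiffAt_endQuot (gauged m x)).restrict_scalars ℝ
      have h1 : ContDiff ℝ ω (fun s : ℝ => ((s : ℂ), gauged m x)) :=
        Complex.ofRealCLM.contDiff.prodMk contDiff_const
      have h3 : (((0 : ℝ) : ℂ), gauged m x) = (0, gauged m x) := by simp
      rw [← h3] at h2
      exact (h2.comp (0 : ℝ) h1.contDiffAt).differentiableAt (by simp)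
    have hd : HasDerivAt (fun s : ℝ => (1 : LoopMat ρ) + (s : ℂ) • G s) (G 0) 0 := by
      have h1 : HasDerivAt (fun s : ℝ => (s : ℂ)) 1 0 := Complex.ofRealCLM.hasDerivAt
      have h2 := (h1.smul hG.hasDerivAt).const_add (1 : LoopMat ρ)
      refine h2.congr_deriv ?_
      rw [Complex.ofReal_zero, zero_smul, zero_add, one_smul]
    have hd2 := (((Laurent.ev l).comp (entryL i j)).restrictScalars ℝ).hasFDerivAt
        |>.comp_hasDerivAt (0 : ℝ) hd
    have he : (fun s : ℝ => monodromy m s x l i j) =ᶠ[𝓝 0]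
        (((Laurent.ev l).comp (entryL i j)).restrictScalars ℝ) ∘
          fun s : ℝ => (1 : LoopMat ρ) + (s : ℂ) • G s := by
      filter_upwards [eventually_small_time m x] with s hs
      rw [monodromy_eq_evMat m hm hs hl]
      rfl
    have hG0 : G 0 = logMat m 0 x := by
      simp only [G, logMat]
      rw [Complex.ofReal_zero, logEnd_zero, endQuot_zero]
    refine he.deriv_eq.trans (hd2.deriv.trans ?_)
    rw [hG0]
    rfl
  · have ht' : (t : ℂ) ≠ 0 := Complex.ofReal_ne_zero.mpr ht
    rw [logMonodromy, if_neg ht, monodromy_eq_evMat m hm h hl, matrixLog,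
      (hasSum_matrixLog (h.2.trans one_half_lt_one) hl).tsum_eq, smul_mul_assoc, map_smul,
      smul_smul, inv_mul_cancel₀ ht', one_smul]
    rfl

theorem logMat_zero (x : Param ρ) : logMat m 0 x = (2 * Real.pi * Complex.I) •
    (residueL m 0 x + (x.r : ℂ) • (nil * residueL m 0 x - residueL m 0 x * nil) -
      (x.r : ℂ) ^ 2 • (nil * residueL m 0 x * nil)) := by
  rw [logMat, Complex.ofReal_zero, logEnd_zero, prim_gauged]

end GaugedSolution

end

end DPW

/-! ### Reality of the logarithmic monodromy and its value at `t = 0`. -/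

namespace DPW

noncomputable section

variable {ρ : ℝ} [Fact (1 < ρ)]

open LoopMat

section Reality

attribute [local instance] Matrix.linftyOpNormedRing Matrix.linftyOpNormedAlgebra

theorem Laurent.norm_ev_le (l : ℂ) (v : Laurent ρ) : ‖Laurent.ev l v‖ ≤ ‖v‖ := by
  rw [Laurent.ev]
  split_ifs with h
  · have h1 := ContinuousLinearMap.le_of_opNorm_le _
      (Laurent.norm_lift_le (fun k => l ^ k) 1 (Laurent.norm_zpow_le h.1 h.2) zero_le_one) v
    rwa [one_mul] at h1
  · exact (norm_zero.le.trans (norm_nonneg v))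

theorem norm_evMat_le (l : ℂ) (X : LoopMat ρ) : ‖evMat l X‖ ≤ ‖X‖ := by
  have h : ‖X‖ = _ := Matrix.linfty_opNorm_def (α := Laurent ρ) X
  rw [h, Matrix.linfty_opNorm_def]
  refine NNReal.coe_le_coe.mpr (Finset.sup_mono_fun fun i _ => Finset.sum_le_sum fun j _ => ?_)
  exact Laurent.norm_ev_le l _

theorem norm_map_conj (X : Matrix (Fin 2) (Fin 2) ℂ) : ‖X.map (starRingEnd ℂ)‖ = ‖X‖ := by
  simp [Matrix.linfty_opNorm_def]

theorem hasSum_matrixLog_one_add {P : Matrix (Fin 2) (Fin 2) ℂ} (hP : ‖P‖ < 1) :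
    HasSum (fun k : ℕ => ((-1 : ℂ) ^ k / (k + 1)) • (1 + P - 1) ^ (k + 1)) (P * logQuot P) := by
  have h := (hasSum_logQuot hP).mul_left P
  have e : (fun k : ℕ => ((-1 : ℂ) ^ k / (k + 1)) • (1 + P - 1) ^ (k + 1)) =
      fun k => P * (logCoeff k • P ^ k) := by
    funext k
    rw [add_sub_cancel_left, mul_smul_comm, ← pow_succ']
    rfl
  rw [e]
  exact h

theorem matrixLog_map_conj {P : Matrix (Fin 2) (Fin 2) ℂ} (hP : ‖P‖ < 1) :
    matrixLog ((1 + P).map (starRingEnd ℂ)) = (matrixLog (1 + P)).map (starRingEnd ℂ) := by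
  have hc : Continuous ((starRingEnd ℂ).mapMatrix (m := Fin 2)) :=
    continuous_id.matrix_map Complex.continuous_conj
  have h := (hasSum_matrixLog_one_add hP).map (starRingEnd ℂ).mapMatrix hc
  have e : ((starRingEnd ℂ).mapMatrix (m := Fin 2)) ∘
      (fun k : ℕ => ((-1 : ℂ) ^ k / (k + 1)) • (1 + P - 1) ^ (k + 1)) =
      fun k : ℕ => ((-1 : ℂ) ^ k / (k + 1)) •
        ((1 + P).map (starRingEnd ℂ) - 1) ^ (k + 1) := by
    funext k
    have h1 : (1 + P).map (starRingEnd ℂ) = (starRingEnd ℂ).mapMatrix (1 + P) := rfl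
    have h2 : (1 + P).map (starRingEnd ℂ) - 1 = (starRingEnd ℂ).mapMatrix (1 + P - 1) := by
      rw [h1, map_sub, map_one]
    rw [h2, ← map_pow]
    ext i j
    simp
  rw [e] at h
  rw [matrixLog, h.tsum_eq, matrixLog, (hasSum_matrixLog_one_add hP).tsum_eq]
  rfl

theorem matrixLog_inv {P R : Matrix (Fin 2) (Fin 2) ℂ} (hP : ‖P‖ < 1) (hR : ‖R‖ < 1)
    (h : (1 + R) * (1 + P) = 1) : matrixLog (1 + R) = -matrixLog (1 + P) := by
  have hR' : ‖1 + R - 1‖ < 1 := by rwa [add_sub_cancel_left]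
  have h1 := mul_logQuot_inv hP hR' h (mul_eq_one_comm.mp h)
  rw [add_sub_cancel_left] at h1
  rw [matrixLog, matrixLog, (hasSum_matrixLog_one_add hR).tsum_eq,
    (hasSum_matrixLog_one_add hP).tsum_eq, h1]

/-- Take logarithms in `conj M(conj λ) * M(λ) = 1`: conjugation commutes with the series, and the
logarithm of the inverse is the negative. The norm bound holds at every point because evaluation is
a contraction. -/
theorem conj_logMat (m : ℕ) (hm : 1 ≤ m) {t : ℝ} (ht : t ≠ 0) {x : Param ρ} (h : Small m t x)
    {l : ℂ} (hl : l ∈ annulus ρ) :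
    (evMat (starRingEnd ℂ l) (logMat m t x)).map (starRingEnd ℂ) = -evMat l (logMat m t x) := by
  have hc := Laurent.conj_mem_annulus hl
  have hX : ‖(t : ℂ) • endQuot t (gauged m x)‖ < 1 := h.2.trans one_half_lt_one
  have hlt (u : ℂ) : ‖evMat u ((t : ℂ) • endQuot t (gauged m x))‖ < 1 :=
    (norm_evMat_le u _).trans_lt hX
  have hM {u : ℂ} (hu : u ∈ annulus ρ) :
      monodromy m t x u = 1 + evMat u ((t : ℂ) • endQuot t (gauged m x)) := by
    rw [monodromy_eq_evMat m hm h hu, map_add, evMat_one hu]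
  have hmul := conj_monodromy_mul m ⟨_, isSolutionAlongLoop m hm h hc⟩
    ⟨_, isSolutionAlongLoop m hm h hl⟩
  rw [hM hc, hM hl] at hmul
  have hmap : (1 + evMat (starRingEnd ℂ l) ((t : ℂ) • endQuot t (gauged m x))).map
      (starRingEnd ℂ) =
      1 + (evMat (starRingEnd ℂ l) ((t : ℂ) • endQuot t (gauged m x))).map (starRingEnd ℂ) := by
    have := map_add ((starRingEnd ℂ).mapMatrix (m := Fin 2)) 1
      (evMat (starRingEnd ℂ l) ((t : ℂ) • endQuot t (gauged m x)))
    rwa [map_one] at this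
  have hlog := matrixLog_inv (hlt l) ((norm_map_conj _).trans_lt (hlt (starRingEnd ℂ l)))
    (hmap ▸ hmul)
  rw [← hmap, matrixLog_map_conj (hlt _), ← hM hc, ← hM hl] at hlog
  rw [← logMonodromy_eq m hm h hc, ← logMonodromy_eq m hm h hl, logMonodromy, if_neg ht,
    logMonodromy, if_neg ht, ← smul_neg, ← hlog]
  ext i j
  simp

end Reality

theorem conj_two_pi_I_inv :
    starRingEnd ℂ (1 / (2 * Real.pi * Complex.I)) = -(1 / (2 * Real.pi * Complex.I)) := by
  rw [map_div₀, map_mul, map_mul, map_one, Complex.conj_ofReal, Complex.conj_I,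
    Complex.conj_ofNat, mul_neg, div_neg]

/-- The entry `i, j` of `M̃ / 2πi` as a Laurent series. -/
def logEntry (m : ℕ) (i j : Fin 2) (t : ℝ) (x : Param ρ) : Laurent ρ :=
  (1 / (2 * Real.pi * Complex.I)) • entryL i j (logMat m t x)

theorem ev_logEntry (m : ℕ) (hm : 1 ≤ m) {t : ℝ} {x : Param ρ} (h : Small m t x) {l : ℂ}
    (hl : l ∈ annulus ρ) (i j : Fin 2) : Laurent.ev l (logEntry m i j t x) =
      1 / (2 * Real.pi * Complex.I) * logMonodromy m t x l i j := by
  rw [logMonodromy_eq m hm h hl, logEntry, map_smul]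
  rfl

theorem logEntry_zero (m : ℕ) (x : Param ρ) (i j : Fin 2) : logEntry m i j 0 x =
    entryL i j (residueL m 0 x + (x.r : ℂ) • (nil * residueL m 0 x - residueL m 0 x * nil) -
      (x.r : ℂ) ^ 2 • (nil * residueL m 0 x * nil)) := by
  rw [logEntry, logMat_zero, map_smul, smul_smul, one_div,
    inv_mul_cancel₀ Complex.two_pi_I_ne_zero, one_smul]

theorem entryL_residueL_zero (m : ℕ) (x : Param ρ) :
    entryL 0 0 (residueL m 0 x) = W.toLaurent x.a ∧
    entryL 0 1 (residueL m 0 x) = Laurent.T (-1) * W.toLaurent x.b ∧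
    entryL 1 0 (residueL m 0 x) = Laurent.T 1 * W.toLaurent x.c ∧
    entryL 1 1 (residueL m 0 x) = -W.toLaurent x.a := by
  refine ⟨rfl, ?_, ?_, rfl⟩
  · change ((twist m ^ 0)⁻¹ * (-1 : ℂ) ^ 0) • (Laurent.T (-1) * W.toLaurent x.b) = _
    rw [pow_zero, pow_zero, inv_one, one_mul, one_smul]
  · change (twist m ^ 0 * (-1 : ℂ) ^ 0) • (Laurent.T 1 * W.toLaurent x.c) = _
    rw [pow_zero, pow_zero, one_mul, one_smul]

theorem entryL_nil : entryL 0 0 (nil : LoopMat ρ) = 0 ∧ entryL 0 1 (nil : LoopMat ρ) = 0 ∧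
    entryL 1 0 (nil : LoopMat ρ) = 1 ∧ entryL 1 1 (nil : LoopMat ρ) = 0 :=
  ⟨rfl, rfl, rfl, rfl⟩

theorem logEntry_zero_apply (m : ℕ) (x : Param ρ) :
    logEntry m 0 0 0 x = W.toLaurent x.a - x.r • (Laurent.T (-1) * W.toLaurent x.b) ∧
    logEntry m 0 1 0 x = Laurent.T (-1) * W.toLaurent x.b ∧
    logEntry m 1 0 0 x = Laurent.T 1 * W.toLaurent x.c + (2 * x.r) • W.toLaurent x.a -
      x.r ^ 2 • (Laurent.T (-1) * W.toLaurent x.b) := by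
  have hr (c : ℝ) (v : Laurent ρ) : (c : ℂ) • v = c • v := rfl
  have hr2 (v : Laurent ρ) : (x.r : ℂ) ^ 2 • v = x.r ^ 2 • v := by
    rw [← Complex.ofReal_pow, hr]
  obtain ⟨h1, h2, h3, h4⟩ := entryL_residueL_zero m x
  obtain ⟨n1, n2, n3, n4⟩ := entryL_nil (ρ := ρ)
  refine ⟨?_, ?_, ?_⟩ <;> rw [logEntry_zero] <;>
    simp only [map_add, map_sub, map_smul, entryL_mul, Fin.sum_univ_two, h1, h2, h3, h4, n1, n2,
      n3, n4, hr, hr2, zero_mul, mul_zero, one_mul, mul_one, add_zero, zero_add, zero_sub, smul_zero,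
      sub_zero, smul_neg] <;> module

theorem coeff_T_mul (d k : ℤ) (v : Laurent ρ) :
    Laurent.coeff k (Laurent.T d * v) = Laurent.coeff (k - d) v := by
  have : ((Laurent.coeffL k ∘L ContinuousLinearMap.mul ℂ (Laurent ρ) (Laurent.T d)) :
      Laurent ρ →L[ℂ] ℂ) = Laurent.coeffL (k - d) := by
    refine Laurent.clm_ext fun j => ?_
    rw [ContinuousLinearMap.comp_apply, ContinuousLinearMap.mul_apply', Laurent.T_mul_T,
      Laurent.coeffL_apply, Laurent.coeffL_apply, Laurent.coeff_T, Laurent.coeff_T]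
    exact if_congr (by omega) rfl rfl
  exact congrArg (fun f => f v) this

/-- For `t ≠ 0` the minus sign in `conj_logMat` cancels the one from conjugating `1/(2πi)`. At `t =
0` the explicit formula is used instead; it covers the three entries that occur in the equations. -/
theorem logEntry_im (m : ℕ) (hm : 1 ≤ m) {t : ℝ} {x : Param ρ} (h : Small m t x) (i j : Fin 2)
    (hij : ¬ (i = 1 ∧ j = 1)) (k : ℤ) : (Laurent.coeff k (logEntry m i j t x)).im = 0 := by
  by_cases ht : t = 0
  · subst ht
    obtain ⟨h1, h2, h3⟩ := logEntry_zero_apply m x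
    have hW (k : ℤ) (f : W ρ) : (Laurent.coeff k (W.toLaurent f)).im = 0 := by
      rw [W.coeff_toLaurent]
      split_ifs <;> simp
    fin_cases i <;> fin_cases j <;> simp only [Fin.mk_zero, Fin.mk_one, Fin.isValue]
    · rw [h1, Laurent.coeff_sub, Laurent.coeff_real_smul, coeff_T_mul]
      simp [hW]
    · rw [h2, coeff_T_mul, hW]
    · rw [h3, Laurent.coeff_sub, Laurent.coeff_add, Laurent.coeff_real_smul,
        Laurent.coeff_real_smul, coeff_T_mul, coeff_T_mul, Complex.sub_im, Complex.add_im,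
        Complex.im_ofReal_mul, Complex.im_ofReal_mul]
      simp [hW]
    · exact absurd ⟨rfl, rfl⟩ hij
  · refine Laurent.coeff_im_eq_zero (fun l hl => ?_) k
    have h1 := congrFun (congrFun (conj_logMat m hm ht h hl) i) j
    rw [Matrix.map_apply, Matrix.neg_apply, evMat_apply, evMat_apply] at h1
    rw [logEntry, (Laurent.ev _).map_smul, (Laurent.ev _).map_smul, smul_eq_mul, smul_eq_mul,
      map_mul, h1]
    rw [conj_two_pi_I_inv, neg_mul_neg]

theorem contDiffAt_logEntry (m : ℕ) (i j : Fin 2) (x : Param ρ) :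
    ContDiffAt ℝ ω (fun p : ℝ × Param ρ => logEntry m i j p.1 p.2) (0, x) := by
  have h : ContDiff ℝ ω (fun X : LoopMat ρ =>
      (1 / (2 * Real.pi * Complex.I)) • entryL i j X) :=
    ((1 / (2 * Real.pi * Complex.I)) • (entryL i j : LoopMat ρ →L[ℂ] Laurent ρ)).contDiff
      |>.restrict_scalars ℝ
  exact h.contDiffAt.comp (0, x) (contDiffAt_logMat m x)

end

end DPW

/-! ### The monodromy problem as equations between real Fourier coefficients. -/

namespace DPW

noncomputable section

variable {ρ : ℝ} [Fact (1 < ρ)]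

open LoopMat

theorem Laurent.ev_conj_of_im {v : Laurent ρ} (hv : ∀ k, (Laurent.coeff k v).im = 0) {l : ℂ}
    (hl : l ∈ annulus ρ) : starRingEnd ℂ (Laurent.ev (starRingEnd ℂ l) v) = Laurent.ev l v := by
  rw [Laurent.ev_conj hl]
  congr 1
  refine Laurent.ext fun k => ?_
  rw [two_mul, Laurent.coeff_sub, Laurent.coeff_add, Laurent.coeff_reL]
  refine Complex.ext ?_ ?_
  · simp
  · simp [hv]

/-- Coefficientwise the condition is `u_k = w_{-k}`, split into `k ≥ 0` and `k < 0`. Only real parts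
need comparing, as the imaginary parts vanish. -/
theorem Laurent.ev_sub_reflect_eq_zero_iff {u w : Laurent ρ} (hu : ∀ k, (Laurent.coeff k u).im = 0)
    (hw : ∀ k, (Laurent.coeff k w).im = 0) :
    (∀ l ∈ annulus ρ, Laurent.ev l (u - Laurent.reflect w) = 0) ↔
      W.posPart 0 u = W.negPart 0 w ∧ W.negPart 1 u = W.posPart 1 w := by
  constructor
  · intro h
    have hk (k : ℤ) : Laurent.coeff k u = Laurent.coeff (-k) w := by
      have := Laurent.coeff_eq_zero_of_ev h k
      rwa [Laurent.coeff_sub, Laurent.coeff_reflect, sub_eq_zero] at this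
    constructor
    · refine W.ext fun k => ?_
      rw [W.coeff_posPart, W.coeff_negPart, hk]
    · refine W.ext fun k => ?_
      rw [W.coeff_posPart, W.coeff_negPart, hk, neg_neg]
  · rintro ⟨h1, h2⟩ l hl
    have hk (k : ℤ) : Laurent.coeff k u = Laurent.coeff (-k) w := by
      refine Complex.ext ?_ ((hu k).trans (hw _).symm)
      obtain ⟨j, rfl | rfl⟩ := k.eq_nat_or_neg
      · have := congrArg (fun f => W.coeff f j) h1
        simpa [W.coeff_posPart, W.coeff_negPart] using this
      · rcases j with _ | j
        · have := congrArg (fun f => W.coeff f 0) h1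
          simpa [W.coeff_posPart, W.coeff_negPart] using this
        · have := congrArg (fun f => W.coeff f j) h2
          simp only [W.coeff_posPart, W.coeff_negPart] at this
          rw [neg_neg]
          exact_mod_cast this
    have h0 : u - Laurent.reflect w = 0 := by
      refine Laurent.ext fun k => ?_
      rw [Laurent.coeff_sub, Laurent.coeff_reflect, hk, sub_self, Laurent.coeff_zero]
    rw [h0, map_zero]

/-- The target space of the equations. -/
abbrev EqSpace (ρ : ℝ) [Fact (1 < ρ)] : Type := W ρ × W ρ × W ρ × ℝ × ℝ × ℝ

/-- The equations of the monodromy problem in Fourier coefficients. -/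
def loopEq (m : ℕ) (p : ℝ × Param ρ) : EqSpace ρ :=
  (W.posPart 1 (logEntry m 0 0 p.1 p.2) - W.negPart 1 (logEntry m 0 0 p.1 p.2),
    W.posPart 0 (logEntry m 1 0 p.1 p.2) - W.negPart 0 (logEntry m 0 1 p.1 p.2),
    W.negPart 1 (logEntry m 1 0 p.1 p.2) - W.posPart 1 (logEntry m 0 1 p.1 p.2),
    (Laurent.ev 1 (logEntry m 0 1 p.1 p.2)).re, (Laurent.ev (-1) (logEntry m 0 1 p.1 p.2)).re,
    calK p.2 - 1)

theorem contDiffAt_loopEq (m : ℕ) (x : Param ρ) : ContDiffAt ℝ ω (loopEq m) (0, x) := by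
  have hv (i j : Fin 2) := contDiffAt_logEntry m i j x
  have hL {F : Type _} [NormedAddCommGroup F] [NormedSpace ℝ F] (φ : Laurent ρ →L[ℝ] F)
      (i j : Fin 2) :
      ContDiffAt ℝ ω (fun p : ℝ × Param ρ => φ (logEntry m i j p.1 p.2)) (0, x) :=
    φ.contDiff.contDiffAt.comp _ (hv i j)
  have hc (k : ℕ) : ContDiff ℝ ω (fun f : W ρ => f.coeff k) := (W.coeffL k).contDiff
  have ha : ContDiff ℝ ω fun p : ℝ × Param ρ => p.2.a := contDiff_snd.snd.fst
  have hb : ContDiff ℝ ω fun p : ℝ × Param ρ => p.2.b := contDiff_snd.snd.snd.fst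
  have hcc : ContDiff ℝ ω fun p : ℝ × Param ρ => p.2.c := contDiff_snd.snd.snd.snd
  have hK : ContDiff ℝ ω fun p : ℝ × Param ρ => calK p.2 - 1 :=
    (((hc 0).comp ha).pow 2 |>.add (((hc 0).comp hb).mul ((hc 0).comp hcc))).sub contDiff_const
  exact ((hL _ _ _).sub (hL _ _ _)).prodMk <| ((hL _ _ _).sub (hL _ _ _)).prodMk <|
    ((hL _ _ _).sub (hL _ _ _)).prodMk <|
    (hL (Complex.reCLM ∘L (Laurent.ev 1).restrictScalars ℝ) 0 1).prodMk <|
    (hL (Complex.reCLM ∘L (Laurent.ev (-1)).restrictScalars ℝ) 0 1).prodMk hK.contDiffAt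

/-- For real coefficients the star acts as `λ ↦ 1/λ`; the sign comes from moving `1/(2πi)` through
the conjugation. -/
theorem starInv_logMonodromy (m : ℕ) (hm : 1 ≤ m) {t : ℝ} {x : Param ρ} (h : Small m t x)
    {i j : Fin 2} (hij : ¬ (i = 1 ∧ j = 1)) {l : ℂ} (hl : l ∈ annulus ρ) :
    1 / (2 * Real.pi * Complex.I) * starInv (fun u => logMonodromy m t x u i j) l =
      -Laurent.ev l (Laurent.reflect (logEntry m i j t x)) := by
  have hi := Laurent.inv_mem_annulus hl
  have e : 1 / starRingEnd ℂ l = starRingEnd ℂ l⁻¹ := by rw [map_inv₀, one_div]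
  rw [Laurent.ev_reflect hl, ← Laurent.ev_conj_of_im (logEntry_im m hm h i j hij) hi,
    ev_logEntry m hm h (Laurent.conj_mem_annulus hi), map_mul, conj_two_pi_I_inv, starInv, e,
    neg_mul, neg_neg]

theorem solves_iff_loopEq (m : ℕ) (hm : 1 ≤ m) {t : ℝ} {x : Param ρ} (h : Small m t x) :
    SolvesMonodromyProblem m t x ↔ loopEq m (t, x) = 0 := by
  have h00 : ¬ ((0 : Fin 2) = 1 ∧ (0 : Fin 2) = 1) := by simp
  have h01 : ¬ ((0 : Fin 2) = 1 ∧ (1 : Fin 2) = 1) := by simp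
  have h10 : ¬ ((1 : Fin 2) = 1 ∧ (0 : Fin 2) = 1) := by simp
  have hF {l : ℂ} (hl : l ∈ annulus ρ) : calF m t x l =
      Laurent.ev l (logEntry m 0 0 t x - Laurent.reflect (logEntry m 0 0 t x)) := by
    rw [calF, mul_add, starInv_logMonodromy m hm h h00 hl, ← ev_logEntry m hm h hl, map_sub,
      sub_eq_add_neg]
  have hG {l : ℂ} (hl : l ∈ annulus ρ) : calG m t x l =
      Laurent.ev l (logEntry m 1 0 t x - Laurent.reflect (logEntry m 0 1 t x)) := by
    rw [calG, mul_add, starInv_logMonodromy m hm h h01 hl, ← ev_logEntry m hm h hl, map_sub,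
      sub_eq_add_neg]
  have hu1 : (1 : ℂ) ∈ annulus ρ := Laurent.mem_annulus_of_norm_one (by simp)
  have hu2 : (-1 : ℂ) ∈ annulus ρ := Laurent.mem_annulus_of_norm_one (by simp)
  have hH {l : ℂ} (hl : l ∈ annulus ρ) (hc : starRingEnd ℂ l = l) :
      1 / (2 * Real.pi * Complex.I) * logMonodromy m t x l 0 1 = 0 ↔
        (Laurent.ev l (logEntry m 0 1 t x)).re = 0 := by
    -- At a real point a series with real coefficients has a real value, so the complex condition is
    -- one real equation.
    have him : (Laurent.ev l (logEntry m 0 1 t x)).im = 0 := by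
      have := Laurent.ev_conj_of_im (logEntry_im m hm h 0 1 h01) hl
      rw [hc] at this
      exact Complex.conj_eq_iff_im.mp this
    rw [← ev_logEntry m hm h hl, Complex.ext_iff, him]
    simp
  have hFF : (∀ l ∈ annulus ρ, calF m t x l = 0) ↔
      W.posPart 1 (logEntry m 0 0 t x) - W.negPart 1 (logEntry m 0 0 t x) = 0 := by
    -- The series `v - v(1/λ)` is antisymmetric: its constant term vanishes and its two halves are
    -- equivalent. Keeping only indices `k ≥ 1` removes this redundancy, without which the
    -- linearisation could not be onto.
    rw [sub_eq_zero, ← and_iff_right_of_imp (a := W.posPart 0 (logEntry m 0 0 t x) =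
      W.negPart 0 (logEntry m 0 0 t x)) (b := W.posPart 1 (logEntry m 0 0 t x) =
      W.negPart 1 (logEntry m 0 0 t x)), eq_comm (a := W.posPart 1 _),
      ← Laurent.ev_sub_reflect_eq_zero_iff (logEntry_im m hm h 0 0 h00)
        (logEntry_im m hm h 0 0 h00)]
    · exact forall₂_congr fun l hl => by rw [hF hl]
    · intro h1
      refine W.ext fun k => ?_
      rw [W.coeff_posPart, W.coeff_negPart]
      rcases k with _ | k
      · simp
      · have := congrArg (fun f => W.coeff f k) h1
        simp only [W.coeff_posPart, W.coeff_negPart] at this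
        push_cast at this ⊢
        rwa [add_zero]
  have hGG : (∀ l ∈ annulus ρ, calG m t x l = 0) ↔
      W.posPart 0 (logEntry m 1 0 t x) - W.negPart 0 (logEntry m 0 1 t x) = 0 ∧
      W.negPart 1 (logEntry m 1 0 t x) - W.posPart 1 (logEntry m 0 1 t x) = 0 := by
    rw [sub_eq_zero, sub_eq_zero, ← Laurent.ev_sub_reflect_eq_zero_iff (logEntry_im m hm h 1 0 h10)
      (logEntry_im m hm h 0 1 h01)]
    exact forall₂_congr fun l hl => by rw [hG hl]
  rw [SolvesMonodromyProblem, hFF, hGG, calH₁, calH₂, hH hu1 (by simp), hH hu2 (by simp), loopEq]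
  simp only [Prod.mk_eq_zero, sub_eq_zero (b := (1 : ℝ)), and_assoc]

/-! ### The equations at `t = 0` in coordinates. -/

section Linearisation

variable (m : ℕ)

theorem W.re_eval_quad (p₀ p₁ p₂ : ℝ) : ((W.quad p₀ p₁ p₂ : W ρ).eval 1).re = p₀ + p₁ + p₂ ∧
    ((W.quad p₀ p₁ p₂ : W ρ).eval (-1)).re = p₀ - p₁ + p₂ := by
  rw [W.eval_quad, W.eval_quad]
  constructor
  · simp
  · simp [sub_eq_add_neg]

/-- The real part of the value at `±1` as a functional. -/
def W.reEvalL (l : ℂ) : W ρ →L[ℝ] ℝ :=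
  Complex.reCLM ∘L (Laurent.ev l).restrictScalars ℝ ∘L W.toLaurent

theorem W.reEvalL_apply {l : ℂ} (hl : l ∈ annulus ρ) (f : W ρ) :
    W.reEvalL l f = (f.eval l).re := by
  rw [← W.ev_toLaurent hl]
  rfl

theorem W.coeff_sub (f g : W ρ) (k : ℕ) : (f - g).coeff k = f.coeff k - g.coeff k :=
  map_sub (W.coeffL k) f g

theorem loopEq_zero (x : Param ρ) :
    (loopEq m (0, x)).1.coeff 0 = x.a.coeff 1 - x.r * x.b.coeff 2 + x.r * x.b.coeff 0 ∧
    (∀ k, (loopEq m (0, x)).1.coeff (k + 1) = x.a.coeff (k + 2) - x.r * x.b.coeff (k + 3)) ∧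
    (loopEq m (0, x)).2.1.coeff 0 =
      2 * x.r * x.a.coeff 0 - x.r ^ 2 * x.b.coeff 1 - x.b.coeff 1 ∧
    (loopEq m (0, x)).2.1.coeff 1 =
      x.c.coeff 0 + 2 * x.r * x.a.coeff 1 - x.r ^ 2 * x.b.coeff 2 - x.b.coeff 0 ∧
    (∀ k, (loopEq m (0, x)).2.1.coeff (k + 2) =
      x.c.coeff (k + 1) + 2 * x.r * x.a.coeff (k + 2) - x.r ^ 2 * x.b.coeff (k + 3)) ∧
    (loopEq m (0, x)).2.2.1.coeff 0 = -(x.r ^ 2 * x.b.coeff 0) - x.b.coeff 2 ∧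
    (∀ k, (loopEq m (0, x)).2.2.1.coeff (k + 1) = -x.b.coeff (k + 3)) ∧
    (loopEq m (0, x)).2.2.2.1 = W.reEvalL 1 x.b ∧
    (loopEq m (0, x)).2.2.2.2.1 = -W.reEvalL (-1) x.b ∧
    (loopEq m (0, x)).2.2.2.2.2 = x.a.coeff 0 ^ 2 + x.b.coeff 0 * x.c.coeff 0 - 1 := by
  obtain ⟨h1, h2, h3⟩ := logEntry_zero_apply m x
  have hu1 : (1 : ℂ) ∈ annulus ρ := Laurent.mem_annulus_of_norm_one (by simp)
  have hu2 : (-1 : ℂ) ∈ annulus ρ := Laurent.mem_annulus_of_norm_one (by simp)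
  have hre (k : ℤ) (f : W ρ) : (Laurent.coeff k (W.toLaurent f)).re =
      if 0 ≤ k then f.coeff k.toNat else 0 := by
    rw [W.coeff_toLaurent]
    split_ifs <;> simp
  have v11 (k : ℤ) : (Laurent.coeff k (logEntry m 0 0 0 x)).re =
      (if 0 ≤ k then x.a.coeff k.toNat else 0) -
        x.r * (if 0 ≤ k + 1 then x.b.coeff (k + 1).toNat else 0) := by
    rw [h1, Laurent.coeff_sub, Laurent.coeff_real_smul, coeff_T_mul, Complex.sub_re,
      Complex.re_ofReal_mul, hre, hre, sub_neg_eq_add]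
  have v12 (k : ℤ) : (Laurent.coeff k (logEntry m 0 1 0 x)).re =
      (if 0 ≤ k + 1 then x.b.coeff (k + 1).toNat else 0) := by
    rw [h2, coeff_T_mul, hre, sub_neg_eq_add]
  have v21 (k : ℤ) : (Laurent.coeff k (logEntry m 1 0 0 x)).re =
      (if 0 ≤ k - 1 then x.c.coeff (k - 1).toNat else 0) +
        2 * x.r * (if 0 ≤ k then x.a.coeff k.toNat else 0) -
        x.r ^ 2 * (if 0 ≤ k + 1 then x.b.coeff (k + 1).toNat else 0) := by
    rw [h3, Laurent.coeff_sub, Laurent.coeff_add, Laurent.coeff_real_smul, Laurent.coeff_real_smul,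
      coeff_T_mul, coeff_T_mul, Complex.sub_re, Complex.add_re, Complex.re_ofReal_mul,
      Complex.re_ofReal_mul, hre, hre, hre, sub_neg_eq_add]
  have e1 : (loopEq m (0, x)).1 = W.posPart 1 (logEntry m 0 0 0 x) -
    W.negPart 1 (logEntry m 0 0 0 x) := rfl
  have e2 : (loopEq m (0, x)).2.1 = W.posPart 0 (logEntry m 1 0 0 x) -
    W.negPart 0 (logEntry m 0 1 0 x) := rfl
  have e3 : (loopEq m (0, x)).2.2.1 = W.negPart 1 (logEntry m 1 0 0 x) -
    W.posPart 1 (logEntry m 0 1 0 x) := rfl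
  refine ⟨?_, fun k => ?_, ?_, ?_, fun k => ?_, ?_, fun k => ?_, ?_, ?_, ?_⟩
  · rw [e1, W.coeff_sub, W.coeff_posPart, W.coeff_negPart, v11, v11]
    norm_num
    exact Or.inl rfl
  · rw [e1, W.coeff_sub, W.coeff_posPart, W.coeff_negPart, v11, v11,
      if_pos (by omega), if_pos (by omega), if_neg (by omega), if_neg (by omega)]
    rw [show (((k + 1 : ℕ) : ℤ) + (1 : ℕ)).toNat = k + 2 by omega,
      show (((k + 1 : ℕ) : ℤ) + (1 : ℕ) + 1).toNat = k + 3 by omega]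
    ring
  · rw [e2, W.coeff_sub, W.coeff_posPart, W.coeff_negPart, v21, v12]
    norm_num
  · rw [e2, W.coeff_sub, W.coeff_posPart, W.coeff_negPart, v21, v12]
    norm_num
    exact Or.inl rfl
  · rw [e2, W.coeff_sub, W.coeff_posPart, W.coeff_negPart, v21, v12,
      if_pos (by omega), if_pos (by omega), if_pos (by omega), if_neg (by omega)]
    rw [show (((k + 2 : ℕ) : ℤ) + (0 : ℕ) - 1).toNat = k + 1 by omega,
      show (((k + 2 : ℕ) : ℤ) + (0 : ℕ)).toNat = k + 2 by omega,
      show (((k + 2 : ℕ) : ℤ) + (0 : ℕ) + 1).toNat = k + 3 by omega]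
    ring
  · rw [e3, W.coeff_sub, W.coeff_posPart, W.coeff_negPart, v21, v12]
    norm_num
    rfl
  · rw [e3, W.coeff_sub, W.coeff_posPart, W.coeff_negPart, v21, v12,
      if_neg (by omega), if_neg (by omega), if_neg (by omega), if_pos (by omega)]
    rw [show (((k + 1 : ℕ) : ℤ) + (1 : ℕ) + 1).toNat = k + 3 by omega]
    ring
  · change (Laurent.ev 1 (logEntry m 0 1 0 x)).re = _
    rw [h2, Laurent.ev_mul hu1, Laurent.ev_T hu1, one_zpow, one_mul]
    rfl
  · change (Laurent.ev (-1) (logEntry m 0 1 0 x)).re = _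
    rw [h2, Laurent.ev_mul hu2, Laurent.ev_T hu2, zpow_neg_one, inv_neg, inv_one, neg_one_mul,
      Complex.neg_re]
    rfl
  · rfl

theorem coeff_central : (Param.central ρ).r = 1 ∧ (Param.central ρ).a = W.quad 0 1 0 ∧
    (Param.central ρ).b = W.quad (-1 / 2) 0 (1 / 2) ∧ (Param.central ρ).c = W.quad (-2) 0 0 := by
  refine ⟨rfl, ?_, ?_, ?_⟩
  · simp [Param.central, Param.a, W.quad]
  · refine W.ext fun k => ?_
    change (Polynomial.C (1 / 2) * (Polynomial.X ^ 2 - 1) : Polynomial ℝ).coeff k = _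
    rcases k with _ | _ | _ | k
    · rw [W.coeff_quad_zero]
      simp
      norm_num
    · rw [W.coeff_quad_one]
      simp [Polynomial.coeff_X_pow, Polynomial.coeff_one]
    · rw [W.coeff_quad_two]
      simp [Polynomial.coeff_one]
    · rw [W.coeff_quad_add_three]
      simp [Polynomial.coeff_X_pow, Polynomial.coeff_one]
  · simp [Param.central, Param.c, W.quad]

end Linearisation

end

end DPW

/-! ### Invertibility of the linearisation at the central value. -/

namespace DPW

noncomputable section

variable {ρ : ℝ} [Fact (1 < ρ)]

section Bijectivity

variable (m : ℕ)

/-- The linearisation of the equations in the parameters at the central value at time `0`. -/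
def linEq (m : ℕ) : Param ρ →L[ℝ] EqSpace ρ :=
  fderiv ℝ (loopEq m) (0, Param.central ρ) ∘L .inr ℝ ℝ (Param ρ)

theorem hasDerivAt_add_mul (c d : ℝ) : HasDerivAt (fun s : ℝ => c + s * d) d 0 := by
  simpa using ((hasDerivAt_id (0 : ℝ)).mul_const d).const_add c

/-- Components of the derivative are read off along the lines `𝐱₀ + s h` at `t = 0`, where
`loopEq_zero` gives explicit polynomials in `s`. -/
theorem apply_linEq {h : Param ρ} (φ : EqSpace ρ →L[ℝ] ℝ) {g : ℝ → ℝ} {d : ℝ}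
    (hg : ∀ s : ℝ, φ (loopEq m (0, Param.central ρ + s • h)) = g s) (hd : HasDerivAt g d 0) :
    φ (linEq m h) = d := by
  have hp : HasDerivAt (fun s : ℝ => ((0 : ℝ), Param.central ρ + s • h)) ((0 : ℝ), h) 0 := by
    refine (hasDerivAt_const _ _).prodMk ?_
    simpa using ((hasDerivAt_id (0 : ℝ)).smul_const h).const_add (Param.central ρ)
  have h0 : ((0 : ℝ), Param.central ρ + (0 : ℝ) • h) = (0, Param.central ρ) := by
    rw [zero_smul, add_zero]
  have hf : HasFDerivAt (loopEq m) (fderiv ℝ (loopEq m) (0, Param.central ρ))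
      ((0 : ℝ), Param.central ρ + (0 : ℝ) • h) := by
    rw [h0]
    exact ((contDiffAt_loopEq m (Param.central ρ)).differentiableAt (by simp)).hasFDerivAt
  have h1 := φ.hasFDerivAt.comp_hasDerivAt (0 : ℝ) (hf.comp_hasDerivAt (0 : ℝ) hp)
  have h2 : HasDerivAt g (φ (linEq m h)) 0 := by
    have e : g = φ ∘ (loopEq m ∘ fun s : ℝ => ((0 : ℝ), Param.central ρ + s • h)) := by
      funext s
      exact (hg s).symm
    rw [e]
    exact h1
  exact h2.unique hd

theorem W.coeff_quad_add_two (p₀ p₁ : ℝ) (k : ℕ) :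
    (W.quad p₀ p₁ 0 : W ρ).coeff (k + 2) = 0 := by
  rcases k with _ | k
  · rw [W.coeff_quad_two]
  · rw [W.coeff_quad_add_three]

theorem linEq_apply (h : Param ρ) :
    (linEq m h).1.coeff 0 = h.a.coeff 1 - h.b.coeff 2 + h.b.coeff 0 - h.r ∧
    (∀ k, (linEq m h).1.coeff (k + 1) = h.a.coeff (k + 2) - h.b.coeff (k + 3)) ∧
    (linEq m h).2.1.coeff 0 = 2 * h.a.coeff 0 - 2 * h.b.coeff 1 ∧
    (linEq m h).2.1.coeff 1 =
      h.r + 2 * h.a.coeff 1 + h.c.coeff 0 - h.b.coeff 2 - h.b.coeff 0 ∧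
    (∀ k, (linEq m h).2.1.coeff (k + 2) =
      h.c.coeff (k + 1) + 2 * h.a.coeff (k + 2) - h.b.coeff (k + 3)) ∧
    (linEq m h).2.2.1.coeff 0 = h.r - h.b.coeff 0 - h.b.coeff 2 ∧
    (∀ k, (linEq m h).2.2.1.coeff (k + 1) = -h.b.coeff (k + 3)) ∧
    (linEq m h).2.2.2.1 = W.reEvalL 1 h.b ∧
    (linEq m h).2.2.2.2.1 = -W.reEvalL (-1) h.b ∧
    (linEq m h).2.2.2.2.2 = -2 * h.b.coeff 0 - h.c.coeff 0 / 2 := by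
  let x : ℝ → Param ρ := fun s => Param.central ρ + s • h
  have hr : HasDerivAt (fun s => (x s).r) h.r 0 := hasDerivAt_add_mul _ _
  have ha (k : ℕ) : HasDerivAt (fun s => (x s).a.coeff k) (h.a.coeff k) 0 := hasDerivAt_add_mul _ _
  have hb (k : ℕ) : HasDerivAt (fun s => (x s).b.coeff k) (h.b.coeff k) 0 := hasDerivAt_add_mul _ _
  have hc (k : ℕ) : HasDerivAt (fun s => (x s).c.coeff k) (h.c.coeff k) 0 := hasDerivAt_add_mul _ _
  have hx0 : x 0 = Param.central ρ := by simp [x]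
  obtain ⟨cr, ca, cb, cc⟩ := coeff_central (ρ := ρ)
  let π₁ : EqSpace ρ →L[ℝ] W ρ := .fst ℝ _ _
  let q₁ : EqSpace ρ →L[ℝ] W ρ × W ρ × ℝ × ℝ × ℝ := .snd ℝ _ _
  let q₂ : EqSpace ρ →L[ℝ] W ρ × ℝ × ℝ × ℝ := .snd ℝ _ _ ∘L q₁
  let q₃ : EqSpace ρ →L[ℝ] ℝ × ℝ × ℝ := .snd ℝ _ _ ∘L q₂
  let q₄ : EqSpace ρ →L[ℝ] ℝ × ℝ := .snd ℝ _ _ ∘L q₃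
  refine ⟨?_, fun k => ?_, ?_, ?_, fun k => ?_, ?_, fun k => ?_, ?_, ?_, ?_⟩
  · refine apply_linEq m (W.coeffL 0 ∘L π₁) (fun s => (loopEq_zero m (x s)).1)
      ((((ha 1).sub (hr.mul (hb 2))).add (hr.mul (hb 0))).congr_deriv ?_)
    rw [hx0, cr, cb, W.coeff_quad_two, W.coeff_quad_zero]
    ring
  · refine apply_linEq m (W.coeffL (k + 1) ∘L π₁) (fun s => (loopEq_zero m (x s)).2.1 k)
      (((ha (k + 2)).sub (hr.mul (hb (k + 3)))).congr_deriv ?_)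
    rw [hx0, cr, cb, W.coeff_quad_add_three]
    ring
  · refine apply_linEq m (W.coeffL 0 ∘L .fst ℝ _ _ ∘L q₁) (fun s => (loopEq_zero m (x s)).2.2.1)
      (((((hr.const_mul 2).mul (ha 0)).sub ((hr.pow 2).mul (hb 1))).sub (hb 1)).congr_deriv ?_)
    simp only [Pi.pow_apply]
    rw [hx0, cr, ca, cb, W.coeff_quad_zero, W.coeff_quad_one]
    norm_num
    ring
  · refine apply_linEq m (W.coeffL 1 ∘L .fst ℝ _ _ ∘L q₁)
      (fun s => (loopEq_zero m (x s)).2.2.2.1)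
      (((((hc 0).add ((hr.const_mul 2).mul (ha 1))).sub
        ((hr.pow 2).mul (hb 2))).sub (hb 0)).congr_deriv ?_)
    simp only [Pi.pow_apply]
    rw [hx0, cr, ca, cb, W.coeff_quad_one, W.coeff_quad_two]
    norm_num
    ring
  · refine apply_linEq m (W.coeffL (k + 2) ∘L .fst ℝ _ _ ∘L q₁)
      (fun s => (loopEq_zero m (x s)).2.2.2.2.1 k)
      ((((hc (k + 1)).add ((hr.const_mul 2).mul (ha (k + 2)))).sub
        ((hr.pow 2).mul (hb (k + 3)))).congr_deriv ?_)
    simp only [Pi.pow_apply]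
    rw [hx0, cr, ca, cb, W.coeff_quad_add_two, W.coeff_quad_add_three]
    ring
  · refine apply_linEq m (W.coeffL 0 ∘L .fst ℝ _ _ ∘L q₂)
      (fun s => (loopEq_zero m (x s)).2.2.2.2.2.1)
      ((((hr.pow 2).mul (hb 0)).neg.sub (hb 2)).congr_deriv ?_)
    simp only [Pi.pow_apply]
    rw [hx0, cr, cb, W.coeff_quad_zero]
    norm_num
    ring
  · exact apply_linEq m (W.coeffL (k + 1) ∘L .fst ℝ _ _ ∘L q₂)
      (fun s => (loopEq_zero m (x s)).2.2.2.2.2.2.1 k) (hb (k + 3)).neg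
  · refine apply_linEq m (.fst ℝ _ _ ∘L q₃)
      (fun s => ((loopEq_zero m (x s)).2.2.2.2.2.2.2.1).trans (?_ : _ =
        W.reEvalL 1 (Param.central ρ).b + s * W.reEvalL 1 h.b)) (hasDerivAt_add_mul _ _)
    have : (x s).b = (Param.central ρ).b + s • h.b := rfl
    rw [this, map_add, map_smul, smul_eq_mul]
  · refine apply_linEq m (.fst ℝ _ _ ∘L q₄)
      (fun s => ((loopEq_zero m (x s)).2.2.2.2.2.2.2.2.1).trans (?_ : _ =
        -W.reEvalL (-1) (Param.central ρ).b + s * -W.reEvalL (-1) h.b)) (hasDerivAt_add_mul _ _)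
    have : (x s).b = (Param.central ρ).b + s • h.b := rfl
    rw [this, map_add, map_smul, smul_eq_mul]
    ring
  · refine apply_linEq m (.snd ℝ _ _ ∘L q₄)
      (fun s => (loopEq_zero m (x s)).2.2.2.2.2.2.2.2.2)
      (((((ha 0).pow 2).add ((hb 0).mul (hc 0))).sub_const 1).congr_deriv ?_)
    rw [hx0, ca, cb, cc, W.coeff_quad_zero, W.coeff_quad_zero, W.coeff_quad_zero]
    norm_num
    ring

theorem W.reEvalL_quad (p₀ p₁ p₂ : ℝ) :
    W.reEvalL 1 (W.quad p₀ p₁ p₂ : W ρ) = p₀ + p₁ + p₂ ∧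
    W.reEvalL (-1) (W.quad p₀ p₁ p₂ : W ρ) = p₀ - p₁ + p₂ := by
  rw [W.reEvalL_apply (Laurent.mem_annulus_of_norm_one (by simp)),
    W.reEvalL_apply (Laurent.mem_annulus_of_norm_one (by simp))]
  exact W.re_eval_quad p₀ p₁ p₂

theorem W.eq_zero_of_coeff {f : W ρ} (h₀ : f.coeff 0 = 0) (h₁ : f.coeff 1 = 0)
    (h : ∀ k, f.coeff (k + 2) = 0) : f = 0 := by
  refine W.ext fun k => ?_
  rw [W.coeff_zero]
  rcases k with _ | _ | k
  · exact h₀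
  · exact h₁
  · exact h k

/-- The equations force `b_{k+3} = 0`, so `b` is quadratic and its values at `±1` are finite sums.
The high coefficients of `a` and `c` then vanish, and a small linear system is left. -/
theorem linEq_injective : Function.Injective (linEq m : Param ρ → EqSpace ρ) := by
  refine (injective_iff_map_eq_zero _).mpr fun h hh => ?_
  obtain ⟨f0, f, g0, g1, g, n0, n, e1, e2, k⟩ := linEq_apply m h
  rw [hh] at f0 f g0 g1 g n0 n e1 e2 k
  simp only [Prod.fst_zero, Prod.snd_zero, W.coeff_zero] at f0 f g0 g1 g n0 n e1 e2 k
  have hb : h.b = W.quad (h.b.coeff 0) (h.b.coeff 1) (h.b.coeff 2) := by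
    refine W.ext fun j => ?_
    rcases j with _ | _ | _ | j
    · rw [W.coeff_quad_zero]
    · rw [W.coeff_quad_one]
    · rw [W.coeff_quad_two]
    · rw [W.coeff_quad_add_three]
      linarith [n j]
  rw [hb, (W.reEvalL_quad _ _ _).1] at e1
  rw [hb, (W.reEvalL_quad _ _ _).2] at e2
  refine Prod.ext (?_ : h.r = 0) (Prod.ext (?_ : h.a = 0) (Prod.ext (?_ : h.b = 0) (?_ : h.c = 0)))
  · linarith
  · refine W.eq_zero_of_coeff ?_ ?_ fun j => ?_
    · linarith
    · linarith
    · linarith [f j, n j]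
  · refine W.eq_zero_of_coeff ?_ ?_ fun j => ?_
    · linarith
    · linarith
    · rcases j with _ | j
      · linarith
      · linarith [n j]
  · refine W.eq_zero_of_coeff ?_ ?_ fun j => ?_
    · linarith
    · linarith [g 0, f 0, n 0]
    · linarith [g (j + 1), f (j + 1), n (j + 1)]

/-- Back substitution. The high coefficients are prescribed by `b_{k+3} = -n_{k+1}`, `a_{k+2} =
f_{k+1} - n_{k+1}`, `c_{k+1} = g_{k+2} - 2 f_{k+1} + n_{k+1}`, and the low ones solve a finite
system. -/
theorem linEq_surjective : Function.Surjective (linEq m : Param ρ → EqSpace ρ) := by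
  rintro ⟨f, g, n, h₁, h₂, κ⟩
  let N : W ρ := W.tail 1 n
  let S : W ρ := W.shiftUp 3 N
  -- The values of `β` at `1` and `-1`, after moving the tail `S` across, determine `σ = b_0 + b_2`
  -- and `p₁ = b_1`.
  let σ : ℝ := (h₁ + W.reEvalL 1 S - h₂ + W.reEvalL (-1) S) / 2
  let p₁ : ℝ := (h₁ + W.reEvalL 1 S + h₂ - W.reEvalL (-1) S) / 2
  -- The equation for `n_0` reads `r - (b_0 + b_2) = n_0`.
  let δ : ℝ := n.coeff 0 + σ
  -- Substituting `a_1 = f_0 + σ - 2 p₀ + δ` and `c_0 = -2 κ - 4 p₀` in the equation for `g_1`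
  -- leaves an equation for `p₀` with coefficient `8`.
  let p₀ : ℝ := (3 * δ + 2 * f.coeff 0 + σ - 2 * κ - g.coeff 1) / 8
  let β : W ρ := W.quad p₀ p₁ (σ - p₀) - S
  let α : W ρ := W.quad (g.coeff 0 / 2 + p₁) (f.coeff 0 + σ - 2 * p₀ + δ) 0 +
    W.shiftUp 2 (W.tail 1 f - N)
  let γ : W ρ := W.quad (-2 * κ - 4 * p₀) 0 0 +
    W.shiftUp 1 (W.tail 2 g - (2 : ℝ) • W.tail 1 f + N)
  have b0 : β.coeff 0 = p₀ := by
    simp only [β, S, W.coeff_sub, W.coeff_quad_zero, W.coeff_shiftUp]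
    norm_num
  have b1 : β.coeff 1 = p₁ := by
    simp only [β, S, W.coeff_sub, W.coeff_quad_one, W.coeff_shiftUp]
    norm_num
  have b2 : β.coeff 2 = σ - p₀ := by
    simp only [β, S, W.coeff_sub, W.coeff_quad_two, W.coeff_shiftUp]
    norm_num
  have b3 (k : ℕ) : β.coeff (k + 3) = -n.coeff (k + 1) := by
    simp only [β, S, N, W.coeff_sub, W.coeff_quad_add_three, W.coeff_shiftUp]
    rw [if_pos (by omega), Nat.add_sub_cancel, W.coeff_tail, zero_sub]
  have a0 : α.coeff 0 = g.coeff 0 / 2 + p₁ := by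
    simp only [α, W.coeff_add, W.coeff_quad_zero, W.coeff_shiftUp]
    norm_num
  have a1 : α.coeff 1 = f.coeff 0 + σ - 2 * p₀ + δ := by
    simp only [α, W.coeff_add, W.coeff_quad_one, W.coeff_shiftUp]
    norm_num
  have a2 (k : ℕ) : α.coeff (k + 2) = f.coeff (k + 1) - n.coeff (k + 1) := by
    simp only [α, N, W.coeff_add, W.coeff_quad_add_two, W.coeff_shiftUp]
    rw [if_pos (by omega), Nat.add_sub_cancel, W.coeff_sub, W.coeff_tail, W.coeff_tail, zero_add]
  have c0 : γ.coeff 0 = -2 * κ - 4 * p₀ := by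
    simp only [γ, W.coeff_add, W.coeff_quad_zero, W.coeff_shiftUp]
    norm_num
  have c1 (k : ℕ) : γ.coeff (k + 1) = g.coeff (k + 2) - 2 * f.coeff (k + 1) + n.coeff (k + 1) := by
    have : (W.quad (-2 * κ - 4 * p₀) 0 0 : W ρ).coeff (k + 1) = 0 := by
      rcases k with _ | k
      · rw [W.coeff_quad_one]
      · rw [W.coeff_quad_add_two]
    simp only [γ, N, W.coeff_add, this, W.coeff_shiftUp]
    rw [if_pos (by omega), Nat.add_sub_cancel, W.coeff_sub, W.coeff_smul, W.coeff_tail,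
      W.coeff_tail, W.coeff_tail, zero_add]
  have r1 : W.reEvalL 1 β = h₁ := by
    simp only [β, map_sub, (W.reEvalL_quad _ _ _).1, p₁, σ]
    ring
  have r2 : W.reEvalL (-1) β = -h₂ := by
    simp only [β, map_sub, (W.reEvalL_quad _ _ _).2, p₁, σ]
    ring
  let h : Param ρ := (δ, α, β, γ)
  have er : h.r = δ := rfl
  have ea : h.a = α := rfl
  have eb : h.b = β := rfl
  have ec : h.c = γ := rfl
  obtain ⟨f0, fk, g0, g1, gk, n0, nk, e1, e2, k⟩ := linEq_apply m h
  rw [er, ea, eb] at f0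
  simp only [ea, eb, ec, er, a0, a1, a2, b0, b1, b2, b3, c0, c1, r1, r2]
    at f0 fk g0 g1 gk n0 nk e1 e2 k
  refine ⟨h, Prod.ext (W.ext fun j => ?_) (Prod.ext (W.ext fun j => ?_)
    (Prod.ext (W.ext fun j => ?_) (Prod.ext ?_ (Prod.ext ?_ ?_))))⟩
  · rcases j with _ | j
    · rw [f0]
      ring
    · rw [fk]
      ring
  · rcases j with _ | _ | j
    · rw [g0]
      ring
    · rw [g1]
      simp only [p₀]
      ring
    · rw [gk]
      ring
  · rcases j with _ | j
    · rw [n0]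
      simp only [δ]
      ring
    · rw [nk]
      ring
  · exact e1
  · rw [e2, neg_neg]
  · rw [k]
    ring

theorem linEq_isInvertible : (linEq m : Param ρ →L[ℝ] EqSpace ρ).IsInvertible :=
  ⟨ContinuousLinearEquiv.ofBijective (linEq m) (LinearMap.ker_eq_bot.mpr (linEq_injective m))
    (LinearMap.range_eq_top.mpr (linEq_surjective m)),
    ContinuousLinearEquiv.coe_ofBijective _ _ _⟩

end Bijectivity

end

end DPW

/-! ### The implicit function theorem and the parity of solution families. -/

namespace DPW

noncomputable section

variable {ρ : ℝ} [Fact (1 < ρ)]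

section Family

variable (m : ℕ)

theorem loopEq_central : loopEq m (0, Param.central ρ) = 0 := by
  obtain ⟨cr, ca, cb, cc⟩ := coeff_central (ρ := ρ)
  obtain ⟨f0, fk, g0, g1, gk, n0, nk, e1, e2, k⟩ := loopEq_zero m (Param.central ρ)
  rw [cb, (W.reEvalL_quad _ _ _).1] at e1
  rw [cb, (W.reEvalL_quad _ _ _).2] at e2
  have c1 (j : ℕ) : (W.quad (-2) 0 0 : W ρ).coeff (j + 1) = 0 := by
    rcases j with _ | j
    · rw [W.coeff_quad_one]
    · rw [W.coeff_quad_add_two]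
  simp only [cr, ca, cb, cc, W.coeff_quad_zero, W.coeff_quad_one, W.coeff_quad_two,
    W.coeff_quad_add_two, W.coeff_quad_add_three, c1] at f0 fk g0 g1 gk n0 nk k
  refine Prod.ext (W.ext fun j => ?_) (Prod.ext (W.ext fun j => ?_)
    (Prod.ext (W.ext fun j => ?_) (Prod.ext (e1.trans ?_) (Prod.ext (e2.trans ?_) (k.trans ?_)))))
  · rcases j with _ | j
    · rw [f0, Prod.fst_zero, W.coeff_zero]
      norm_num
    · rw [fk, Prod.fst_zero, W.coeff_zero]
      norm_num
  · rw [Prod.snd_zero, Prod.fst_zero, W.coeff_zero]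
    rcases j with _ | _ | j
    · rw [g0]
      norm_num
    · rw [g1]
      norm_num
    · rw [gk]
      norm_num
  · rw [Prod.snd_zero, Prod.snd_zero, Prod.fst_zero, W.coeff_zero]
    rcases j with _ | j
    · rw [n0]
      norm_num
    · rw [nk]
      norm_num
  · norm_num
  · norm_num
  · norm_num

/-- The equivalence holds for all pairs `(t, 𝐱)` near `(0, 𝐱₀)`; this is the uniqueness used both
for the family and for its parity. -/
theorem exists_implicit_family (hm : 1 ≤ m) : ∃ φ : ℝ → Param ρ, φ 0 = Param.central ρ ∧
    ContDiffAt ℝ ω φ 0 ∧ ∀ᶠ v : ℝ × Param ρ in 𝓝 (0, Param.central ρ),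
      (SolvesMonodromyProblem m v.1 v.2 ↔ φ v.1 = v.2) := by
  have hc := contDiffAt_loopEq m (Param.central ρ)
  have h0 : (ω : WithTop ℕ∞) ≠ 0 := by simp
  have hi : (fderiv ℝ (loopEq m) (0, Param.central ρ) ∘L .inr ℝ ℝ (Param ρ)).IsInvertible :=
    linEq_isInvertible m
  refine ⟨hc.implicitFunction h0 hi, hc.implicitFunction_apply_self h0 hi,
    hc.contDiffAt_implicitFunction h0 hi, ?_⟩
  filter_upwards [hc.eventually_apply_eq_iff_implicitFunction h0 hi,
    eventually_small_prod m (Param.central ρ)] with v h1 h2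
  rw [solves_iff_loopEq m hm h2, ← h1, loopEq_central]

theorem exists_unique_solutionFamily (hm : 1 ≤ m) :
    ∃ ε > 0, ∃ U ∈ 𝓝 (Param.central ρ), ∃ x : ℝ → Param ρ,
      IsSolutionFamily m x ∧ ContDiffOn ℝ ∞ x (Set.Ioo (-ε) ε) ∧
      ∀ t ∈ Set.Ioo (-ε) ε, ∀ y : Param ρ,
        (y ∈ U ∧ SolvesMonodromyProblem m t y) ↔ y = x t := by
  obtain ⟨φ, hφ0, hφ, h⟩ := exists_implicit_family (ρ := ρ) m hm
  rw [nhds_prod_eq] at h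
  obtain ⟨p, hp, q, hq, hpq⟩ := Filter.eventually_prod_iff.mp h
  have hcont : ContinuousAt φ 0 := hφ.continuousAt
  -- The family must itself remain in the neighbourhood where uniqueness is claimed.
  have hU : ∀ᶠ t in 𝓝 (0 : ℝ), q (φ t) := hcont.eventually (by rwa [hφ0])
  -- Analyticity at `0` spreads to nearby times. Mere `C^∞` regularity at one point would not give a
  -- common interval for all orders.
  have hall := (hp.and hU).and (hφ.eventually (by simp))
  obtain ⟨ε, hε, hball⟩ := Metric.eventually_nhds_iff_ball.mp hall
  rw [Real.ball_eq_Ioo, zero_sub, zero_add] at hball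
  have hmem : Set.Ioo (-ε) ε ∈ 𝓝 (0 : ℝ) := Ioo_mem_nhds (by linarith) hε
  refine ⟨ε, hε, {y | q y}, hq, φ, ⟨hφ0, hcont, ?_⟩, fun t ht => ?_, fun t ht y => ?_⟩
  · filter_upwards [hmem] with t ht
    exact (hpq (hball t ht).1.1 (hball t ht).1.2).mpr rfl
  · exact ((hball t ht).2.of_le le_top).contDiffWithinAt
  · constructor
    · rintro ⟨hy, hs⟩
      exact ((hpq (hball t ht).1.1 hy).mp hs).symm
    · rintro rfl
      exact ⟨(hball t ht).1.2, (hpq (hball t ht).1.1 (hball t ht).1.2).mpr rfl⟩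

theorem parity_central : (Param.central ρ).parity = Param.central ρ := by
  obtain ⟨-, ca, cb, cc⟩ := coeff_central (ρ := ρ)
  refine Prod.ext rfl (Prod.ext ?_ (Prod.ext ?_ ?_))
  · change -W.reflect (Param.central ρ).a = (Param.central ρ).a
    rw [ca]
    refine W.ext fun k => ?_
    have hn : (-W.reflect (W.quad 0 1 0 : W ρ)).coeff k = -(W.reflect (W.quad 0 1 0)).coeff k := rfl
    rw [hn, W.coeff_reflect]
    rcases k with _ | _ | k
    · rw [W.coeff_quad_zero]
      norm_num
    · rw [W.coeff_quad_one]
      norm_num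
    · rw [W.coeff_quad_add_two]
      norm_num
  · change W.reflect (Param.central ρ).b = (Param.central ρ).b
    rw [cb]
    refine W.ext fun k => ?_
    rw [W.coeff_reflect]
    rcases k with _ | _ | _ | k
    · rw [pow_zero, one_mul]
    · rw [W.coeff_quad_one, mul_zero]
    · norm_num
    · rw [W.coeff_quad_add_three, mul_zero]
  · change W.reflect (Param.central ρ).c = (Param.central ρ).c
    rw [cc]
    refine W.ext fun k => ?_
    rw [W.coeff_reflect]
    rcases k with _ | _ | k
    · rw [pow_zero, one_mul]
    · rw [W.coeff_quad_one, mul_zero]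
    · rw [W.coeff_quad_add_two, mul_zero]

theorem tendsto_neg_zero : Filter.Tendsto (fun t : ℝ => -t) (𝓝 0) (𝓝 0) := by
  have := (continuous_neg : Continuous fun t : ℝ => -t).tendsto 0
  rwa [neg_zero] at this

/-- Both `x(t)` and the parity transform of `x(-t)` solve the problem at time `t`, and both tend to
the central value, which the transform fixes. Hence both equal the implicit function, which also
gives smoothness. -/
theorem IsSolutionFamily.eventually_parity (hm : 1 ≤ m) {x : ℝ → Param ρ}
    (hx : IsSolutionFamily m x) :
    ContDiffAt ℝ ∞ x 0 ∧ ∀ᶠ t in 𝓝 (0 : ℝ), x (-t) = (x t).parity := by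
  obtain ⟨φ, -, hφ, h⟩ := exists_implicit_family (ρ := ρ) m hm
  obtain ⟨hx0, hxc, hxs⟩ := hx
  have ht1 : Filter.Tendsto (fun t => (t, x t)) (𝓝 0) (𝓝 (0, Param.central ρ)) := by
    have := (continuousAt_id (x := (0 : ℝ))).prodMk hxc
    rwa [ContinuousAt, hx0] at this
  have hy : Filter.Tendsto (fun t => (x (-t)).parity) (𝓝 0) (𝓝 (Param.central ρ)) := by
    rw [← parity_central (ρ := ρ), ← hx0]
    exact (continuous_parity.tendsto _).comp (hxc.tendsto.comp tendsto_neg_zero)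
  have ht2 : Filter.Tendsto (fun t => (t, (x (-t)).parity)) (𝓝 0) (𝓝 (0, Param.central ρ)) :=
    Filter.Tendsto.prodMk_nhds Filter.tendsto_id hy
  have h1 : ∀ᶠ t in 𝓝 (0 : ℝ), φ t = x t := by
    filter_upwards [ht1.eventually h, hxs] with t h1 h2
    exact h1.mp h2
  refine ⟨((hφ.of_le le_top).congr_of_eventuallyEq (h1.mono fun t ht => ht.symm)), ?_⟩
  filter_upwards [ht2.eventually h, h1, tendsto_neg_zero.eventually hxs] with t h2 h3 h4
  rw [← h3, h2.mp (SolvesMonodromyProblem.parity m h4), Param.parity_parity]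

/-- Differentiating `f(-t) = -f(t)(-λ)` an even number of times at `0` leaves no sign on the left,
and the bounded operator `W.reflect` commutes with the derivatives. -/
theorem reflect_iteratedDeriv_of_even {f : ℝ → W ρ} (hf : ContDiffAt ℝ ∞ f 0)
    (h : ∀ᶠ t in 𝓝 (0 : ℝ), f (-t) = -W.reflect (f t)) {k : ℕ} (hk : Even k) :
    W.reflect (iteratedDeriv k f 0) = -iteratedDeriv k f 0 := by
  have h1 : iteratedDeriv k (W.reflect ∘ f) 0 = W.reflect (iteratedDeriv k f 0) := by
    rw [iteratedDeriv_eq_iteratedFDeriv, iteratedDeriv_eq_iteratedFDeriv,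
      W.reflect.iteratedFDeriv_comp_left hf (by exact_mod_cast le_top)]
    rfl
  have h2 : (fun t => f (-t)) =ᶠ[𝓝 0] fun t => -(W.reflect ∘ f) t := h
  have h3 := h2.iteratedDeriv_eq k
  rw [iteratedDeriv_comp_neg, iteratedDeriv_fun_neg, h1, hk.neg_one_pow, one_smul, neg_zero] at h3
  exact (neg_eq_iff_eq_neg.mpr h3).symm

end Family

end

end DPW

theorem mainTheorem10 (m : ℕ) (hm : 1 ≤ m) (ρ : ℝ) [Fact (1 < ρ)] :
    -- the family exists, is smooth and is unique in a neighbourhood of the central value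
    (∃ ε > 0, ∃ U ∈ 𝓝 (Param.central ρ), ∃ x : ℝ → Param ρ,
      IsSolutionFamily m x ∧ ContDiffOn ℝ ∞ x (Set.Ioo (-ε) ε) ∧
      ∀ t ∈ Set.Ioo (-ε) ε, ∀ y : Param ρ,
        (y ∈ U ∧ SolvesMonodromyProblem m t y) ↔ y = x t) ∧
    -- time parity of the potential and of the parameters, and of the derivatives of `a`
    (∀ x : ℝ → Param ρ, IsSolutionFamily m x →
      (∀ᶠ t in 𝓝 (0 : ℝ), PotentialParity m t (x t) (x (-t))) ∧
      (∀ᶠ t in 𝓝 (0 : ℝ), ParamParity (x t) (x (-t))) ∧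
      ContDiffAt ℝ ∞ x 0 ∧
      ∀ k : ℕ, Even k →
        (∀ l : ℂ, ‖l‖ < ρ →
          (iteratedDeriv k (fun t => Param.a (x t)) 0).eval (-l) =
            -(iteratedDeriv k (fun t => Param.a (x t)) 0).eval l) ∧
        (iteratedDeriv k (fun t => Param.a (x t)) 0).eval 0 = 0) ∧
    -- the two forms of the parity are equivalent
    (∀ t : ℝ, t ≠ 0 → ∀ x y : Param ρ, PotentialParity m t x y ↔ ParamParity x y) := by
  refine ⟨exists_unique_solutionFamily m hm, fun x hx => ?_, fun t ht x y => ?_⟩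
  · obtain ⟨hd, hp⟩ := IsSolutionFamily.eventually_parity m hm hx
    refine ⟨?_, ?_, hd, fun k hk => ?_⟩
    · filter_upwards [hp] with t ht
      rw [ht]
      exact potentialParity_of_eq m t (x t)
    · filter_upwards [hp] with t ht
      exact paramParity_iff.mpr ht
    · have hodd := reflect_iteratedDeriv_of_even (f := fun t => Param.a (x t)) hd.snd.fst
        (hp.mono fun t ht => by rw [ht, Param.parity_a]) hk
      have hl (l : ℂ) : (iteratedDeriv k (fun t => Param.a (x t)) 0).eval (-l) =
          -(iteratedDeriv k (fun t => Param.a (x t)) 0).eval l := by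
        rw [← W.eval_reflect, hodd, W.eval_neg]
      refine ⟨fun l _ => hl l, ?_⟩
      have h0 := hl 0
      rw [neg_zero] at h0
      -- An odd function of `λ` vanishes at `λ = 0`.
      exact self_eq_neg.mp h0
  · rw [paramParity_iff]
    exact ⟨fun h => eq_parity_of_potentialParity m ht hm h, fun h => h ▸ potentialParity_of_eq m t x⟩
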